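/- All graphs are finite and simple. A labelling of a graph $G$ with $m$ edges assigns each of $1,\dots,m$ to exactly one edge; it is local antimagic if $S_v\ne S_w$ for every pair of adjacent vertices $v,w$, where $S_v$ is the sum of the labels of the edges meeting $v$. An edge is isolated if it meets no other edge. For a graph $G$ let $p_G$ be the probability that a uniformly random labelling of $G$ is local antimagic. Machine model: a unit-cost word RAM with $w$-bit words, with registers, zero-initialised memory outside the input, the instructions constant, addition modulo $2^w$, truncated subtraction, indirect load and store, jump, comparison jumps ($<$, $=$), and an instruction which draws a fresh uniformly random integer from $\{0,\dots,r-1\}$, where $r$ is the content of a register. A graph on the vertices $0,\dots,n-1$ is given in memory by $n$, $m$ and the list of its $m$ edges, in any order and each in either orientation. The output is a list of $m$ numbers in memory, the $i$-th being the label of the $i$-th edge; it is stored directly after the input. Theorem. There are constants $c>0$, $C$ and $k\in\mathbb N$ and a single randomized word RAM program $P$ such that for every graph $G$ on $n$ vertices with $m\ge1$ edges and no isolated edge, every such input representation of $G$, and every word size $w$ with $2^w\ge(n+m+2)^k$, the following hold. 1. $p_G\ge c/m$. 2. $P$ works in rounds: in each round it writes a labelling of $G$ to the output cells. The labellings of the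 successive rounds are independent and uniformly random, and the program halts after the first round whose labelling is local antimagic. That is, if $f_1,\dots,f_r$ are labellings of which only $f_r$ is local antimagic, then the probability that $P$ halts after precisely $r$ rounds, having sampled $f_1,\dots,f_r$ in this order, is $(1/m!)^r$. 3. The number of rounds is geometric with parameter $p_G$: $P$ halts after precisely $r+1$ rounds with probability $(1-p_G)^r\,p_G$, for every $r\ge0$. 4. With probability $1$, $P$ halts and its output is a local antimagic labelling of $G$. 5. The expected running time (number of executed instructions) of $P$ is at most $C\,m^2$. -/

import Mathlib

open scoped ENNReal NNReal

noncomputable section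

/-! ## Local antimagic labellings -/

/-- No edge of `G` is isolated, i.e. no component of `G` is a `K₂`: every edge meets another edge
at one of its two ends. -/
def NoIsolatedEdge {V : Type} (G : SimpleGraph V) : Prop :=
  ∀ x y : V, G.Adj x y → (∃ z, z ≠ y ∧ G.Adj x z) ∨ (∃ z, z ≠ x ∧ G.Adj y z)

open Classical in
/-- `S_v`, the sum of the labels of the edges meeting the vertex `v`. -/
def vertexSum {V : Type} [Fintype V] (G : SimpleGraph V) (label : G.edgeSet → ℕ) (v : V) : ℕ :=
  ∑ e : G.edgeSet, if v ∈ (e : Sym2 V) then label e else 0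

/-- `label` uses each of `1, …, |E(G)|` exactly once, and the sums at any two neighbouring vertices
are different. -/
def IsLocalAntimagic {V : Type} [Fintype V] (G : SimpleGraph V) (label : G.edgeSet → ℕ) : Prop :=
  Set.BijOn label Set.univ (Set.Icc 1 (Nat.card G.edgeSet)) ∧
    ∀ v w : V, G.Adj v w → vertexSum G label v ≠ vertexSum G label w

/-- The labelling of the edges with `1, …, m` given by a bijection onto `{0, …, m - 1}`. -/
def labelOf {V : Type} {G : SimpleGraph V} {m : ℕ} (f : G.edgeSet ≃ Fin m) : G.edgeSet → ℕ :=
  fun e => (f e : ℕ) + 1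

/-- The probability that a uniformly random labelling of the `m` edges of `G` with `1, …, m`
(each label being used once) is local antimagic. -/
def successProb {V : Type} [Fintype V] (G : SimpleGraph V) : ℝ≥0∞ :=
  (Nat.card {f : G.edgeSet ≃ Fin (Nat.card G.edgeSet) // IsLocalAntimagic G (labelOf f)} : ℝ≥0∞) /
    (Nat.card (G.edgeSet ≃ Fin (Nat.card G.edgeSet)) : ℝ≥0∞)

/-! ## Randomized word RAM -/

/-- Instructions of a word RAM with word size `w`. It has registers `R` and a memory `M`, all of
whose cells hold natural numbers below `2 ^ w`; every instruction takes one unit of time. -/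
inductive Instr : Type
  /-- `R[d] := a mod 2 ^ w` -/
  | const (d a : ℕ)
  /-- `R[d] := (R[a] + R[b]) mod 2 ^ w` -/
  | add (d a b : ℕ)
  /-- `R[d] := R[a] - R[b]`, or `0` if this is negative -/
  | sub (d a b : ℕ)
  /-- `R[d] := M[R[a]]` -/
  | load (d a : ℕ)
  /-- `M[R[a]] := R[s]` -/
  | store (a s : ℕ)
  /-- `R[d] :=` a fresh uniformly random element of `{0, …, R[a] - 1}` (`0` if `R[a] = 0`) -/
  | rand (d a : ℕ)
  /-- go to line `l` -/
  | jump (l : ℕ)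
  /-- if `R[a] < R[b]`, go to line `l` -/
  | jlt (a b l : ℕ)
  /-- if `R[a] = R[b]`, go to line `l` -/
  | jeq (a b l : ℕ)

/-- A program is a finite list of instructions (lines `0, 1, 2, …`), independent of the input and
of the word size. -/
abbrev Program : Type := List Instr

/-- A configuration of the machine: current line, registers, memory. -/
structure Config : Type where
  pc : ℕ
  reg : ℕ → ℕ
  mem : ℕ → ℕ

/-- The machine has halted when the current line is outside of the program. -/
def Halted (P : Program) (c : Config) : Prop := P.length ≤ c.pc

/-- Write `x` into register `d` and go to the next line. -/
def Config.setReg (c : Config) (d x : ℕ) : Config :=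
  { pc := c.pc + 1, reg := Function.update c.reg d x, mem := c.mem }

/-- Continue at line `l` if `b`, and at the next line otherwise. -/
def Config.goto (c : Config) (b : Prop) [Decidable b] (l : ℕ) : Config :=
  { pc := if b then l else c.pc + 1, reg := c.reg, mem := c.mem }

/-- The law of the configuration after executing one instruction. -/
def execInstr (w : ℕ) (c : Config) : Instr → PMF Config
  | .const d a => PMF.pure (c.setReg d (a % 2 ^ w))
  | .add d a b => PMF.pure (c.setReg d ((c.reg a + c.reg b) % 2 ^ w))
  | .sub d a b => PMF.pure (c.setReg d (c.reg a - c.reg b))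
  | .load d a => PMF.pure (c.setReg d (c.mem (c.reg a)))
  | .store a s => PMF.pure
      { pc := c.pc + 1, reg := c.reg, mem := Function.update c.mem (c.reg a) (c.reg s) }
  | .rand d a =>
      (PMF.uniformOfFinset (Finset.range (max (c.reg a) 1))
        (Finset.nonempty_range_iff.mpr (by omega))).map (fun x => c.setReg d x)
  | .jump l => PMF.pure (c.goto True l)
  | .jlt a b l => PMF.pure (c.goto (c.reg a < c.reg b) l)
  | .jeq a b l => PMF.pure (c.goto (c.reg a = c.reg b) l)

/-- The law of the next configuration; nothing happens any more once the machine has halted. -/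
def step (P : Program) (w : ℕ) (c : Config) : PMF Config :=
  match P[c.pc]? with
  | some ins => execInstr w c ins
  | none => PMF.pure c

open Classical in
/-- Append one more configuration to a run, unless the run has halted. A run is the list of
the configurations visited so far, the most recent one first. -/
def extendRun (P : Program) (w : ℕ) : List Config → PMF (List Config)
  | [] => PMF.pure []
  | c :: h => if Halted P c then PMF.pure (c :: h) else (step P w c).map (fun c' => c' :: c :: h)

/-- The law of the run of `P` from `c₀` that is stopped upon halting, but after `t` steps at the
latest. -/
def runLaw (P : Program) (w : ℕ) (c₀ : Config) : ℕ → PMF (List Config)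
  | 0 => PMF.pure [c₀]
  | t + 1 => (runLaw P w c₀ t).bind (extendRun P w)

/-- The probability that `P`, started in `c₀`, eventually halts and that its complete run (a list of
configurations, the final one first) has the property `A`. -/
def haltProb (P : Program) (w : ℕ) (c₀ : Config) (A : List Config → Prop) : ℝ≥0∞ :=
  ⨆ t : ℕ, (runLaw P w c₀ t).toOuterMeasure {h | (∃ c ∈ h.head?, Halted P c) ∧ A h}

/-- The expected running time `E[T] = lim_t E[min(T, t)]`, where `T ∈ ℕ ∪ {∞}` is the number
of instructions executed before halting. (A list of `s + 1` configurations is a run of `s` steps.) -/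
def expectedTime (P : Program) (w : ℕ) (c₀ : Config) : ℝ≥0∞ :=
  ⨆ t : ℕ, ∑' h : List Config, runLaw P w c₀ t h * ((h.length - 1 : ℕ) : ℝ≥0∞)

/-! ## Graphs as inputs, labellings as outputs -/

/-- The initial configuration for a graph with vertices `0, …, n - 1` and `m` edges,
the `i`-th of which has the ends `(ends i).1` and `(ends i).2`. The memory holds
`n, m, (ends 0).1, (ends 0).2, (ends 1).1, (ends 1).2, …` followed by zeros. -/
def initConfig {n m : ℕ} (ends : Fin m → Fin n × Fin n) : Config where
  pc := 0
  reg := fun _ => 0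
  mem := fun a =>
    if a = 0 then n
    else if a = 1 then m
    else if h : (a - 2) / 2 < m then
      if a % 2 = 0 then ((ends ⟨(a - 2) / 2, h⟩).1 : ℕ) else ((ends ⟨(a - 2) / 2, h⟩).2 : ℕ)
    else 0

/-- The sequence of `m` numbers in the memory cells directly after the input; the `i`-th of them is
the label of the `i`-th edge. -/
def readLabels (m : ℕ) (c : Config) : Fin m → ℕ := fun i => c.mem (2 + 2 * m + i)

/-- The labels in the output cells at the successive visits of line `l`, in chronological order. -/
def sampledLabels (m l : ℕ) (h : List Config) : List (Fin m → ℕ) :=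
  (h.reverse.filter (fun c => decide (c.pc = l))).map (readLabels m)

end

/-! For an edge vw the difference S_v − S_w is a signed sum of the labels: the other edges at v
count with 1, the other edges at w with −1, and all the rest, including vw itself, with 0. So there
are p = deg v − 1 positive and q = deg w − 1 negative signs, and p + q ≥ 1 since vw is not isolated.
A union bound over the m edges needs slightly less than 1/m for the probability that this sum
vanishes. The bound is 1/m − 1/(20m²) (`card_labelSum_eq_zero_le`), which leaves a success
probability of at least 1/(20m). Only m = 5, p = q = 2 is worse, with the bound 1/5; but not all
five edges can be of this kind, by counting degrees (`factorial_le_card_goodPerm`).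

Let p ≥ q and κ = p − q. If q = 0 or p = q = 1, the sum never vanishes. Otherwise there are three
cases.

κ = 1: a cyclic shift of the labels by s changes the sum by sκ modulo m, so all residues are equally
likely and the sum is divisible by m with probability 1/m. Reflecting all labels but the largest
turns a zero into a nonzero multiple of m, unless the largest label has a negative sign. These
remaining zeros lead to a sum with κ = 2 at its mean value, which is again bounded by shifts,
together with a parity argument. The result is at most (3/4)/m (`card_labelSum_near_balanced_lt`).

κ = 0: shifts give nothing. But a balanced sum does not change if all labels are lowered by 1, so
removing the element with label 1 gives a recursion whose other terms have κ = ±1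
(`card_labelSum_balanced_step`).

κ ≥ 2: fix the labels of all negative elements but one, and the order of the labels of the remaining
elements. Then the sum is strictly monotone in the label of the last negative element, and varies
too little to take both the value 0 and its mirror image κ(m + 1). These values are equally likely,
which saves a factor of 2 (`card_labelSum_unbalanced_le`).

The program samples by the inside-out Fisher–Yates shuffle, computes the vertex sums, compares them
along each edge and starts again upon failure. It clears only sums at ends of edges, so a round
takes O(m) instructions whatever n is; with success probability Ω(1/m), the expected time is O(m²).
-/

section SignedLabelSums
open Finset Equiv

/-! ### Signed sums of randomly permuted labels -/

variable {n : ℕ}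

/-- The signed sum of the labels `1, …, n`, where the label `i + 1` is given to the element `τ i`,
which counts with the sign `x (τ i)`. -/
def labelSum (x : Fin n → ℤ) (τ : Perm (Fin n)) : ℤ := ∑ i, x (τ i) * ((i : ℤ) + 1)

/-- All signs are `1`, `0` or `-1`; there are `p` positive and `q` negative ones. -/
structure HasSigns (x : Fin n → ℤ) (p q : ℕ) : Prop where
  values : ∀ i, x i = 1 ∨ x i = 0 ∨ x i = -1
  pos : #{i | x i = 1} = p
  neg : #{i | x i = -1} = q

theorem HasSigns.sum_eq {x : Fin n → ℤ} {p q : ℕ} (h : HasSigns x p q) :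
    ∑ i, x i = (p : ℤ) - q := by
  have h1 : ∀ i, x i = (if x i = 1 then 1 else 0) - (if x i = -1 then 1 else 0) := by
    intro i
    rcases h.values i with h | h | h <;> simp [h]
  rw [Finset.sum_congr rfl fun i _ => h1 i, Finset.sum_sub_distrib, ← h.pos, ← h.neg]
  simp

theorem HasSigns.card_zero {x : Fin n → ℤ} {p q : ℕ} (h : HasSigns x p q) :
    #{i | x i = 0} + p + q = n := by
  have h1 : ∀ i, (if x i = 0 then 1 else 0) + (if x i = 1 then 1 else 0) +
      (if x i = -1 then 1 else 0) = 1 := by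
    intro i
    rcases h.values i with h | h | h <;> simp [h]
  rw [← h.pos, ← h.neg, Finset.card_filter, Finset.card_filter, Finset.card_filter,
    ← Finset.sum_add_distrib, ← Finset.sum_add_distrib, Finset.sum_congr rfl fun i _ => h1 i]
  simp

theorem HasSigns.neg_signs {x : Fin n → ℤ} {p q : ℕ} (h : HasSigns x p q) :
    HasSigns (fun i => -x i) q p where
  values i := by rcases h.values i with h | h | h <;> simp [h]
  pos := by simpa [neg_eq_iff_eq_neg] using h.neg
  neg := by simpa [neg_eq_iff_eq_neg] using h.pos

theorem labelSum_neg (x : Fin n → ℤ) (τ : Perm (Fin n)) :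
    labelSum (fun i => -x i) τ = -labelSum x τ := by
  simp [labelSum]

theorem card_filter_succAbove (x : Fin (n + 1) → ℤ) (c : Fin (n + 1)) (a : ℤ) :
    #{i | x i = a} = (if x c = a then 1 else 0) + #{i | x (c.succAbove i) = a} := by
  rw [Finset.card_filter, Fin.sum_univ_succAbove _ c, Finset.card_filter]

theorem HasSigns.remove_zero {x : Fin (n + 1) → ℤ} {p q : ℕ} (h : HasSigns x p q)
    {c : Fin (n + 1)} (hc : x c = 0) : HasSigns (fun i => x (c.succAbove i)) p q where
  values i := h.values _
  pos := by rw [← h.pos, card_filter_succAbove x c]; simp [hc]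
  neg := by rw [← h.neg, card_filter_succAbove x c]; simp [hc]

theorem HasSigns.remove_pos {x : Fin (n + 1) → ℤ} {p q : ℕ} (h : HasSigns x (p + 1) q)
    {c : Fin (n + 1)} (hc : x c = 1) : HasSigns (fun i => x (c.succAbove i)) p q where
  values i := h.values _
  pos := by have := h.pos; rw [card_filter_succAbove x c] at this; simp [hc] at this; omega
  neg := by rw [← h.neg, card_filter_succAbove x c]; simp [hc]

theorem HasSigns.remove_neg {x : Fin (n + 1) → ℤ} {p q : ℕ} (h : HasSigns x p (q + 1))
    {c : Fin (n + 1)} (hc : x c = -1) : HasSigns (fun i => x (c.succAbove i)) p q where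
  values i := h.values _
  pos := by rw [← h.pos, card_filter_succAbove x c]; simp [hc]
  neg := by have := h.neg; rw [card_filter_succAbove x c] at this; simp [hc] at this; omega

/-! ### Removing one element -/

/-- The permutation which maps `b` to `l`, and the other elements in the way `h` does. -/
def insertPerm (b l : Fin (n + 1)) (h : Perm (Fin n)) : Perm (Fin (n + 1)) :=
  (finSuccEquiv' b).trans ((Equiv.optionCongr h).trans (finSuccEquiv' l).symm)

@[simp] theorem insertPerm_self (b l : Fin (n + 1)) (h : Perm (Fin n)) :
    insertPerm b l h b = l := by
  simp [insertPerm]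

@[simp] theorem insertPerm_succAbove (b l : Fin (n + 1)) (h : Perm (Fin n)) (i : Fin n) :
    insertPerm b l h (b.succAbove i) = l.succAbove (h i) := by
  simp [insertPerm]

theorem insertPerm_bijective (b : Fin (n + 1)) :
    Function.Bijective fun s : Fin (n + 1) × Perm (Fin n) => insertPerm b s.1 s.2 := by
  rw [Fintype.bijective_iff_injective_and_card]
  constructor
  · rintro ⟨l, h⟩ ⟨l', h'⟩ he
    have h1 : l = l' := by
      have := DFunLike.congr_fun he b
      simpa using this
    subst h1
    have h2 : h = h' := by
      ext1 i
      have := DFunLike.congr_fun he (b.succAbove i)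
      simpa using this
    rw [h2]
  · simp [Fintype.card_perm, Nat.factorial_succ]

/-- Conditioning on the value at `b`. Below, `b` is either a label and `l` the element that gets it,
or the other way round. -/
theorem card_filter_perm_succ (b : Fin (n + 1)) (Q : Perm (Fin (n + 1)) → Prop)
    [DecidablePred Q] :
    #{τ | Q τ} = ∑ l, #{h : Perm (Fin n) | Q (insertPerm b l h)} := by
  rw [Finset.card_filter,
    ← (Equiv.ofBijective _ (insertPerm_bijective b)).sum_comp, Fintype.sum_prod_type]
  exact Finset.sum_congr rfl fun l _ => (Finset.card_filter _ _).symm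

/-! ### Cyclic shifts of the labels -/

/-- The shift lowers every label by `s` modulo `n`. -/
theorem labelSum_shift [NeZero n] (x : Fin n → ℤ) (τ : Perm (Fin n)) (s : Fin n) :
    (n : ℤ) ∣ labelSum x τ - labelSum x (τ * Equiv.addRight s) - (s : ℤ) * ∑ i, x i := by
  have h1 : labelSum x τ = ∑ i, x (τ (i + s)) * (((i + s : Fin n) : ℤ) + 1) :=
    (Equiv.sum_comp (Equiv.addRight s) fun i => x (τ i) * ((i : ℤ) + 1)).symm
  have h2 : ∑ i, x i = ∑ i, x (τ (i + s)) := by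
    rw [← Equiv.sum_comp τ, ← Equiv.sum_comp (Equiv.addRight s)]
    rfl
  rw [h1, h2, labelSum, Finset.mul_sum, ← Finset.sum_sub_distrib, ← Finset.sum_sub_distrib]
  refine Finset.dvd_sum fun i _ => ?_
  have h3 : (n : ℤ) ∣ ((i + s : Fin n) : ℤ) - i - s := by
    rw [Fin.val_add]
    push_cast
    have := Int.emod_add_mul_ediv ((i : ℤ) + s) n
    exact ⟨-(((i : ℤ) + s) / n), by linarith⟩
  obtain ⟨k, hk⟩ := h3
  refine ⟨x (τ (i + s)) * k, ?_⟩
  simp only [Perm.mul_apply, Equiv.coe_addRight]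
  linear_combination x (τ (i + s)) * hk

/-- By `hg`, shifts preserve the sum modulo `g`; by `hj`, the first `j` shifts change it by
different amounts modulo `n`. So the pairs of a shift and a permutation with sum `c` modulo `n`
embed into the permutations with sum `c` modulo `g`. -/
theorem card_labelSum_dvd_le [NeZero n] (x : Fin n → ℤ) {g j : ℕ} (hn : n = g * j)
    (hg : (g : ℤ) ∣ ∑ i, x i) (hj : ∀ s : ℤ, (n : ℤ) ∣ s * ∑ i, x i → (j : ℤ) ∣ s) (c : ℤ) :
    j * #{τ | (n : ℤ) ∣ labelSum x τ - c} ≤ #{τ | (g : ℤ) ∣ labelSum x τ - c} := by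
  have hgpos : 0 < g := Nat.pos_of_ne_zero fun h => NeZero.ne n (by simp [hn, h])
  have hjn : j ≤ n := by rw [hn]; exact Nat.le_mul_of_pos_left _ hgpos
  let F : Fin j × Perm (Fin n) → Perm (Fin n) := fun s => s.2 * Equiv.addRight (Fin.castLE hjn s.1)
  have hcard : j * #{τ | (n : ℤ) ∣ labelSum x τ - c} =
      #((univ : Finset (Fin j)) ×ˢ ({τ | (n : ℤ) ∣ labelSum x τ - c} : Finset (Perm (Fin n)))) := by
    simp
  rw [hcard]
  have hgn : (g : ℤ) ∣ n := ⟨j, by exact_mod_cast hn⟩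
  refine Finset.card_le_card_of_injOn F ?_ ?_
  · rintro ⟨s, τ⟩ hs
    simp only [coe_product, coe_univ, Set.mem_prod, Set.mem_univ, coe_filter, mem_univ, true_and,
      Set.mem_ofPred_eq] at hs
    simp only [coe_filter, mem_univ, true_and, Set.mem_ofPred_eq, F]
    have h1 := hgn.trans (labelSum_shift x τ (Fin.castLE hjn s))
    have h2 := hgn.trans hs
    have h3 := hg.mul_left ((Fin.castLE hjn s : Fin n) : ℤ)
    have h4 := (h2.sub h1).sub h3
    rw [show labelSum x (τ * Equiv.addRight (Fin.castLE hjn s)) - c = labelSum x τ - c -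
      (labelSum x τ - labelSum x (τ * Equiv.addRight (Fin.castLE hjn s)) -
        ((Fin.castLE hjn s : Fin n) : ℤ) * ∑ i, x i) -
        ((Fin.castLE hjn s : Fin n) : ℤ) * ∑ i, x i by ring]
    exact h4
  · rintro ⟨s, τ⟩ hs ⟨s', τ'⟩ hs' he
    simp only [coe_product, coe_univ, Set.mem_prod, Set.mem_univ, coe_filter, mem_univ, true_and,
      Set.mem_ofPred_eq] at hs hs'
    simp only [F] at he
    have h1 := labelSum_shift x τ (Fin.castLE hjn s)
    have h2 := labelSum_shift x τ' (Fin.castLE hjn s')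
    rw [he] at h1
    have h3 : (n : ℤ) ∣ ((s : ℤ) - s') * ∑ i, x i := by
      have h4 := ((hs.sub h1).sub hs').add h2
      have e1 : ((Fin.castLE hjn s : Fin n) : ℤ) = s := rfl
      have e2 : ((Fin.castLE hjn s' : Fin n) : ℤ) = s' := rfl
      rw [e1, e2] at h4
      obtain ⟨k, hk⟩ := h4
      exact ⟨k, by linear_combination hk⟩
    have h5 := hj _ h3
    have h6 : s = s' := by
      obtain ⟨k, hk⟩ := h5
      have a1 : (s : ℤ) < j := by exact_mod_cast s.2
      have a2 : (s' : ℤ) < j := by exact_mod_cast s'.2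
      have a3 : (0 : ℤ) ≤ s := by positivity
      have a4 : (0 : ℤ) ≤ s' := by positivity
      have hk0 : k = 0 := by
        by_contra hk0
        rcases lt_or_gt_of_ne hk0 with hneg | hpos
        · nlinarith
        · nlinarith
      apply Fin.ext
      rw [hk0] at hk
      omega
    subst h6
    simpa using he

theorem card_labelSum_dvd_le_of_isCoprime [NeZero n] (x : Fin n → ℤ)
    (h : IsCoprime (n : ℤ) (∑ i, x i)) (c : ℤ) :
    n * #{τ | (n : ℤ) ∣ labelSum x τ - c} ≤ n.factorial := by
  refine (card_labelSum_dvd_le x (g := 1) (by simp) (by simp)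
    (fun s hs => h.dvd_of_dvd_mul_right hs) c).trans ?_
  refine (Finset.card_le_univ _).trans ?_
  simp [Fintype.card_perm]

/-! ### Parity -/

/-- The other element of the pair `{2 k, 2 k + 1}`. -/
def pairPartner (hn : Even n) (i : Fin n) : Fin n :=
  ⟨if (i : ℕ) % 2 = 0 then i + 1 else i - 1, by
    obtain ⟨k, hk⟩ := hn
    have := i.2
    split_ifs <;> omega⟩

theorem pairPartner_pairPartner (hn : Even n) (i : Fin n) :
    pairPartner hn (pairPartner hn i) = i := by
  apply Fin.ext
  simp only [pairPartner]
  split_ifs <;> omega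

theorem odd_pairPartner_sub (hn : Even n) (i : Fin n) :
    ¬ (2 : ℤ) ∣ (pairPartner hn i : ℤ) - i := by
  simp only [pairPartner]
  split_ifs <;> omega

theorem pairPartner_ne (hn : Even n) (i : Fin n) : pairPartner hn i ≠ i := by
  intro h
  exact odd_pairPartner_sub hn i (by simp [h])

theorem labelSum_mul_swap (x : Fin n → ℤ) (τ : Perm (Fin n)) {i j : Fin n} (hij : i ≠ j)
    (hi : x (τ i) = 0) :
    labelSum x (τ * swap i j) = labelSum x τ + x (τ j) * ((i : ℤ) - j) := by
  have h1 : labelSum x (τ * swap i j) - labelSum x τ =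
      ∑ k, (x (τ (swap i j k)) - x (τ k)) * ((k : ℤ) + 1) := by
    rw [labelSum, labelSum, ← Finset.sum_sub_distrib]
    exact Finset.sum_congr rfl fun k _ => by simp only [Perm.mul_apply]; ring
  have h2 : ∑ k, (x (τ (swap i j k)) - x (τ k)) * ((k : ℤ) + 1) =
      ∑ k ∈ {i, j}, (x (τ (swap i j k)) - x (τ k)) * ((k : ℤ) + 1) := by
    symm
    apply Finset.sum_subset (Finset.subset_univ _)
    intro k _ hk
    simp only [mem_insert, mem_singleton, not_or] at hk
    rw [swap_apply_of_ne_of_ne hk.1 hk.2]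
    ring
  rw [h2, Finset.sum_pair hij, swap_apply_left, swap_apply_right, hi] at h1
  linarith

/-- The element whose label is paired with that of `z₀` is uniform among the others: exchanging `y`
and `z` matches the two fibres. -/
theorem card_partner_eq (hn : Even n) {z₀ z : Fin n} (hz : z ≠ z₀) :
    (n - 1) * #{τ : Perm (Fin n) | τ (pairPartner hn (τ.symm z₀)) = z} = n.factorial := by
  have h1 : ∀ y ∈ univ.erase z₀, #{τ : Perm (Fin n) | τ (pairPartner hn (τ.symm z₀)) = y} =
      #{τ : Perm (Fin n) | τ (pairPartner hn (τ.symm z₀)) = z} := by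
    intro y hy
    have hy : y ≠ z₀ := by simpa using hy
    refine Finset.card_bij (fun τ _ => swap y z * τ) ?_ ?_ ?_
    · intro τ hτ
      simp only [mem_filter, mem_univ, true_and] at hτ ⊢
      have : (swap y z * τ).symm z₀ = τ.symm z₀ := by
        rw [Equiv.symm_apply_eq]
        simp [swap_apply_of_ne_of_ne hy.symm hz.symm]
      rw [this, Perm.mul_apply, hτ, swap_apply_left]
    · intro a _ b _ h
      exact mul_left_cancel h
    · intro τ hτ
      simp only [mem_filter, mem_univ, true_and] at hτ
      refine ⟨swap y z * τ, ?_, by simp⟩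
      simp only [mem_filter, mem_univ, true_and]
      have : (swap y z * τ).symm z₀ = τ.symm z₀ := by
        rw [Equiv.symm_apply_eq]
        simp [swap_apply_of_ne_of_ne hy.symm hz.symm]
      rw [this, Perm.mul_apply, hτ, swap_apply_right]
  have h2 := Finset.sum_congr rfl h1
  rw [Finset.sum_const, Finset.card_erase_of_mem (mem_univ _), Finset.card_univ, Fintype.card_fin,
    smul_eq_mul] at h2
  rw [← h2, ← Finset.card_eq_sum_card_fiberwise (s := univ)
    (f := fun τ : Perm (Fin n) => τ (pairPartner hn (τ.symm z₀)))]
  · simp [Fintype.card_perm]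
  · intro τ _
    simp only [coe_erase, coe_univ, Set.mem_sdiff, Set.mem_univ, Set.mem_singleton_iff, true_and]
    exact fun h => pairPartner_ne hn _ ((Equiv.eq_symm_apply τ).2 h)

/-- Pair the labels into neighbours and let `z₀` be an element of sign 0. Exchanging it with the
element on the partner label changes the parity of the sum, unless that element has sign 0 as well.
The latter has probability (n − p − q − 1)/(n − 1), and otherwise even and odd sums are matched. -/
theorem card_odd_labelSum_le (hn : Even n) {x : Fin n → ℤ} {p q : ℕ} (hx : HasSigns x p q)
    (h0 : p + q < n) :
    2 * (n - 1) * #{τ | (2 : ℤ) ∣ labelSum x τ - 1} ≤ (2 * n - p - q - 2) * n.factorial := by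
  have hzc := hx.card_zero
  obtain ⟨z₀, hz₀⟩ : ∃ z₀, x z₀ = 0 := by
    have : 0 < #{i | x i = 0} := by omega
    obtain ⟨z, hz⟩ := Finset.card_pos.mp this
    exact ⟨z, by simpa using hz⟩
  set y : Perm (Fin n) → ℤ := fun τ => x (τ (pairPartner hn (τ.symm z₀))) with hy
  set O : Finset (Perm (Fin n)) := {τ | (2 : ℤ) ∣ labelSum x τ - 1} with hO
  set Y : Finset (Perm (Fin n)) := {τ | y τ = 0} with hY
  have hYcard : (n - 1) * #Y = (n - p - q - 1) * n.factorial := by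
    have e1 : #Y = ∑ z ∈ ({i | x i = 0} : Finset (Fin n)).erase z₀,
        #{τ : Perm (Fin n) | τ (pairPartner hn (τ.symm z₀)) = z} := by
      rw [Finset.card_eq_sum_card_fiberwise (s := Y)
        (f := fun τ : Perm (Fin n) => τ (pairPartner hn (τ.symm z₀)))
        (t := ({i | x i = 0} : Finset (Fin n)).erase z₀)]
      · refine Finset.sum_congr rfl fun z hz => ?_
        congr 1
        ext τ
        simp only [mem_filter, hY, mem_univ, true_and, and_iff_right_iff_imp, hy]
        rintro rfl
        simpa using (Finset.mem_erase.mp hz).2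
      · intro τ hτ
        simp only [coe_erase, coe_filter, mem_univ, true_and, Set.mem_sdiff, Set.mem_ofPred_eq,
          Set.mem_singleton_iff]
        refine ⟨by simpa [hY, hy] using hτ, fun h => pairPartner_ne hn _ ((Equiv.eq_symm_apply τ).2 h)⟩
    rw [e1, Finset.mul_sum, Finset.sum_congr rfl fun z hz =>
      card_partner_eq hn (Finset.mem_erase.mp hz).1, Finset.sum_const,
      Finset.card_erase_of_mem (by simp [hz₀]), smul_eq_mul]
    congr 1
    omega
  have hswap : #(O \ Y) ≤ #(univ \ (O ∪ Y)) := by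
    refine Finset.card_le_card_of_injOn
      (fun τ => τ * swap (τ.symm z₀) (pairPartner hn (τ.symm z₀))) ?_ ?_
    · intro τ hτ
      simp only [coe_sdiff, Set.mem_sdiff, mem_coe, hO, hY, mem_filter, mem_univ, true_and] at hτ
      have hne := (pairPartner_ne hn (τ.symm z₀)).symm
      have hD := labelSum_mul_swap x τ hne (by simpa using hz₀)
      have hsymm : (τ * swap (τ.symm z₀) (pairPartner hn (τ.symm z₀))).symm z₀ =
          pairPartner hn (τ.symm z₀) := by
        rw [Equiv.symm_apply_eq]
        simp
      simp only [coe_sdiff, coe_univ, coe_union, Set.mem_sdiff, Set.mem_univ, Set.mem_union,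
        mem_coe, true_and, hO, hY, mem_filter, mem_univ, not_or]
      constructor
      · rw [hD]
        have hodd := odd_pairPartner_sub hn (τ.symm z₀)
        have h2 := hτ.1
        have h3 := hτ.2
        simp only [hy] at h3
        rcases hx.values (τ (pairPartner hn (τ.symm z₀))) with h | h | h
        · rw [h]; omega
        · exact absurd h h3
        · rw [h]; omega
      · simp only [hy]
        rw [hsymm, pairPartner_pairPartner]
        simpa [hy] using hτ.2
    · intro τ _ τ' _ he
      simp only at he
      have hs : ∀ τ : Perm (Fin n),
          (τ * swap (τ.symm z₀) (pairPartner hn (τ.symm z₀))).symm z₀ =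
          pairPartner hn (τ.symm z₀) := by
        intro τ
        rw [Equiv.symm_apply_eq]
        simp
      have h1 : pairPartner hn (τ.symm z₀) = pairPartner hn (τ'.symm z₀) := by
        rw [← hs τ, ← hs τ', he]
      have h2 : τ.symm z₀ = τ'.symm z₀ := by
        rw [← pairPartner_pairPartner hn (τ.symm z₀), h1, pairPartner_pairPartner]
      rw [h2] at he
      exact mul_right_cancel he
  have h1 : #(O \ Y) + #(univ \ (O ∪ Y)) + #Y = n.factorial := by
    have hP : n.factorial = #(univ : Finset (Perm (Fin n))) := by
      rw [Finset.card_univ, Fintype.card_perm, Fintype.card_fin]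
    rw [hP, ← Finset.card_union_of_disjoint, ← Finset.card_union_of_disjoint]
    · congr 1
      ext τ
      simp only [mem_union, mem_sdiff, mem_univ, true_and, iff_true]
      tauto
    · rw [Finset.disjoint_left]
      intro τ
      simp only [mem_union, mem_sdiff, mem_univ, true_and]
      tauto
    · rw [Finset.disjoint_left]
      intro τ
      simp only [mem_union, mem_sdiff, mem_univ, true_and]
      tauto
  have h2 : #O ≤ #(O \ Y) + #Y := by
    rw [← Finset.card_sdiff_add_card_inter O Y]
    exact Nat.add_le_add_left (Finset.card_le_card Finset.inter_subset_right) _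
  have h3 : 2 * #O ≤ n.factorial + #Y := by omega
  calc 2 * (n - 1) * #O = (n - 1) * (2 * #O) := by ring
    _ ≤ (n - 1) * (n.factorial + #Y) := Nat.mul_le_mul_left _ h3
    _ = (n - 1) * n.factorial + (n - 1) * #Y := by ring
    _ = (n - 1 + (n - p - q - 1)) * n.factorial := by rw [hYcard]; ring
    _ = _ := by congr 1; omega

end SignedLabelSums

section SignedLabelSums
open Finset Equiv

variable {n : ℕ}

/-! ### One more positive than negative sign -/

/-- The sum `labelSum` for the labels `n + 1, 1, 2, …, n` in this order. -/
def rotatedLabelSum (x : Fin (n + 1) → ℤ) (τ : Perm (Fin (n + 1))) : ℤ :=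
  x (τ 0) * ((n : ℤ) + 1) + ∑ i : Fin n, x (τ i.succ) * ((i : ℤ) + 1)

theorem labelSum_mul_finRotate (x : Fin (n + 1) → ℤ) (τ : Perm (Fin (n + 1))) :
    labelSum x (τ * finRotate (n + 1)) = rotatedLabelSum x τ := by
  rw [labelSum, Fin.sum_univ_castSucc, rotatedLabelSum, add_comm]
  simp only [Perm.mul_apply, finRotate_apply, Fin.last_add_one, Fin.val_last,
    Fin.coeSucc_eq_succ, Fin.val_castSucc]

theorem card_filter_labelSum (x : Fin (n + 1) → ℤ) (Q : ℤ → Prop) [DecidablePred Q] :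
    #{τ | Q (labelSum x τ)} = #{τ | Q (rotatedLabelSum x τ)} := by
  rw [Finset.card_filter, Finset.card_filter,
    ← Equiv.sum_comp (Equiv.mulRight (finRotate (n + 1)))]
  simp only [Equiv.coe_mulRight, labelSum_mul_finRotate]

/-- The purpose of the rotation: removing position 0 removes the largest label and leaves exactly
the labels 1, …, n. -/
theorem rotatedLabelSum_insertPerm (x : Fin (n + 1) → ℤ) (c : Fin (n + 1)) (e : Perm (Fin n)) :
    rotatedLabelSum x (insertPerm 0 c e) =
      x c * ((n : ℤ) + 1) + labelSum (fun i => x (c.succAbove i)) e := by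
  have h : ∀ i : Fin n, insertPerm 0 c e i.succ = c.succAbove (e i) := fun i => by
    rw [← Fin.succAbove_zero_apply, insertPerm_succAbove]
  simp only [rotatedLabelSum, insertPerm_self, h, labelSum]

/-- The label n + 1 stays in place, and every other label k becomes n + 1 − k. -/
theorem rotatedLabelSum_reflect (x : Fin (n + 1) → ℤ) (τ : Perm (Fin (n + 1))) :
    rotatedLabelSum x (τ * insertPerm 0 0 Fin.revPerm) =
      ((n : ℤ) + 1) * (∑ i, x i + x (τ 0)) - rotatedLabelSum x τ := by
  have h : ∀ i : Fin n, insertPerm 0 0 Fin.revPerm i.succ = (Fin.rev i).succ := fun i => by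
    rw [← Fin.succAbove_zero_apply, insertPerm_succAbove]; simp
  have h1 : ∑ i : Fin n, x (τ (Fin.rev i).succ) * ((i : ℤ) + 1) =
      ∑ i : Fin n, x (τ i.succ) * ((n : ℤ) - i) := by
    rw [← Equiv.sum_comp Fin.revPerm]
    refine Finset.sum_congr rfl fun i _ => ?_
    simp only [Fin.revPerm_apply, Fin.rev_rev, Fin.val_rev]
    have := i.2
    push_cast [Nat.cast_sub (Nat.succ_le_of_lt i.2)]
    ring
  have h2 : ∑ i, x i = x (τ 0) + ∑ i : Fin n, x (τ i.succ) := by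
    rw [← Equiv.sum_comp τ, Fin.sum_univ_succ]
  simp only [rotatedLabelSum, Perm.mul_apply, insertPerm_self, h]
  rw [h1, h2]
  have h3 : ∑ i : Fin n, x (τ i.succ) * ((n : ℤ) - i) =
      ((n : ℤ) + 1) * ∑ i : Fin n, x (τ i.succ) - ∑ i : Fin n, x (τ i.succ) * ((i : ℤ) + 1) := by
    rw [Finset.mul_sum, ← Finset.sum_sub_distrib]
    exact Finset.sum_congr rfl fun i _ => by ring
  rw [h3]
  ring

/-- By the shifts, at most n! permutations have a sum divisible by n + 1. The reflection maps a zero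
to (n + 1)(1 + x(τ 0)), a nonzero multiple of n + 1 unless x(τ 0) = −1. So the zeros outside this
exception are no more than the nonzero multiples; the exceptional zeros are the sum on the right. -/
theorem two_mul_card_labelSum_eq_zero_le (x : Fin (n + 1) → ℤ) (hx : ∑ i, x i = 1) :
    2 * #{τ | labelSum x τ = 0} ≤ n.factorial +
      ∑ c ∈ {c | x c = -1},
        #{e : Perm (Fin n) | labelSum (fun i => x (c.succAbove i)) e = (n : ℤ) + 1} := by
  have hn : ((n : ℤ) + 1) ≠ 0 := by positivity
  have h1 : (n + 1) * #{τ | ((n + 1 : ℕ) : ℤ) ∣ labelSum x τ - 0} ≤ (n + 1).factorial :=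
    card_labelSum_dvd_le_of_isCoprime x (by rw [hx]; exact isCoprime_one_right) 0
  simp only [sub_zero, Nat.factorial_succ] at h1
  have h2 := Nat.le_of_mul_le_mul_left h1 (Nat.succ_pos n)
  rw [card_filter_labelSum x fun d => ((n + 1 : ℕ) : ℤ) ∣ d] at h2
  rw [card_filter_labelSum x fun d => d = 0]
  set Z : Finset (Perm (Fin (n + 1))) := {τ | rotatedLabelSum x τ = 0} with hZ
  set M : Finset (Perm (Fin (n + 1))) := {τ | ((n + 1 : ℕ) : ℤ) ∣ rotatedLabelSum x τ} with hM
  have h3 : #{τ ∈ Z | ¬ x (τ 0) = -1} ≤ #(M \ Z) := by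
    refine Finset.card_le_card_of_injOn (fun τ => τ * insertPerm 0 0 Fin.revPerm) ?_ ?_
    · intro τ hτ
      simp only [coe_filter, hZ, mem_filter, mem_univ, true_and, Set.mem_ofPred_eq] at hτ
      simp only [coe_sdiff, Set.mem_sdiff, mem_coe, hM, hZ, mem_filter, mem_univ, true_and,
        rotatedLabelSum_reflect, hτ.1, hx, sub_zero]
      refine ⟨⟨1 + x (τ 0), by push_cast; ring⟩, ?_⟩
      rw [mul_eq_zero, not_or]
      exact ⟨hn, fun h => hτ.2 (by omega)⟩
    · intro τ _ τ' _ h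
      exact mul_right_cancel h
  have h4 : #(M \ Z) + #Z = #M := by
    apply Finset.card_sdiff_add_card_eq_card
    intro τ
    simp only [hZ, hM, mem_filter, mem_univ, true_and]
    intro h
    rw [h]
    exact dvd_zero _
  have h5 : #{τ ∈ Z | x (τ 0) = -1} = ∑ c ∈ {c | x c = -1},
      #{e : Perm (Fin n) | labelSum (fun i => x (c.succAbove i)) e = (n : ℤ) + 1} := by
    rw [hZ, Finset.filter_filter,
      card_filter_perm_succ 0 fun τ => rotatedLabelSum x τ = 0 ∧ x (τ 0) = -1, Finset.sum_filter]
    refine Finset.sum_congr rfl fun c _ => ?_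
    simp only [rotatedLabelSum_insertPerm, insertPerm_self]
    split_ifs with hc
    · congr 1
      ext e
      simp only [hc, mem_filter, mem_univ, true_and, and_true]
      constructor <;> intro h <;> linarith
    · simp [hc]
  have h6 := Finset.card_filter_add_card_filter_not (s := Z) (fun τ => x (τ 0) = -1)
  omega

/-- Two more positive than negative signs, the value halfway between the extremes. -/
theorem card_labelSum_eq_middle_le {x : Fin n → ℤ} {q : ℕ} (hx : HasSigns x (q + 2) q)
    (h0 : 2 * q + 2 < n) :
    2 * (q + 1) * #{τ | labelSum x τ = (n : ℤ) + 1} ≤ n.factorial ∧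
      (q = 0 → 3 * #{τ | labelSum x τ = (n : ℤ) + 1} ≤ n.factorial) := by
  have : NeZero n := ⟨by omega⟩
  have hκ : ∑ i, x i = 2 := by rw [hx.sum_eq]; push_cast; ring
  have h1 : #{τ | labelSum x τ = (n : ℤ) + 1} ≤ #{τ | (n : ℤ) ∣ labelSum x τ - 1} := by
    apply Finset.card_le_card
    intro τ
    simp only [mem_filter, mem_univ, true_and]
    intro h
    rw [h]
    simp
  rcases Nat.even_or_odd n with he | ho
  · obtain ⟨h, hh⟩ := he
    -- For even n = 2h the shifts change the sum by even amounts only, so they distribute the odd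
    -- sums evenly over h classes; the probability of an odd sum has to be bounded separately.
    have h2 : h * #{τ | (n : ℤ) ∣ labelSum x τ - 1} ≤ #{τ | ((2 : ℕ) : ℤ) ∣ labelSum x τ - 1} := by
      refine card_labelSum_dvd_le x (by omega) (by rw [hκ]; norm_num) ?_ 1
      intro s hs
      rw [hκ, hh] at hs
      push_cast at hs
      obtain ⟨k, hk⟩ := hs
      exact ⟨k, by linarith⟩
    have h3 := card_odd_labelSum_le (n := n) ⟨h, hh⟩ hx (by omega)
    push_cast at h2
    set N := #{τ | labelSum x τ = (n : ℤ) + 1}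
    set M := #{τ | (n : ℤ) ∣ labelSum x τ - 1}
    set O := #{τ | (2 : ℤ) ∣ labelSum x τ - 1}
    set J := n.factorial
    have hhpos : 0 < h := by omega
    -- An even n > 2q + 2 is at least 2q + 4.
    obtain ⟨k, hk⟩ : ∃ k, h = q + 1 + 1 + k := ⟨h - (q + 2), by omega⟩
    have e1 : 2 * n - (q + 2) - q - 2 = 2 * q + 4 + 4 * k := by omega
    have e2 : n - 1 = 2 * q + 2 * k + 3 := by omega
    rw [e1, e2] at h3
    have h4 : h * N ≤ O := (Nat.mul_le_mul_left _ h1).trans h2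
    have h5 : (2 * q + 2 * k + 3) * h * N ≤ (q + 2 + 2 * k) * J := by
      have : 2 * ((2 * q + 2 * k + 3) * h * N) ≤ 2 * ((q + 2 + 2 * k) * J) := by
        calc 2 * ((2 * q + 2 * k + 3) * h * N) = 2 * (2 * q + 2 * k + 3) * (h * N) := by ring
          _ ≤ 2 * (2 * q + 2 * k + 3) * O := Nat.mul_le_mul_left _ h4
          _ ≤ (2 * q + 4 + 4 * k) * J := h3
          _ = _ := by ring
      omega
    have hpos : 0 < (2 * q + 2 * k + 3) * h := by positivity
    constructor
    · apply Nat.le_of_mul_le_mul_left _ hpos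
      calc (2 * q + 2 * k + 3) * h * (2 * (q + 1) * N)
          = 2 * (q + 1) * ((2 * q + 2 * k + 3) * h * N) := by ring
        _ ≤ 2 * (q + 1) * ((q + 2 + 2 * k) * J) := Nat.mul_le_mul_left _ h5
        _ = 2 * (q + 1) * (q + 2 + 2 * k) * J := by ring
        _ ≤ (2 * q + 2 * k + 3) * h * J := by
            apply Nat.mul_le_mul_right
            rw [hk]
            zify
            nlinarith [sq_nonneg ((k : ℤ)), Int.natCast_nonneg k, Int.natCast_nonneg q]
    · intro hq
      subst hq
      apply Nat.le_of_mul_le_mul_left _ hpos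
      calc (2 * 0 + 2 * k + 3) * h * (3 * N)
          = 3 * ((2 * 0 + 2 * k + 3) * h * N) := by ring
        _ ≤ 3 * ((0 + 2 + 2 * k) * J) := Nat.mul_le_mul_left _ h5
        _ = (6 + 6 * k) * J := by ring
        _ ≤ (2 * 0 + 2 * k + 3) * h * J := by
            apply Nat.mul_le_mul_right
            rw [hk]
            -- For k = 0, which means n = 4, both sides are equal, so 3 is the best constant that
            -- this estimate gives.
            rcases k with _ | k
            · norm_num
            · zify
              push_cast
              nlinarith [Int.natCast_nonneg k]
  · have h2 : n * #{τ | (n : ℤ) ∣ labelSum x τ - 1} ≤ n.factorial := by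
      refine card_labelSum_dvd_le_of_isCoprime x ?_ 1
      rw [hκ]
      have := (Nat.coprime_two_right).2 ho
      exact_mod_cast Nat.isCoprime_iff_coprime.2 this
    have h3 := (Nat.mul_le_mul_left n h1).trans h2
    constructor
    · exact (Nat.mul_le_mul_right _ (by omega)).trans h3
    · intro hq
      exact (Nat.mul_le_mul_right _ (by omega)).trans h3

/-- The plain bound from the shifts. Unlike the next one it does not need an element of sign 0, so
it can start the recursion for balanced signs. -/
theorem card_labelSum_near_balanced_le {x : Fin (n + 1) → ℤ} {q : ℕ}
    (hx : HasSigns x (q + 1) q) : #{τ | labelSum x τ = 0} ≤ n.factorial := by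
  have hκ : ∑ i, x i = 1 := by rw [hx.sum_eq]; push_cast; ring
  have h1 : (n + 1) * #{τ | ((n + 1 : ℕ) : ℤ) ∣ labelSum x τ - 0} ≤ (n + 1).factorial :=
    card_labelSum_dvd_le_of_isCoprime x (by rw [hκ]; exact isCoprime_one_right) 0
  rw [Nat.factorial_succ] at h1
  refine (Finset.card_le_card ?_).trans (Nat.le_of_mul_le_mul_left h1 (Nat.succ_pos n))
  intro τ
  simp only [mem_filter, mem_univ, true_and]
  intro h
  simp [h]

/-- There are q + 1 negative elements which can carry the largest label, and each contributes at
most n!/(2(q + 1)) zeros. So twice the number of zeros is at most n! + n!/2, and at most n! + n!/3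
for q = 0. -/
theorem card_labelSum_near_balanced_lt {x : Fin (n + 1) → ℤ} {q : ℕ}
    (hx : HasSigns x (q + 2) (q + 1)) (h0 : 2 * q + 2 < n) :
    4 * #{τ | labelSum x τ = 0} ≤ 3 * n.factorial ∧
      (q = 0 → 3 * #{τ | labelSum x τ = 0} ≤ 2 * n.factorial) := by
  have hκ : ∑ i, x i = 1 := by rw [hx.sum_eq]; push_cast; ring
  have h1 := two_mul_card_labelSum_eq_zero_le x hκ
  have h2 : ∀ c ∈ ({c | x c = -1} : Finset (Fin (n + 1))), _ := fun c hc =>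
    card_labelSum_eq_middle_le (hx.remove_neg (c := c) (by simpa using hc)) h0
  have h3 := Finset.sum_le_sum fun c hc => (h2 c hc).1
  rw [← Finset.mul_sum, Finset.sum_const, hx.neg, smul_eq_mul] at h3
  have h4 : 2 * ∑ c ∈ {c | x c = -1},
        #{e : Perm (Fin n) | labelSum (fun i => x (c.succAbove i)) e = (n : ℤ) + 1} ≤
      n.factorial := by
    apply Nat.le_of_mul_le_mul_left _ (Nat.succ_pos q)
    calc _ = _ := by rw [← mul_assoc, mul_comm (q + 1) 2]
      _ ≤ _ := h3
  refine ⟨by omega, fun hq => ?_⟩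
  have h5 := Finset.sum_le_sum fun c hc => (h2 c hc).2 hq
  rw [← Finset.mul_sum, Finset.sum_const, hx.neg, smul_eq_mul, hq] at h5
  omega

/-! ### As many positive as negative signs -/

/-- Here `c` has the label 1. Lowering all labels by 1 does not change a balanced sum, and then `c`
contributes 0 and the other elements have the labels 1, …, n. -/
theorem labelSum_insertPerm_of_sum_eq_zero (x : Fin (n + 1) → ℤ) (hx : ∑ i, x i = 0)
    (c : Fin (n + 1)) (e : Perm (Fin n)) :
    labelSum x (insertPerm 0 c e) = labelSum (fun i => x (c.succAbove i)) e := by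
  have h : ∀ i : Fin n, insertPerm 0 c e i.succ = c.succAbove (e i) := fun i => by
    rw [← Fin.succAbove_zero_apply, insertPerm_succAbove]
  have h1 : x c + ∑ i, x (c.succAbove (e i)) = 0 := by
    rw [Equiv.sum_comp e fun i => x (c.succAbove i), ← hx, Fin.sum_univ_succAbove _ c]
  rw [labelSum, Fin.sum_univ_succ, labelSum]
  simp only [insertPerm_self, h, Fin.val_zero, Fin.val_succ]
  push_cast
  have h2 : ∑ i : Fin n, x (c.succAbove (e i)) * ((i : ℤ) + 1 + 1) =
      ∑ i : Fin n, x (c.succAbove (e i)) * ((i : ℤ) + 1) + ∑ i : Fin n, x (c.succAbove (e i)) := by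
    rw [← Finset.sum_add_distrib]
    exact Finset.sum_congr rfl fun i _ => by ring
  rw [h2]
  linarith

/-- Split according to the element with label 1. If its sign is 0, the rest is balanced (`hU`);
otherwise the rest is off balance by one (`hG`, after a change of all signs if a positive element
was removed). The factor `K` clears denominators. -/
theorem card_labelSum_balanced_step {p K U G : ℕ} {x : Fin (n + 1) → ℤ}
    (hx : HasSigns x (p + 1) (p + 1))
    (hU : ∀ y : Fin n → ℤ, HasSigns y (p + 1) (p + 1) → K * #{τ | labelSum y τ = 0} ≤ U)
    (hG : ∀ y : Fin n → ℤ, HasSigns y (p + 1) p → K * #{τ | labelSum y τ = 0} ≤ G) :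
    K * #{τ | labelSum x τ = 0} ≤ (n + 1 - 2 * (p + 1)) * U + 2 * (p + 1) * G := by
  have hκ : ∑ i, x i = 0 := by rw [hx.sum_eq]; push_cast; ring
  rw [card_filter_perm_succ 0 fun τ => labelSum x τ = 0, Finset.mul_sum]
  simp only [labelSum_insertPerm_of_sum_eq_zero x hκ]
  have h1 : ∀ c, K * #{e : Perm (Fin n) | labelSum (fun i => x (c.succAbove i)) e = 0} ≤
      (if x c = 0 then 1 else 0) * U + (if x c = 1 then 1 else 0) * G +
      (if x c = -1 then 1 else 0) * G := by
    intro c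
    rcases hx.values c with h | h | h
    · have h2 := hG _ (hx.remove_pos h).neg_signs
      simp only [labelSum_neg, neg_eq_zero] at h2
      simpa [h] using h2
    · simpa [h] using hU _ (hx.remove_zero h)
    · simpa [h] using hG _ (hx.remove_neg h)
  refine (Finset.sum_le_sum fun c _ => h1 c).trans ?_
  rw [Finset.sum_add_distrib, Finset.sum_add_distrib, ← Finset.sum_mul, ← Finset.sum_mul,
    ← Finset.sum_mul, ← Finset.card_filter, ← Finset.card_filter, ← Finset.card_filter,
    hx.pos, hx.neg]
  have := hx.card_zero
  rw [show #{i | x i = 0} = n + 1 - 2 * (p + 1) by omega]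
  apply le_of_eq
  ring

/-- Without elements of sign 0 the balanced branch of the recursion is void. The resulting
probability 1/(2p + 1) is above 1/(2p + 2); the gain appears only once there are elements of sign 0.
-/
theorem card_labelSum_balanced_base {p : ℕ} {x : Fin (2 * p + 2) → ℤ}
    (hx : HasSigns x (p + 1) (p + 1)) :
    #{τ | labelSum x τ = 0} ≤ 2 * (p + 1) * (2 * p).factorial := by
  have h := card_labelSum_balanced_step (n := 2 * p + 1) (K := 1) (U := 0)
    (G := (2 * p).factorial) hx ?_ ?_
  · simpa using h
  · intro y hy
    have := hy.card_zero
    omega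
  · intro y hy
    simpa using card_labelSum_near_balanced_le hy

/-- Induction on the number of elements of sign 0: the near-balanced terms have the constant 15/20 =
3/4, so 19/20 persists once it is reached. -/
theorem card_labelSum_balanced_le {p : ℕ} (hp : 2 ≤ p) (k : ℕ) {x : Fin (2 * p + 2 + 1 + k) → ℤ}
    (hx : HasSigns x (p + 1) (p + 1)) :
    20 * #{τ | labelSum x τ = 0} ≤ 19 * (2 * p + 2 + k).factorial := by
  obtain ⟨q, rfl⟩ : ∃ q, p = q + 1 := ⟨p - 1, by omega⟩
  have hG : ∀ k, ∀ y : Fin (2 * (q + 1) + 2 + k) → ℤ, HasSigns y (q + 1 + 1) (q + 1) →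
      20 * #{τ | labelSum y τ = 0} ≤ 15 * (2 * (q + 1) + 1 + k).factorial := by
    intro k y hy
    obtain ⟨N, hN⟩ : ∃ N, 2 * (q + 1) + 2 + k = N + 1 := ⟨2 * (q + 1) + 1 + k, by omega⟩
    have hN' : 2 * (q + 1) + 1 + k = N := by omega
    revert y
    rw [hN, hN']
    intro y hy
    have := (card_labelSum_near_balanced_lt hy (by omega)).1
    omega
  induction k with
  | zero =>
    have h := card_labelSum_balanced_step (n := 2 * (q + 1) + 2) (K := 20) hx
      (fun y hy => Nat.mul_le_mul_left 20 (card_labelSum_balanced_base hy))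
      (hG 0)
    refine h.trans ?_
    have e1 : 2 * (q + 1) + 2 + 1 - 2 * (q + 1 + 1) = 1 := by omega
    rw [e1]
    have e2 : (2 * (q + 1) + 1 + 0).factorial = (2 * q + 3) * (2 * (q + 1)).factorial := by
      rw [show 2 * (q + 1) + 1 + 0 = 2 * (q + 1) + 1 by ring, Nat.factorial_succ]
      ring
    have e3 : (2 * (q + 1) + 2 + 0).factorial =
        (2 * q + 4) * ((2 * q + 3) * (2 * (q + 1)).factorial) := by
      rw [show 2 * (q + 1) + 2 + 0 = 2 * (q + 1) + 1 + 1 by ring, Nat.factorial_succ,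
        Nat.factorial_succ]
      ring
    rw [e2, e3]
    set J := (2 * (q + 1)).factorial
    -- This fits the weaker base bound into the margin between 15 and 19. It needs 2q + 3 ≥ 5, hence
    -- p ≥ 2.
    have : 20 * J ≤ 4 * ((2 * q + 3) * J) := by
      rw [← mul_assoc]
      exact Nat.mul_le_mul_right _ (by omega)
    calc 1 * (20 * (2 * (q + 1 + 1) * J)) + 2 * (q + 1 + 1) * (15 * ((2 * q + 3) * J))
        = (2 * q + 4) * (20 * J + 15 * ((2 * q + 3) * J)) := by ring
      _ ≤ (2 * q + 4) * (4 * ((2 * q + 3) * J) + 15 * ((2 * q + 3) * J)) := by gcongr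
      _ = _ := by ring
  | succ k ih =>
    have h := card_labelSum_balanced_step (n := 2 * (q + 1) + 2 + 1 + k) (K := 20) hx
      (fun y hy => ih hy)
      (fun y hy => by
        have := hG (k + 1)
        rw [show 2 * (q + 1) + 2 + (k + 1) = 2 * (q + 1) + 2 + 1 + k by ring,
          show 2 * (q + 1) + 1 + (k + 1) = 2 * (q + 1) + 2 + k by ring] at this
        exact this y hy)
    refine h.trans ?_
    rw [show 2 * (q + 1) + 2 + (k + 1) = (2 * (q + 1) + 2 + k) + 1 by ring, Nat.factorial_succ]
    set J := (2 * (q + 1) + 2 + k).factorial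
    rw [show 2 * (q + 1) + 2 + 1 + k + 1 - 2 * (q + 1 + 1) = k + 2 by omega]
    calc (k + 2) * (19 * J) + 2 * (q + 1 + 1) * (15 * J)
        = ((k + 2) * 19 + 2 * (q + 1 + 1) * 15) * J := by ring
      _ ≤ (19 * (2 * (q + 1) + 2 + k + 1)) * J := Nat.mul_le_mul_right _ (by omega)
      _ = _ := by ring

theorem card_labelSum_two_two_near (k : ℕ) {y : Fin (k + 4) → ℤ} (hy : HasSigns y 2 1) :
    3 * #{τ | labelSum y τ = 0} ≤ 2 * (k + 3).factorial :=
  (card_labelSum_near_balanced_lt hy (by omega)).2 rfl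

/-- With a single element of sign 0 the recursion gives just 4!, the probability 1/5 without any
gain. This is the exceptional case. -/
theorem card_labelSum_two_two_five {x : Fin 5 → ℤ} (hx : HasSigns x 2 2) :
    #{τ | labelSum x τ = 0} ≤ 24 := by
  have h : 3 * #{τ | labelSum x τ = 0} ≤ (4 + 1 - 2 * (1 + 1)) * 24 + 2 * (1 + 1) * 12 :=
    card_labelSum_balanced_step (n := 4) (p := 1) (K := 3) (U := 24) (G := 12) hx
    (fun y hy => by
      have : #{τ | labelSum y τ = 0} ≤ 2 * (1 + 1) * 2 :=
        card_labelSum_balanced_base (p := 1) hy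
      omega)
    (fun y hy => by simpa [Nat.factorial] using card_labelSum_two_two_near 0 hy)
  omega

/-- A second element of sign 0 suffices: for six elements the recursion gives 336/3 = 112, below 19
· 120/20 = 114. From there on 19/20 persists, as the near-balanced terms have the constant 2/3; 60
is the common denominator. -/
theorem card_labelSum_two_two_le (k : ℕ) {x : Fin (k + 6) → ℤ} (hx : HasSigns x 2 2) :
    20 * #{τ | labelSum x τ = 0} ≤ 19 * (k + 5).factorial := by
  induction k with
  | zero =>
    have h : 3 * #{τ | labelSum x τ = 0} ≤ (5 + 1 - 2 * (1 + 1)) * 72 + 2 * (1 + 1) * 48 :=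
      card_labelSum_balanced_step (n := 5) (p := 1) (K := 3) (U := 72) (G := 48) hx
      (fun y hy => by
        have := card_labelSum_two_two_five hy
        omega)
      (fun y hy => by simpa [Nat.factorial] using card_labelSum_two_two_near 1 hy)
    have e : (0 + 5).factorial = 120 := rfl
    rw [e]
    omega
  | succ k ih =>
    have h : 60 * #{τ | labelSum x τ = 0} ≤ (k + 6 + 1 - 2 * (1 + 1)) *
        (57 * (k + 5).factorial) + 2 * (1 + 1) * (40 * (k + 5).factorial) :=
      card_labelSum_balanced_step (n := k + 6) (p := 1) (K := 60)
      (U := 57 * (k + 5).factorial) (G := 40 * (k + 5).factorial) hx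
      (fun y hy => by have := ih hy; omega)
      (fun y hy => by
        have : 3 * #{τ | labelSum y τ = 0} ≤ 2 * (k + 5).factorial :=
          card_labelSum_two_two_near (k + 2) hy
        omega)
    rw [show k + 1 + 5 = k + 5 + 1 by ring, Nat.factorial_succ]
    rw [show k + 6 + 1 - 2 * (1 + 1) = k + 3 by omega] at h
    have e : 3 * (19 * ((k + 5 + 1) * (k + 5).factorial)) =
      (k + 3) * (57 * (k + 5).factorial) + 171 * (k + 5).factorial := by ring
    have e2 : 2 * (1 + 1) * (40 * (k + 5).factorial) = 160 * (k + 5).factorial := by ring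
    omega

/-! ### Unbalanced signs -/

/-- The labels `a i` are arbitrary here. The least sign is that of `b`, and `b` alone has it. -/
theorem card_perm_two_values_le_of_unique {x : Fin (n + 1) → ℤ} {b : Fin (n + 1)} (hb : x b = -1)
    (hx : ∀ i, i ≠ b → 0 ≤ x i ∧ x i ≤ 1) {a : Fin (n + 1) → ℤ} (ha : StrictMono a) {W u v : ℤ}
    (hW : a (Fin.last n) - a 0 ≤ W) (huv : u + 2 * W < v) :
    #{f : Perm (Fin (n + 1)) | ∑ i, x i * a (f i) = u ∨ ∑ i, x i * a (f i) = v} ≤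
      n.factorial := by
  -- Adding the constant ∑ a raises all coefficients by 1: that of `b` becomes 0 and the others lie
  -- between 1 and 2.
  have hval : ∀ l h, ∑ i, x i * a (insertPerm b l h i) =
      ∑ i, (x (b.succAbove i) + 1) * a (l.succAbove (h i)) - ∑ i, a i := by
    intro l h
    rw [Fin.sum_univ_succAbove _ b, Fin.sum_univ_succAbove a l,
      ← Equiv.sum_comp h fun i => a (l.succAbove i)]
    simp only [insertPerm_self, insertPerm_succAbove, hb, add_mul, one_mul, Finset.sum_add_distrib]
    ring
  have hx' : ∀ i, 1 ≤ x (b.succAbove i) + 1 ∧ x (b.succAbove i) + 1 ≤ 2 := fun i => by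
    have := hx _ (Fin.succAbove_ne b i)
    omega
  have hmono : ∀ (l l' : Fin (n + 1)) (j : Fin n), l ≤ l' →
      a (l'.succAbove j) ≤ a (l.succAbove j) := by
    intro l l' j hl
    apply ha.monotone
    rw [Fin.le_def] at hl ⊢
    simp only [Fin.succAbove, Fin.lt_def, Fin.val_castSucc]
    split_ifs <;> simp <;> omega
  -- If `b` moves from `l` up to `l'`, the labels of the others go down by `a l' - a l` in total.
  -- With coefficients in [1, 2] the sum strictly decreases, but by at most 2W. So for fixed `h` at
  -- most one `l` can produce either of `u` and `v`.
  have hlt : ∀ (l l' : Fin (n + 1)) (h : Perm (Fin n)), l < l' →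
      ∑ i, x i * a (insertPerm b l' h i) < ∑ i, x i * a (insertPerm b l h i) ∧
      ∑ i, x i * a (insertPerm b l h i) ≤ ∑ i, x i * a (insertPerm b l' h i) + 2 * W := by
    intro l l' h hl
    have hd : ∑ i, (a (l.succAbove (h i)) - a (l'.succAbove (h i))) = a l' - a l := by
      have e1 := Fin.sum_univ_succAbove a l
      have e2 := Fin.sum_univ_succAbove a l'
      rw [← Equiv.sum_comp h] at e1 e2
      rw [Finset.sum_sub_distrib]
      linarith
    have hD : ∑ i, x i * a (insertPerm b l h i) - ∑ i, x i * a (insertPerm b l' h i) =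
        ∑ i, (x (b.succAbove i) + 1) * (a (l.succAbove (h i)) - a (l'.succAbove (h i))) := by
      rw [hval, hval]
      simp only [mul_sub, Finset.sum_sub_distrib]
      ring
    have h1 : ∑ i, (a (l.succAbove (h i)) - a (l'.succAbove (h i))) ≤
        ∑ i, (x (b.succAbove i) + 1) * (a (l.succAbove (h i)) - a (l'.succAbove (h i))) :=
      Finset.sum_le_sum fun i _ => by
        nlinarith [hmono l l' (h i) hl.le, (hx' i).1]
    have h2 : ∑ i, (x (b.succAbove i) + 1) * (a (l.succAbove (h i)) - a (l'.succAbove (h i))) ≤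
        2 * ∑ i, (a (l.succAbove (h i)) - a (l'.succAbove (h i))) := by
      rw [Finset.mul_sum]
      exact Finset.sum_le_sum fun i _ => by
        nlinarith [hmono l l' (h i) hl.le, (hx' i).2]
    have h3 : a l < a l' := ha hl
    have h4 : a l' ≤ a (Fin.last n) := ha.monotone (Fin.le_last _)
    have h5 : a 0 ≤ a l := ha.monotone (Fin.zero_le _)
    constructor <;> linarith
  rw [card_filter_perm_succ b fun f => ∑ i, x i * a (f i) = u ∨ ∑ i, x i * a (f i) = v]
  simp only [Finset.card_filter]
  rw [Finset.sum_comm]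
  calc _ ≤ ∑ _h : Perm (Fin n), 1 := by
        refine Finset.sum_le_sum fun h _ => ?_
        rw [← Finset.card_filter, Finset.card_le_one]
        intro l hl l' hl'
        simp only [mem_filter, mem_univ, true_and] at hl hl'
        rcases lt_trichotomy l l' with hll | hll | hll
        · have := hlt l l' h hll
          have h0 : 0 ≤ W := by linarith [ha.monotone (Fin.zero_le (Fin.last n))]
          exfalso
          rcases hl with hl | hl <;> rcases hl' with hl' | hl' <;> linarith
        · exact hll
        · have := hlt l' l h hll
          have h0 : 0 ≤ W := by linarith [ha.monotone (Fin.zero_le (Fin.last n))]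
          exfalso
          rcases hl with hl | hl <;> rcases hl' with hl' | hl' <;> linarith
    _ = n.factorial := by simp [Fintype.card_perm]

/-- Condition on the labels of negative elements until a single one is left. The labels that remain
have gaps, which is why `a` is arbitrary; both values are moved by the removed label, so their
distance is unchanged. -/
theorem card_perm_two_values_le {p : ℕ} (q : ℕ) : ∀ {m : ℕ}, m = n + 1 + q → ∀ {x : Fin m → ℤ},
    HasSigns x p (q + 1) → ∀ {a : Fin m → ℤ}, StrictMono a → ∀ {W u v : ℤ},
    (∀ i j, a i - a j ≤ W) → u + 2 * W < v →
    (n + 1) * #{f : Perm (Fin m) | ∑ i, x i * a (f i) = u ∨ ∑ i, x i * a (f i) = v} ≤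
      m.factorial := by
  induction q with
  | zero =>
    intro m hm x hx a ha W u v hW huv
    obtain rfl : m = n + 1 := hm
    obtain ⟨b, hb⟩ := Finset.card_eq_one.mp hx.neg
    have hb' : ∀ i, x i = -1 ↔ i = b := fun i => by
      have : i ∈ ({i | x i = -1} : Finset (Fin (n + 1))) ↔ i ∈ ({b} : Finset (Fin (n + 1))) := by
        rw [← hb]
      simpa using this
    rw [Nat.factorial_succ]
    refine Nat.mul_le_mul_left _ ?_
    refine card_perm_two_values_le_of_unique (n := n) ((hb' b).2 rfl) (fun i hi => ?_) ha
      (hW _ _) huv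
    rcases hx.values i with h | h | h
    · omega
    · omega
    · exact absurd ((hb' i).1 h) hi
  | succ q ih =>
    intro m hm x hx a ha W u v hW huv
    obtain ⟨k, rfl⟩ : ∃ k, m = k + 1 := ⟨n + 1 + q, by omega⟩
    obtain ⟨b, hb⟩ : ∃ b, x b = -1 := by
      have h : 0 < #{i | x i = -1} := by rw [hx.neg]; omega
      obtain ⟨b, hb⟩ := Finset.card_pos.mp h
      exact ⟨b, by simpa using hb⟩
    rw [card_filter_perm_succ b fun f => ∑ i, x i * a (f i) = u ∨ ∑ i, x i * a (f i) = v,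
      Finset.mul_sum, Nat.factorial_succ]
    calc _ ≤ ∑ _l : Fin (k + 1), k.factorial := by
          refine Finset.sum_le_sum fun l _ => ?_
          have h := ih (m := k) (by omega) (hx.remove_neg hb)
            (ha.comp (Fin.strictMono_succAbove l)) (W := W) (u := u + a l) (v := v + a l)
            (fun i j => hW _ _) (by linarith)
          refine le_trans (le_of_eq ?_) h
          congr 2
          ext f
          simp only [mem_filter, mem_univ, true_and, Fin.sum_univ_succAbove _ b, insertPerm_self,
            insertPerm_succAbove, hb, Function.comp_apply]
          constructor <;> rintro (h | h) <;> [left; right; left; right] <;> linarith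
      _ = _ := by simp

/-- Replacing every label k by m + 1 − k exchanges the values 0 and κ(m + 1), where κ = p − (q + 1),
so these are equally likely. The bound for both values together therefore counts the zeros twice. -/
theorem card_labelSum_unbalanced_le {m p q : ℕ} (hm : m = n + 1 + q) {x : Fin m → ℤ}
    (hx : HasSigns x p (q + 1)) (hpq : q + 3 ≤ p) :
    2 * (n + 1) * #{τ | labelSum x τ = 0} ≤ m.factorial := by
  have hinv : ∀ f : Perm (Fin m), labelSum x f.symm = ∑ i, x i * ((f i : ℤ) + 1) := fun f => by
    rw [labelSum, ← Equiv.sum_comp f]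
    simp
  have hκ : ∑ i, x i = (p : ℤ) - (q + 1) := by rw [hx.sum_eq]; push_cast; ring
  have h1 : (n + 1) * #{f : Perm (Fin m) | ∑ i, x i * ((f i : ℤ) + 1) = 0 ∨
      ∑ i, x i * ((f i : ℤ) + 1) = ((p : ℤ) - (q + 1)) * (m + 1)} ≤ m.factorial := by
    exact card_perm_two_values_le q hm hx (a := fun i => (i : ℤ) + 1)
      (fun i j h => by simpa using h) (W := (m : ℤ) - 1)
      (fun i j => by have := i.2; omega)
      -- The values are far enough apart: κ ≥ 2 gives κ(m + 1) > 2(m − 1).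
      (by
        have : (2 : ℤ) ≤ (p : ℤ) - (q + 1) := by omega
        nlinarith)
  have h2 : #{f : Perm (Fin m) | ∑ i, x i * ((f i : ℤ) + 1) = 0 ∨
        ∑ i, x i * ((f i : ℤ) + 1) = ((p : ℤ) - (q + 1)) * (m + 1)} =
      #{f : Perm (Fin m) | ∑ i, x i * ((f i : ℤ) + 1) = 0} +
      #{f : Perm (Fin m) | ∑ i, x i * ((f i : ℤ) + 1) = ((p : ℤ) - (q + 1)) * (m + 1)} := by
    rw [Finset.filter_or, Finset.card_union_of_disjoint]
    rw [Finset.disjoint_filter]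
    intro f _ h h'
    rw [h] at h'
    have : (0 : ℤ) < ((p : ℤ) - (q + 1)) * (m + 1) := by
      apply mul_pos <;> omega
    omega
  have h3 : #{τ | labelSum x τ = 0} =
      #{f : Perm (Fin m) | ∑ i, x i * ((f i : ℤ) + 1) = 0} := by
    rw [Finset.card_filter, Finset.card_filter, ← Equiv.sum_comp (Equiv.inv (Perm (Fin m)))]
    refine Finset.sum_congr rfl fun f _ => ?_
    have : (Equiv.inv (Perm (Fin m))) f = f.symm := rfl
    rw [this, hinv]
  have h4 : #{f : Perm (Fin m) | ∑ i, x i * ((f i : ℤ) + 1) = 0} =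
      #{f : Perm (Fin m) | ∑ i, x i * ((f i : ℤ) + 1) = ((p : ℤ) - (q + 1)) * (m + 1)} := by
    rw [Finset.card_filter, Finset.card_filter, ← Equiv.sum_comp (Equiv.mulLeft Fin.revPerm)]
    refine Finset.sum_congr rfl fun f _ => ?_
    have e : ∑ i, x i * (((Equiv.mulLeft Fin.revPerm f) i : ℤ) + 1) =
        ((p : ℤ) - (q + 1)) * (m + 1) - ∑ i, x i * ((f i : ℤ) + 1) := by
      rw [← hκ, Finset.sum_mul, ← Finset.sum_sub_distrib]
      refine Finset.sum_congr rfl fun i _ => ?_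
      simp only [Equiv.coe_mulLeft, Perm.mul_apply, Fin.revPerm_apply, Fin.val_rev]
      push_cast [Nat.cast_sub (Nat.succ_le_of_lt (f i).2)]
      ring
    rw [e]
    congr 1
    apply propext
    constructor <;> intro h <;> linarith
  rw [h2, ← h4, ← h3] at h1
  refine le_trans (le_of_eq ?_) h1
  ring

/-! ### The bound for all signs -/

theorem labelSum_pos_of_no_neg {p : ℕ} {x : Fin n → ℤ} (hx : HasSigns x p 0) (hp : 0 < p)
    (τ : Perm (Fin n)) : 0 < labelSum x τ := by
  have h0 : ∀ i, 0 ≤ x i := fun i => by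
    rcases hx.values i with h | h | h
    · omega
    · omega
    · have := Finset.card_eq_zero.mp hx.neg
      rw [Finset.filter_eq_empty_iff] at this
      exact absurd h (this (mem_univ i))
  obtain ⟨b, hb⟩ : ∃ b, x b = 1 := by
    have h : 0 < #{i | x i = 1} := by rw [hx.pos]; omega
    obtain ⟨b, hb⟩ := Finset.card_pos.mp h
    exact ⟨b, by simpa using hb⟩
  refine Finset.sum_pos' (fun i _ => mul_nonneg (h0 _) (by positivity)) ⟨τ.symm b, mem_univ _, ?_⟩
  simp only [apply_symm_apply, hb]
  positivity

theorem labelSum_ne_zero_of_one_one {x : Fin n → ℤ} (hx : HasSigns x 1 1) (τ : Perm (Fin n)) :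
    labelSum x τ ≠ 0 := by
  obtain ⟨a, ha⟩ := Finset.card_eq_one.mp hx.pos
  obtain ⟨b, hb⟩ := Finset.card_eq_one.mp hx.neg
  have ha' : ∀ i, x i = 1 ↔ i = a := fun i => by
    have : i ∈ ({i | x i = 1} : Finset (Fin n)) ↔ i ∈ ({a} : Finset (Fin n)) := by rw [ha]
    simpa using this
  have hb' : ∀ i, x i = -1 ↔ i = b := fun i => by
    have : i ∈ ({i | x i = -1} : Finset (Fin n)) ↔ i ∈ ({b} : Finset (Fin n)) := by rw [hb]
    simpa using this
  have hab : a ≠ b := by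
    rintro rfl
    have h1 := (ha' a).2 rfl
    have h2 := (hb' a).2 rfl
    omega
  have h1 : labelSum x τ = ∑ i ∈ {τ.symm a, τ.symm b}, x (τ i) * ((i : ℤ) + 1) := by
    symm
    apply Finset.sum_subset (Finset.subset_univ _)
    intro i _ hi
    simp only [mem_insert, mem_singleton, not_or] at hi
    rcases hx.values (τ i) with h | h | h
    · exact absurd ((Equiv.eq_symm_apply τ).2 ((ha' _).1 h)) hi.1
    · simp [h]
    · exact absurd ((Equiv.eq_symm_apply τ).2 ((hb' _).1 h)) hi.2
  have hne : τ.symm a ≠ τ.symm b := fun h => hab (τ.symm.injective h)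
  rw [h1, Finset.sum_pair hne]
  simp only [apply_symm_apply, (ha' a).2 rfl, (hb' b).2 rfl]
  have : ((τ.symm a : Fin n) : ℕ) ≠ (τ.symm b : Fin n) := fun h => hne (Fin.ext h)
  omega

/-- If not all elements have a sign, then a random labelling makes the signed sum zero with a
probability of at most `1 / n - 1 / (20 n ^ 2)`, but for one exception. -/
theorem card_labelSum_eq_zero_le {x : Fin n → ℤ} {p q : ℕ} (hx : HasSigns x p q)
    (hqp : q ≤ p) (hp : 0 < p) (hpq : p + q < n) (hex : ¬ (n = 5 ∧ p = 2 ∧ q = 2)) :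
    20 * n ^ 2 * #{τ | labelSum x τ = 0} ≤ (20 * n - 1) * n.factorial := by
  obtain ⟨N, rfl⟩ : ∃ N, n = N + 1 := ⟨n - 1, by omega⟩
  -- A constant factor 19/20 is more than needed, since 1/n − 1/(20n) ≤ 1/n − 1/(20n²).
  have hred : 20 * #{τ | labelSum x τ = 0} ≤ 19 * N.factorial →
      20 * (N + 1) ^ 2 * #{τ | labelSum x τ = 0} ≤ (20 * (N + 1) - 1) * (N + 1).factorial := by
    intro h
    rw [Nat.factorial_succ]
    calc 20 * (N + 1) ^ 2 * #{τ | labelSum x τ = 0}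
        = (N + 1) ^ 2 * (20 * #{τ | labelSum x τ = 0}) := by ring
      _ ≤ (N + 1) ^ 2 * (19 * N.factorial) := Nat.mul_le_mul_left _ h
      _ = (19 * (N + 1)) * ((N + 1) * N.factorial) := by ring
      _ ≤ _ := Nat.mul_le_mul_right _ (by omega)
  rcases Nat.eq_zero_or_pos q with rfl | hq
  · rw [Finset.filter_eq_empty_iff.2 fun τ _ => (labelSum_pos_of_no_neg hx hp τ).ne']
    simp
  obtain ⟨q, rfl⟩ : ∃ q', q = q' + 1 := ⟨q - 1, by omega⟩
  rcases (show p = q + 1 ∨ p = q + 2 ∨ q + 3 ≤ p by omega) with rfl | rfl | h3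
  · rcases Nat.eq_zero_or_pos q with rfl | hq
    · rw [Finset.filter_eq_empty_iff.2 fun τ _ => labelSum_ne_zero_of_one_one hx τ]
      simp
    apply hred
    rcases (show q = 1 ∨ 2 ≤ q by omega) with rfl | hq2
    · obtain ⟨k, rfl⟩ : ∃ k, N = k + 5 := ⟨N - 5, by omega⟩
      exact card_labelSum_two_two_le k hx
    · obtain ⟨k, rfl⟩ : ∃ k, N = 2 * q + 2 + k := ⟨N - (2 * q + 2), by omega⟩
      have := @card_labelSum_balanced_le q hq2 k
      rw [show 2 * q + 2 + 1 + k = 2 * q + 2 + k + 1 by ring] at this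
      exact this hx
  · apply hred
    have := (card_labelSum_near_balanced_lt hx (by omega)).1
    omega
  · obtain ⟨k, rfl⟩ : ∃ k, N = k + q := ⟨N - q, by omega⟩
    have h := card_labelSum_unbalanced_le (n := k) (by omega) hx h3
    set C := #{τ | labelSum x τ = 0}
    set J := (k + q + 1).factorial
    -- With m = k + q + 1 elements this gives 2(m − q) ≥ m + 4, so 1/(2(m − q)) is sufficiently
    -- below 1/m.
    obtain ⟨d, rfl⟩ : ∃ d, k = q + 3 + d := ⟨k - (q + 3), by omega⟩
    have hpos : 0 < 2 * (q + 3 + d + 1) := by omega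
    apply Nat.le_of_mul_le_mul_left _ hpos
    calc 2 * (q + 3 + d + 1) * (20 * (q + 3 + d + q + 1) ^ 2 * C)
        = 20 * (q + 3 + d + q + 1) ^ 2 * (2 * (q + 3 + d + 1) * C) := by ring
      _ ≤ 20 * (q + 3 + d + q + 1) ^ 2 * J := Nat.mul_le_mul_left _ h
      _ ≤ 2 * (q + 3 + d + 1) * (20 * (q + 3 + d + q + 1) - 1) * J := by
          apply Nat.mul_le_mul_right
          rw [show 20 * (q + 3 + d + q + 1) - 1 = 40 * q + 20 * d + 79 by omega]
          zify
          nlinarith [Int.natCast_nonneg q, Int.natCast_nonneg d,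
            mul_nonneg (Int.natCast_nonneg q) (Int.natCast_nonneg d), sq_nonneg ((d : ℤ))]
      _ = _ := by ring

end SignedLabelSums

/-! ### The union bound over the edges of a graph -/

section GraphLabellings
open Finset Equiv

variable {V : Type} {G : SimpleGraph V} {m : ℕ}

theorem bijOn_labelOf (hm : Nat.card G.edgeSet = m) (f : G.edgeSet ≃ Fin m) :
    Set.BijOn (labelOf f) Set.univ (Set.Icc 1 (Nat.card G.edgeSet)) := by
  refine ⟨fun e _ => ?_, fun a _ b _ h => ?_, fun k hk => ?_⟩
  · have := (f e).2
    simp only [labelOf, Set.mem_Icc]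
    omega
  · simp only [labelOf] at h
    exact f.injective (Fin.ext (by omega))
  · simp only [Set.mem_Icc] at hk
    refine ⟨f.symm ⟨k - 1, by omega⟩, trivial, ?_⟩
    simp only [labelOf, apply_symm_apply]
    omega

/-- The labelling of the edges for a permutation of their numbers is local antimagic. -/
def GoodPerm [Fintype V] (edge : Fin m ≃ G.edgeSet) (π : Perm (Fin m)) : Prop :=
  IsLocalAntimagic G (labelOf (edge.symm.trans π))

theorem card_eq_of_edge (edge : Fin m ≃ G.edgeSet) : Nat.card G.edgeSet = m := by
  rw [Nat.card_congr edge.symm, Nat.card_fin]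

theorem goodPerm_iff [Fintype V] (edge : Fin m ≃ G.edgeSet) (π : Perm (Fin m)) :
    GoodPerm edge π ↔ ∀ v w : V, G.Adj v w →
      vertexSum G (labelOf (edge.symm.trans π)) v ≠
        vertexSum G (labelOf (edge.symm.trans π)) w :=
  ⟨fun h => h.2, fun h => ⟨bijOn_labelOf (card_eq_of_edge edge) _, h⟩⟩

open Classical in
theorem vertexSum_labelOf [Fintype V] (edge : Fin m ≃ G.edgeSet) (π : Perm (Fin m)) (v : V) :
    vertexSum G (labelOf (edge.symm.trans π)) v =
      ∑ i, if v ∈ (edge i : Sym2 V) then (π i : ℕ) + 1 else 0 := by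
  rw [vertexSum, ← Equiv.sum_comp edge]
  simp [labelOf]

open Classical in
/-- The sign of the `i`-th edge in the difference of the sums at `v` and at `w`. -/
noncomputable def edgeSign (edge : Fin m ≃ G.edgeSet) (v w : V) (i : Fin m) : ℤ :=
  (if v ∈ (edge i : Sym2 V) then 1 else 0) - (if w ∈ (edge i : Sym2 V) then 1 else 0)

theorem vertexSum_eq_iff [Fintype V] (edge : Fin m ≃ G.edgeSet) (π : Perm (Fin m)) (v w : V) :
    vertexSum G (labelOf (edge.symm.trans π)) v = vertexSum G (labelOf (edge.symm.trans π)) w ↔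
      labelSum (edgeSign edge v w) π⁻¹ = 0 := by
  classical
  have h : labelSum (edgeSign edge v w) π⁻¹ =
      (vertexSum G (labelOf (edge.symm.trans π)) v : ℤ) -
        vertexSum G (labelOf (edge.symm.trans π)) w := by
    rw [vertexSum_labelOf, vertexSum_labelOf, labelSum, ← Equiv.sum_comp π]
    push_cast
    rw [← Finset.sum_sub_distrib]
    refine Finset.sum_congr rfl fun i _ => ?_
    rw [show π⁻¹ (π i) = i by simp, edgeSign]
    split_ifs <;> simp
  rw [h, sub_eq_zero, Nat.cast_inj]

theorem edgeSign_eq_zero (edge : Fin m ≃ G.edgeSet) {v w : V} {i : Fin m}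
    (hi : (edge i : Sym2 V) = s(v, w)) : edgeSign edge v w i = 0 := by
  simp [edgeSign, hi]

theorem eq_of_mem_of_mem (edge : Fin m ≃ G.edgeSet) {v w : V} (hvw : v ≠ w) {i j : Fin m}
    (hi : (edge i : Sym2 V) = s(v, w)) (hv : v ∈ (edge j : Sym2 V)) (hw : w ∈ (edge j : Sym2 V)) :
    j = i := by
  apply edge.injective
  apply Subtype.ext
  rw [hi]
  exact (Sym2.mem_and_mem_iff hvw).1 ⟨hv, hw⟩

open Classical in
/-- The signs for the ends of an edge: the edge itself has none, and each other edge at one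
of the ends has one. -/
theorem hasSigns_edgeSign (edge : Fin m ≃ G.edgeSet) {v w : V} (hvw : v ≠ w) {i : Fin m}
    (hi : (edge i : Sym2 V) = s(v, w)) :
    ∃ p q, HasSigns (edgeSign edge v w) p q ∧ p + q < m ∧
      #{j | v ∈ (edge j : Sym2 V)} = p + 1 ∧ #{j | w ∈ (edge j : Sym2 V)} = q + 1 := by
  have hs : HasSigns (edgeSign edge v w) _ _ := ⟨fun j => by
    simp only [edgeSign]; split_ifs <;> simp, rfl, rfl⟩
  refine ⟨_, _, hs, ?_, ?_, ?_⟩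
  · have h1 : 0 < #{j | edgeSign edge v w j = 0} :=
      Finset.card_pos.2 ⟨i, by simpa using edgeSign_eq_zero edge hi⟩
    have := hs.card_zero
    omega
  · rw [← Finset.card_erase_add_one (a := i) (by simp [hi])]
    congr 2
    ext j
    simp only [mem_erase, mem_filter, mem_univ, true_and]
    rw [edgeSign]
    constructor
    · rintro ⟨h1, h2⟩
      have : w ∉ (edge j : Sym2 V) := fun h3 => h1 (eq_of_mem_of_mem edge hvw hi h2 h3)
      simp [h2, this]
    · intro h
      split_ifs at h with h1 h2 h2
      · omega
      · exact ⟨fun h3 => h2 (by rw [h3, hi]; simp), h1⟩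
      · omega
      · omega
  · rw [← Finset.card_erase_add_one (a := i) (by simp [hi])]
    congr 2
    ext j
    simp only [mem_erase, mem_filter, mem_univ, true_and]
    rw [edgeSign]
    constructor
    · rintro ⟨h1, h2⟩
      have : v ∉ (edge j : Sym2 V) := fun h3 => h1 (eq_of_mem_of_mem edge hvw hi h3 h2)
      simp [h2, this]
    · intro h
      split_ifs at h with h1 h2 h2
      · omega
      · omega
      · exact ⟨fun h3 => h1 (by rw [h3, hi]; simp), h2⟩
      · omega

theorem two_le_card_of_adj (edge : Fin m ≃ G.edgeSet) {v y z : V} (hy : G.Adj v y)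
    (hz : G.Adj v z) (hyz : z ≠ y) [DecidablePred fun j => v ∈ (edge j : Sym2 V)] :
    2 ≤ #{j | v ∈ (edge j : Sym2 V)} := by
  have h1 : (edge (edge.symm ⟨s(v, y), hy⟩) : Sym2 V) = s(v, y) := by simp
  have h2 : (edge (edge.symm ⟨s(v, z), hz⟩) : Sym2 V) = s(v, z) := by simp
  have h3 : edge.symm ⟨s(v, z), hz⟩ ≠ edge.symm ⟨s(v, y), hy⟩ := by
    intro h
    rw [h, h1, Sym2.congr_right] at h2
    exact hyz h2.symm
  rw [← Finset.card_pair h3]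
  apply Finset.card_le_card
  intro j hj
  simp only [mem_insert, mem_singleton] at hj
  rcases hj with rfl | rfl <;> simp

open Classical in
theorem card_vertexSum_eq_le [Fintype V] (edge : Fin m ≃ G.edgeSet) (hG : NoIsolatedEdge G) {v w : V}
    (hvw : G.Adj v w) :
    20 * m ^ 2 * #{π : Perm (Fin m) | vertexSum G (labelOf (edge.symm.trans π)) v =
        vertexSum G (labelOf (edge.symm.trans π)) w} ≤ (20 * m - 1) * m.factorial ∨
      (m = 5 ∧ #{j | v ∈ (edge j : Sym2 V)} = 3 ∧ #{j | w ∈ (edge j : Sym2 V)} = 3 ∧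
        #{π : Perm (Fin m) | vertexSum G (labelOf (edge.symm.trans π)) v =
        vertexSum G (labelOf (edge.symm.trans π)) w} ≤ 24) := by
  have hi : (edge (edge.symm ⟨s(v, w), hvw⟩) : Sym2 V) = s(v, w) := by simp
  obtain ⟨p, q, hs, hpq, hv, hw⟩ := hasSigns_edgeSign edge hvw.ne hi
  have hpos : 0 < p + q := by
    rcases hG v w hvw with ⟨z, hz, hadj⟩ | ⟨z, hz, hadj⟩
    · have := two_le_card_of_adj edge hvw hadj hz
      omega
    · have := two_le_card_of_adj edge hvw.symm hadj hz
      omega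
  have hN : #{π : Perm (Fin m) | vertexSum G (labelOf (edge.symm.trans π)) v =
        vertexSum G (labelOf (edge.symm.trans π)) w} =
      #{τ | labelSum (edgeSign edge v w) τ = 0} := by
    rw [Finset.card_filter, Finset.card_filter, ← Equiv.sum_comp (Equiv.inv (Perm (Fin m)))]
    refine Finset.sum_congr rfl fun π _ => ?_
    simp only [vertexSum_eq_iff, Equiv.inv_apply, inv_inv]
  rw [hN]
  by_cases hex : m = 5 ∧ p = 2 ∧ q = 2
  · obtain ⟨rfl, rfl, rfl⟩ := hex
    exact Or.inr ⟨rfl, hv, hw, card_labelSum_two_two_five hs⟩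
  left
  rcases le_total q p with h | h
  · exact card_labelSum_eq_zero_le hs h (by omega) hpq hex
  · have := card_labelSum_eq_zero_le hs.neg_signs h (by omega) (by omega) (by tauto)
    simpa only [labelSum_neg, neg_eq_zero] using this

open Classical in
theorem sum_card_mem_edge [Fintype V] (edge : Fin m ≃ G.edgeSet) :
    ∑ v, #{j | v ∈ (edge j : Sym2 V)} = 2 * m := by
  simp only [Finset.card_filter]
  rw [Finset.sum_comm]
  have : ∀ j, ∑ v, (if v ∈ (edge j : Sym2 V) then 1 else 0) = 2 := by
    intro j
    rw [← Finset.card_filter]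
    have hj := (edge j).2
    generalize ((edge j : G.edgeSet) : Sym2 V) = e at hj
    induction e with
    | _ x y =>
      have hne : x ≠ y := (SimpleGraph.mem_edgeSet G).1 hj |>.ne
      rw [← Finset.card_pair hne]
      congr 1
      ext v
      simp
  rw [Finset.sum_congr rfl fun j _ => this j]
  simp [mul_comm]

open Classical in
-- For m ≠ 5 the m bad events together leave a probability of at least 1/(20m). For m = 5 one edge
-- with at most 23 bad permutations out of 120 is enough, as then at most 23 + 4 · 24 = 119 are bad.
theorem factorial_le_card_goodPerm [Fintype V] (edge : Fin m ≃ G.edgeSet) (hm : 1 ≤ m)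
    (hG : NoIsolatedEdge G) :
    m.factorial ≤ 100 * m * #{π | GoodPerm edge π} := by
  have hends : ∀ i, ∃ v w, G.Adj v w ∧ (edge i : Sym2 V) = s(v, w) := by
    intro i
    have hi := (edge i).2
    generalize ((edge i : G.edgeSet) : Sym2 V) = e at hi
    induction e with
    | _ x y => exact ⟨x, y, hi, rfl⟩
  choose v w hadj hedge using hends
  set B : Fin m → Finset (Perm (Fin m)) := fun i =>
    {π | vertexSum G (labelOf (edge.symm.trans π)) (v i) =
        vertexSum G (labelOf (edge.symm.trans π)) (w i)} with hB
  have hbad : #{π | ¬ GoodPerm edge π} ≤ ∑ i, #(B i) := by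
    refine le_trans (Finset.card_le_card ?_) Finset.card_biUnion_le
    intro π hπ
    simp only [mem_filter, mem_univ, true_and, goodPerm_iff, not_forall, not_not] at hπ
    obtain ⟨x, y, hxy, hS⟩ := hπ
    simp only [mem_biUnion, mem_univ, true_and, hB, mem_filter]
    refine ⟨edge.symm ⟨s(x, y), hxy⟩, ?_⟩
    have h := hedge (edge.symm ⟨s(x, y), hxy⟩)
    rw [apply_symm_apply, Sym2.eq_iff] at h
    rcases h with ⟨h1, h2⟩ | ⟨h1, h2⟩
    · rw [← h1, ← h2]; exact hS
    · rw [← h1, ← h2]; exact hS.symm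
  have hall : #{π | GoodPerm edge π} + #{π | ¬ GoodPerm edge π} = m.factorial := by
    rw [Finset.card_filter_add_card_filter_not, Finset.card_univ, Fintype.card_perm,
      Fintype.card_fin]
  have hbound := fun i => card_vertexSum_eq_le edge hG (hadj i)
  by_cases h5 : m = 5
  · subst h5
    have h24 : ∀ i, #(B i) ≤ 24 := fun i => by
      rcases hbound i with h | h
      · norm_num [Nat.factorial] at h
        simp only [hB]
        omega
      · exact h.2.2.2
    -- The general bound forces at most 23 for m = 5. If all five edges were exceptional, every
    -- vertex on an edge would have degree 3, and 3 would divide the degree sum 10.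
    obtain ⟨i₀, hi₀⟩ : ∃ i, #(B i) ≤ 23 := by
      by_contra hcon
      push Not at hcon
      have h3 : ∀ i, #{j | v i ∈ (edge j : Sym2 V)} = 3 ∧ #{j | w i ∈ (edge j : Sym2 V)} = 3 := by
        intro i
        rcases hbound i with h | h
        · have := hcon i
          norm_num [Nat.factorial] at h
          simp only [hB] at this
          omega
        · exact ⟨h.2.1, h.2.2.1⟩
      have hdvd : 3 ∣ ∑ u, #{j | u ∈ (edge j : Sym2 V)} := by
        refine Finset.dvd_sum fun u _ => ?_
        rcases Finset.eq_empty_or_nonempty ({j | u ∈ (edge j : Sym2 V)} : Finset (Fin 5)) with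
          h | ⟨j, hj⟩
        · simp [h]
        · have hj : u ∈ (edge j : Sym2 V) := by simpa using hj
          rw [hedge j, Sym2.mem_iff] at hj
          rcases hj with rfl | rfl
          · exact ⟨1, (h3 j).1⟩
          · exact ⟨1, (h3 j).2⟩
      rw [sum_card_mem_edge] at hdvd
      omega
    have hsum : ∑ i, #(B i) ≤ 119 := by
      rw [← Finset.add_sum_erase _ _ (mem_univ i₀)]
      have : ∑ i ∈ univ.erase i₀, #(B i) ≤ ∑ i ∈ univ.erase i₀, 24 :=
        Finset.sum_le_sum fun i _ => h24 i
      simp at this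
      omega
    have hf : (5 : ℕ).factorial = 120 := rfl
    omega
  · have h1 : ∀ i, 20 * m ^ 2 * #(B i) ≤ (20 * m - 1) * m.factorial := fun i => by
      rcases hbound i with h | h
      · exact h
      · exact absurd h.1 h5
    have h2 : 20 * m ^ 2 * ∑ i, #(B i) ≤ m * ((20 * m - 1) * m.factorial) := by
      rw [Finset.mul_sum]
      refine (Finset.sum_le_sum fun i _ => h1 i).trans ?_
      simp
    have h3 : 20 * m * #{π | ¬ GoodPerm edge π} ≤ (20 * m - 1) * m.factorial := by
      apply Nat.le_of_mul_le_mul_left _ hm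
      calc m * (20 * m * #{π | ¬ GoodPerm edge π}) = 20 * m ^ 2 * #{π | ¬ GoodPerm edge π} := by
            ring
        _ ≤ 20 * m ^ 2 * ∑ i, #(B i) := Nat.mul_le_mul_left _ hbad
        _ ≤ _ := h2
    have h4 : 20 * m * #{π | GoodPerm edge π} + 20 * m * #{π | ¬ GoodPerm edge π} =
        (20 * m - 1) * m.factorial + m.factorial := by
      rw [← mul_add, hall, ← Nat.succ_mul]
      congr 1
      omega
    have h5 : m.factorial ≤ 20 * m * #{π | GoodPerm edge π} := by omega
    refine h5.trans ?_
    apply Nat.mul_le_mul_right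
    omega

open Classical in
theorem successProb_eq [Fintype V] (edge : Fin m ≃ G.edgeSet) :
    successProb G = (#{π | GoodPerm edge π} : ℝ≥0∞) / (m.factorial : ℝ≥0∞) := by
  have hcard := card_eq_of_edge edge
  subst hcard
  let Ψ : Perm (Fin (Nat.card G.edgeSet)) ≃ (G.edgeSet ≃ Fin (Nat.card G.edgeSet)) :=
    Equiv.equivCongr edge (Equiv.refl _)
  have h1 : Nat.card (G.edgeSet ≃ Fin (Nat.card G.edgeSet)) = (Nat.card G.edgeSet).factorial := by
    rw [← Nat.card_congr Ψ, Nat.card_eq_fintype_card, Fintype.card_perm, Fintype.card_fin]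
  have h2 : Nat.card {f : G.edgeSet ≃ Fin (Nat.card G.edgeSet) // IsLocalAntimagic G (labelOf f)} =
      #{π | GoodPerm edge π} := by
    rw [← Nat.card_congr (Ψ.subtypeEquiv (p := fun π => GoodPerm edge π) fun π => Iff.rfl),
      Nat.card_eq_fintype_card, Fintype.card_subtype]
  rw [successProb, h1, h2]

theorem le_successProb [Fintype V] (edge : Fin m ≃ G.edgeSet) (hm : 1 ≤ m) (hG : NoIsolatedEdge G) :
    (((1 : ℝ≥0) / 100 : ℝ≥0) : ℝ≥0∞) / (m : ℝ≥0∞) ≤ successProb G := by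
  classical
  rw [successProb_eq edge]
  have h := factorial_le_card_goodPerm edge hm hG
  set g := #{π | GoodPerm edge π}
  have hf := m.factorial_pos
  have hm' : (m : ℝ≥0) ≠ 0 := by positivity
  have hf' : (m.factorial : ℝ≥0) ≠ 0 := by positivity
  rw [← ENNReal.coe_natCast m, ← ENNReal.coe_natCast g, ← ENNReal.coe_natCast m.factorial,
    ← ENNReal.coe_div hm', ← ENNReal.coe_div hf', ENNReal.coe_le_coe, div_div,
    div_le_div_iff₀ (by positivity) (by positivity), one_mul]
  have : (m.factorial : ℝ≥0) ≤ ((100 * m * g : ℕ) : ℝ≥0) := by exact_mod_cast h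
  refine this.trans (le_of_eq ?_)
  push_cast
  ring

end GraphLabellings

/-! ### Expected values under a discrete distribution -/

section Expectation

variable {α β : Type*}

/-- The expected value of `g` under `p`. -/
noncomputable def PMF.mean (p : PMF α) (g : α → ℝ≥0∞) : ℝ≥0∞ := ∑' a, p a * g a

theorem PMF.mean_pure (a : α) (g : α → ℝ≥0∞) : (PMF.pure a).mean g = g a := by
  rw [PMF.mean, tsum_eq_single a]
  · simp
  · intro b hb
    simp [PMF.pure_apply, hb]

theorem PMF.mean_bind (p : PMF α) (f : α → PMF β) (g : β → ℝ≥0∞) :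
    (p.bind f).mean g = p.mean fun a => (f a).mean g := by
  simp only [PMF.mean, PMF.bind_apply, ← ENNReal.tsum_mul_right, ← ENNReal.tsum_mul_left]
  rw [ENNReal.tsum_comm]
  simp only [mul_assoc]

theorem PMF.mean_map (p : PMF α) (f : α → β) (g : β → ℝ≥0∞) :
    (p.map f).mean g = p.mean fun a => g (f a) := by
  rw [PMF.map, PMF.mean_bind]
  simp only [Function.comp_apply, PMF.mean_pure]

theorem PMF.mean_congr {p : PMF α} {g h : α → ℝ≥0∞} (H : ∀ a ∈ p.support, g a = h a) :
    p.mean g = p.mean h := by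
  refine tsum_congr fun a => ?_
  by_cases ha : p a = 0
  · simp [ha]
  · rw [H a ((p.mem_support_iff a).2 ha)]

theorem PMF.mean_mono {p : PMF α} {g h : α → ℝ≥0∞} (H : ∀ a, g a ≤ h a) : p.mean g ≤ p.mean h :=
  ENNReal.tsum_le_tsum fun a => mul_le_mul_right (H a) _

theorem PMF.mean_const (p : PMF α) (x : ℝ≥0∞) : (p.mean fun _ => x) = x := by
  rw [PMF.mean, ENNReal.tsum_mul_right, p.tsum_coe, one_mul]

theorem PMF.mean_add (p : PMF α) (g h : α → ℝ≥0∞) :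
    (p.mean fun a => g a + h a) = p.mean g + p.mean h := by
  simp only [PMF.mean, mul_add, ENNReal.tsum_add]

/-- Monotone convergence, proved by exchanging suprema over times and over finite partial sums. -/
theorem PMF.mean_iSup (p : PMF α) {g : ℕ → α → ℝ≥0∞} (hg : Monotone g) :
    (p.mean fun a => ⨆ t, g t a) = ⨆ t, p.mean (g t) := by
  simp only [PMF.mean, ENNReal.mul_iSup, ENNReal.tsum_eq_iSup_sum]
  rw [iSup_comm]
  refine iSup_congr fun s => ?_
  exact ENNReal.finsetSum_iSup_of_monotone fun a t t' h => mul_le_mul_right (hg h a) _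

open Classical in
theorem PMF.toOuterMeasure_eq_mean (p : PMF α) (s : Set α) :
    p.toOuterMeasure s = p.mean fun a => if a ∈ s then 1 else 0 := by
  rw [PMF.toOuterMeasure_apply]
  refine tsum_congr fun a => ?_
  by_cases h : a ∈ s <;> simp [h]

end Expectation

/-! ### First-step analysis of runs of a word RAM -/

section Runs

variable {P : Program} {w : ℕ}

theorem step_of_getElem? {c : Config} {ins : Instr} (h : P[c.pc]? = some ins) :
    step P w c = execInstr w c ins := by
  simp [step, h]

theorem not_halted_iff {c : Config} : ¬ Halted P c ↔ c.pc < P.length := by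
  simp [Halted]

theorem runLaw_of_halted {c : Config} (h : Halted P c) (t : ℕ) :
    runLaw P w c t = PMF.pure [c] := by
  induction t with
  | zero => rfl
  | succ t ih => simp [runLaw, ih, extendRun, h]

theorem ne_nil_of_mem_support_extendRun {h h' : List Config} (hh : h ≠ [])
    (hs : h' ∈ (extendRun P w h).support) : h' ≠ [] := by
  cases h with
  | nil => exact absurd rfl hh
  | cons c h =>
    rw [extendRun] at hs
    split_ifs at hs with hc
    · simp only [PMF.support_pure, Set.mem_singleton_iff] at hs
      simp [hs]
    · simp only [PMF.support_map, Set.mem_image] at hs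
      obtain ⟨x, _, rfl⟩ := hs
      simp

theorem ne_nil_of_mem_support_runLaw {c : Config} {t : ℕ} {h : List Config}
    (hh : h ∈ (runLaw P w c t).support) : h ≠ [] := by
  induction t generalizing h with
  | zero =>
    simp only [runLaw, PMF.support_pure, Set.mem_singleton_iff] at hh
    simp [hh]
  | succ t ih =>
    rw [runLaw, PMF.mem_support_bind_iff] at hh
    obtain ⟨h₀, h1, h2⟩ := hh
    exact ne_nil_of_mem_support_extendRun (ih h1) h2

theorem mean_extendRun_append {h : List Config} (hh : h ≠ []) (c : Config)
    (g : List Config → ℝ≥0∞) :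
    (extendRun P w (h ++ [c])).mean g = (extendRun P w h).mean fun h => g (h ++ [c]) := by
  cases h with
  | nil => exact absurd rfl hh
  | cons c' h =>
    simp only [List.cons_append, extendRun]
    split_ifs
    · simp [PMF.mean_pure]
    · simp [PMF.mean_map]

/-- Decomposition of a run according to its first step. -/
theorem mean_runLaw_succ {c : Config} (hc : ¬ Halted P c) (t : ℕ) (g : List Config → ℝ≥0∞) :
    (runLaw P w c (t + 1)).mean g =
      (step P w c).mean fun c' => (runLaw P w c' t).mean fun h => g (h ++ [c]) := by
  induction t generalizing g with
  | zero => simp [runLaw, PMF.mean_pure, extendRun, hc, PMF.mean_map]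
  | succ t ih =>
    rw [runLaw, PMF.mean_bind, ih]
    refine congrArg _ (funext fun c' => ?_)
    rw [runLaw, PMF.mean_bind]
    exact PMF.mean_congr fun h hh =>
      mean_extendRun_append (ne_nil_of_mem_support_runLaw hh) c g

/-! ### Probabilities of events -/

theorem ite_eq_ite_of_iff {p q : Prop} (ip : Decidable p) (iq : Decidable q) (h : p ↔ q) :
    @ite ℝ≥0∞ p ip 1 0 = @ite ℝ≥0∞ q iq 1 0 := by
  by_cases hp : p
  · rw [if_pos hp, if_pos (h.1 hp)]
  · rw [if_neg hp, if_neg fun hq => hp (h.2 hq)]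

open Classical in
/-- The probability that the run halts within `t` steps and has the property `A`. -/
noncomputable def haltProbWithin (P : Program) (w : ℕ) (A : List Config → Prop) (t : ℕ)
    (c : Config) : ℝ≥0∞ :=
  (runLaw P w c t).mean fun h => if (∃ q ∈ h.head?, Halted P q) ∧ A h then 1 else 0

theorem haltProb_eq_iSup (c : Config) (A : List Config → Prop) :
    haltProb P w c A = ⨆ t, haltProbWithin P w A t c := by
  classical
  simp only [haltProb, PMF.toOuterMeasure_eq_mean, haltProbWithin]
  exact iSup_congr fun t => congrArg _ (funext fun a =>
    ite_eq_ite_of_iff _ _ Iff.rfl)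

open Classical in
theorem haltProbWithin_of_halted {c : Config} (hc : Halted P c) (A : List Config → Prop) (t : ℕ) :
    haltProbWithin P w A t c = if A [c] then 1 else 0 := by
  rw [haltProbWithin, runLaw_of_halted hc, PMF.mean_pure]
  simp [hc]

theorem haltProbWithin_succ {c : Config} (hc : ¬ Halted P c) (A : List Config → Prop) (t : ℕ) :
    haltProbWithin P w A (t + 1) c =
      (step P w c).mean (haltProbWithin P w (fun h => A (h ++ [c])) t) := by
  rw [haltProbWithin, mean_runLaw_succ hc]
  refine congrArg _ (funext fun c' => PMF.mean_congr fun h hh => ?_)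
  cases h with
  | nil => exact absurd rfl (ne_nil_of_mem_support_runLaw hh)
  | cons a h => exact ite_eq_ite_of_iff _ _ (by simp)

theorem haltProbWithin_mono (A : List Config → Prop) : Monotone (haltProbWithin P w A) := by
  classical
  refine monotone_nat_of_le_succ fun t => ?_
  induction t generalizing A with
  | zero =>
    intro c
    by_cases hc : Halted P c
    · simp [haltProbWithin_of_halted hc]
    · have : haltProbWithin P w A 0 c = 0 := by
        simp [haltProbWithin, runLaw, PMF.mean_pure, hc]
      simp [this]
  | succ t ih =>
    intro c
    by_cases hc : Halted P c
    · simp [haltProbWithin_of_halted hc]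
    · rw [haltProbWithin_succ hc, haltProbWithin_succ hc]
      exact PMF.mean_mono fun c' => ih _ c'

open Classical in
theorem haltProb_of_halted {c : Config} (hc : Halted P c) (A : List Config → Prop) :
    haltProb P w c A = if A [c] then 1 else 0 := by
  simp [haltProb_eq_iSup, haltProbWithin_of_halted hc]

/-- The oldest configuration is at the end of the list, so conditioning on the first step appends
`c` to the run inside the event; monotone convergence passes to unbounded time. -/
theorem haltProb_of_not_halted {c : Config} (hc : ¬ Halted P c) (A : List Config → Prop) :
    haltProb P w c A = (step P w c).mean fun c' => haltProb P w c' fun h => A (h ++ [c]) := by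
  simp only [haltProb_eq_iSup]
  rw [PMF.mean_iSup _ (haltProbWithin_mono _),
    ← (Monotone.iSup_nat_add (f := fun t => haltProbWithin P w A t c)
      (fun t t' h => haltProbWithin_mono A h c) 1)]
  exact iSup_congr fun t => haltProbWithin_succ hc A t

theorem haltProb_le_one (c : Config) (A : List Config → Prop) : haltProb P w c A ≤ 1 := by
  classical
  rw [haltProb_eq_iSup]
  refine iSup_le fun t => ?_
  rw [← PMF.mean_const (runLaw P w c t) 1]
  refine PMF.mean_mono fun h => ?_
  split_ifs <;> simp

/-- The probability of halting such that the labellings sampled at line `l` together with the final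
configuration have the property `Φ`. -/
noncomputable def sampleProb (P : Program) (w m l : ℕ) (Φ : List (Fin m → ℕ) → Config → Prop)
    (c : Config) : ℝ≥0∞ :=
  haltProb P w c fun h => ∃ q ∈ h.head?, Φ (sampledLabels m l h) q

theorem haltProb_congr {c : Config} {A B : List Config → Prop}
    (h : ∀ h, h ≠ [] → (A h ↔ B h)) : haltProb P w c A = haltProb P w c B := by
  simp only [haltProb_eq_iSup, haltProbWithin]
  refine iSup_congr fun t => PMF.mean_congr fun a ha => ?_
  exact ite_eq_ite_of_iff _ _
    (and_congr_right fun _ => h a (ne_nil_of_mem_support_runLaw ha))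

variable {m l : ℕ}

theorem haltProb_eq_sampleProb (Φ : List (Fin m → ℕ) → Prop) (c : Config) :
    haltProb P w c (fun h => Φ (sampledLabels m l h)) =
      sampleProb P w m l (fun L _ => Φ L) c := by
  refine haltProb_congr fun h hh => ?_
  cases h with
  | nil => exact absurd rfl hh
  | cons a h => simp

open Classical in
theorem sampleProb_of_halted {Φ : List (Fin m → ℕ) → Config → Prop} {c : Config}
    (hc : Halted P c) (hl : c.pc ≠ l) :
    sampleProb P w m l Φ c = if Φ [] c then 1 else 0 := by
  rw [sampleProb, haltProb_of_halted hc]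
  simp [sampledLabels, hl]

theorem sampleProb_of_ne {Φ : List (Fin m → ℕ) → Config → Prop} {c : Config}
    (hc : ¬ Halted P c) (hl : c.pc ≠ l) :
    sampleProb P w m l Φ c = (step P w c).mean (sampleProb P w m l Φ) := by
  rw [sampleProb, haltProb_of_not_halted hc]
  refine congrArg _ (funext fun c' => haltProb_congr fun h hh => ?_)
  cases h with
  | nil => exact absurd rfl hh
  | cons a h => simp [sampledLabels, hl]

theorem sampleProb_of_eq {Φ : List (Fin m → ℕ) → Config → Prop} {c : Config}
    (hc : ¬ Halted P c) (hl : c.pc = l) :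
    sampleProb P w m l Φ c =
      (step P w c).mean (sampleProb P w m l fun L => Φ (readLabels m c :: L)) := by
  rw [sampleProb, haltProb_of_not_halted hc]
  refine congrArg _ (funext fun c' => haltProb_congr fun h hh => ?_)
  cases h with
  | nil => exact absurd rfl hh
  | cons a h => simp [sampledLabels, hl]

/-! ### Running time -/

/-- The expected running time, if the run is stopped after `t` steps. -/
noncomputable def timeWithin (P : Program) (w t : ℕ) (c : Config) : ℝ≥0∞ :=
  (runLaw P w c t).mean fun h => ((h.length - 1 : ℕ) : ℝ≥0∞)

theorem expectedTime_eq_iSup (c : Config) : expectedTime P w c = ⨆ t, timeWithin P w t c := rfl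

theorem timeWithin_of_halted {c : Config} (hc : Halted P c) (t : ℕ) :
    timeWithin P w t c = 0 := by
  simp [timeWithin, runLaw_of_halted hc, PMF.mean_pure]

theorem timeWithin_zero (c : Config) : timeWithin P w 0 c = 0 := by
  simp [timeWithin, runLaw, PMF.mean_pure]

theorem timeWithin_succ {c : Config} (hc : ¬ Halted P c) (t : ℕ) :
    timeWithin P w (t + 1) c = 1 + (step P w c).mean (timeWithin P w t) := by
  rw [timeWithin, mean_runLaw_succ hc, ← PMF.mean_const (step P w c) 1, ← PMF.mean_add]
  refine congrArg _ (funext fun c' => ?_)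
  rw [timeWithin, ← PMF.mean_const (runLaw P w c' t) 1, ← PMF.mean_add]
  refine PMF.mean_congr fun h hh => ?_
  cases h with
  | nil => exact absurd rfl (ne_nil_of_mem_support_runLaw hh)
  | cons a h =>
    simp only [List.length_append, List.length_cons, List.length_nil]
    push_cast
    simp [add_comm]

theorem timeWithin_mono : Monotone (timeWithin P w) := by
  refine monotone_nat_of_le_succ fun t => ?_
  induction t with
  | zero => intro c; simp [timeWithin_zero]
  | succ t ih =>
    intro c
    by_cases hc : Halted P c
    · simp [timeWithin_of_halted hc]
    · rw [timeWithin_succ hc, timeWithin_succ hc]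
      gcongr
      exact PMF.mean_mono ih

theorem timeWithin_le (t : ℕ) (c : Config) : timeWithin P w t c ≤ t := by
  induction t generalizing c with
  | zero => simp [timeWithin_zero]
  | succ t ih =>
    by_cases hc : Halted P c
    · simp [timeWithin_of_halted hc]
    · rw [timeWithin_succ hc, ← PMF.mean_const (step P w c) ((t + 1 : ℕ) : ℝ≥0∞)]
      push_cast
      rw [PMF.mean_const, add_comm]
      gcongr
      rw [← PMF.mean_const (step P w c) (t : ℝ≥0∞)]
      exact PMF.mean_mono ih

/-! ### Functions of the configuration which are averaged by the steps -/

/-- Off line `l`, the value `Ψ (t + 1)` is the mean of `Ψ t` after one step, plus a reward. -/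
def IsAveraged (P : Program) (w l : ℕ) (δ : ℝ≥0∞) (Ψ : ℕ → Config → ℝ≥0∞) : Prop :=
  ∀ t c, ¬ Halted P c → c.pc ≠ l → Ψ (t + 1) c = δ + (step P w c).mean (Ψ t)

/-- Probabilities have reward 0 and running times have reward 1, so one analysis of the program
serves for both. Line `l` is excluded because a step from there records a labelling and so changes
the event. -/
theorem isAveraged_sampleProb (Φ : List (Fin m → ℕ) → Config → Prop) :
    IsAveraged P w l 0 fun _ => sampleProb P w m l Φ := fun _ _ hc hl =>
  (sampleProb_of_ne hc hl).trans (zero_add _).symm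

theorem isAveraged_timeWithin : IsAveraged P w l 1 (timeWithin P w) :=
  fun t _ hc _ => timeWithin_succ hc t

/-- The program gets from one configuration to another one in the given number of steps, without
any random step and without a step from line `l`. -/
inductive Reaches (P : Program) (w l : ℕ) : ℕ → Config → Config → Prop
  | refl (c : Config) : Reaches P w l 0 c c
  | head {k : ℕ} {c c₁ c₂ : Config} : ¬ Halted P c → c.pc ≠ l → step P w c = PMF.pure c₁ →
      Reaches P w l k c₁ c₂ → Reaches P w l (k + 1) c c₂

theorem Reaches.trans {k k' : ℕ} {c c₁ c₂ : Config} (h : Reaches P w l k c c₁)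
    (h' : Reaches P w l k' c₁ c₂) : Reaches P w l (k + k') c c₂ := by
  induction h with
  | refl c => simpa using h'
  | head h1 h2 h3 _ ih =>
    have := Reaches.head h1 h2 h3 (ih h')
    rwa [Nat.add_right_comm] at this

theorem IsAveraged.reaches {δ : ℝ≥0∞} {Ψ : ℕ → Config → ℝ≥0∞} (hΨ : IsAveraged P w l δ Ψ)
    {k : ℕ} {c c' : Config} (h : Reaches P w l k c c') (t : ℕ) :
    Ψ (t + k) c = k * δ + Ψ t c' := by
  induction h with
  | refl c => simp
  | @head k c _ _ h1 h2 h3 _ ih =>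
    rw [← add_assoc, hΨ _ _ h1 h2, h3, PMF.mean_pure, ih]
    push_cast
    ring

/-! ### Straight-line code -/

/-- The instructions which change only registers and memory, without randomness. -/
def Instr.IsStraight : Instr → Prop
  | .const _ _ | .add _ _ _ | .sub _ _ _ | .load _ _ | .store _ _ => True
  | _ => False

/-- The effect of an instruction on registers and memory. -/
def Instr.effect (w : ℕ) : Instr → (ℕ → ℕ) × (ℕ → ℕ) → (ℕ → ℕ) × (ℕ → ℕ)
  | .const d a, s => (Function.update s.1 d (a % 2 ^ w), s.2)
  | .add d a b, s => (Function.update s.1 d ((s.1 a + s.1 b) % 2 ^ w), s.2)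
  | .sub d a b, s => (Function.update s.1 d (s.1 a - s.1 b), s.2)
  | .load d a, s => (Function.update s.1 d (s.2 (s.1 a)), s.2)
  | .store a v, s => (s.1, Function.update s.2 (s.1 a) (s.1 v))
  | _, s => s

/-- The effect of a sequence of instructions on registers and memory. -/
def blockEffect (w : ℕ) : List Instr → (ℕ → ℕ) × (ℕ → ℕ) → (ℕ → ℕ) × (ℕ → ℕ)
  | [], s => s
  | i :: b, s => blockEffect w b (i.effect w s)

theorem getElem?_of_drop_eq {pc : ℕ} {i : Instr} {b : List Instr} (h : P.drop pc = i :: b) :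
    P[pc]? = some i := by
  have := congrArg (fun L => L[0]?) h
  simpa using this

theorem drop_succ_of_drop_eq {pc : ℕ} {i : Instr} {b : List Instr} (h : P.drop pc = i :: b) :
    P.drop (pc + 1) = b := by
  rw [← List.drop_drop, h]
  rfl

theorem not_halted_of_getElem? {c : Config} {i : Instr} (h : P[c.pc]? = some i) :
    ¬ Halted P c := by
  rw [not_halted_iff]
  exact (List.getElem?_eq_some_iff.1 h).1

theorem reaches_block {b tl : List Instr} {pc : ℕ} (hb : P.drop pc = b ++ tl)
    (hs : ∀ i ∈ b, i.IsStraight) (hl : l < pc ∨ pc + b.length ≤ l) (R M : ℕ → ℕ) :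
    Reaches P w l b.length ⟨pc, R, M⟩
      ⟨pc + b.length, (blockEffect w b (R, M)).1, (blockEffect w b (R, M)).2⟩ := by
  induction b generalizing pc R M with
  | nil => exact Reaches.refl _
  | cons i b ih =>
    have h1 := getElem?_of_drop_eq hb
    have h2 := drop_succ_of_drop_eq hb
    have h3 : step P w ⟨pc, R, M⟩ =
        PMF.pure ⟨pc + 1, (i.effect w (R, M)).1, (i.effect w (R, M)).2⟩ := by
      rw [step_of_getElem? (c := ⟨pc, R, M⟩) h1]
      have := hs i (by simp)
      cases i <;> first | rfl | exact absurd this id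
    have h4 := ih h2 (fun j hj => hs j (by simp [hj]))
      (by simp only [List.length_cons] at hl; omega) (i.effect w (R, M)).1 (i.effect w (R, M)).2
    rw [Nat.add_right_comm] at h4
    refine Reaches.head (not_halted_of_getElem? (c := ⟨pc, R, M⟩) h1) ?_ h3 h4
    simp only [List.length_cons] at hl
    simp only
    omega

theorem reaches_jump {pc a : ℕ} (h : P[pc]? = some (.jump a)) (hl : pc ≠ l) (R M : ℕ → ℕ) :
    Reaches P w l 1 ⟨pc, R, M⟩ ⟨a, R, M⟩ :=
  Reaches.head (not_halted_of_getElem? (c := ⟨pc, R, M⟩) h) hl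
    (by rw [step_of_getElem? (c := ⟨pc, R, M⟩) h]; simp [execInstr, Config.goto]) (Reaches.refl _)

theorem reaches_jeq_of_eq {pc a b k : ℕ} (h : P[pc]? = some (.jeq a b k)) (hl : pc ≠ l)
    {R : ℕ → ℕ} (hR : R a = R b) (M : ℕ → ℕ) :
    Reaches P w l 1 ⟨pc, R, M⟩ ⟨k, R, M⟩ :=
  Reaches.head (not_halted_of_getElem? (c := ⟨pc, R, M⟩) h) hl
    (by rw [step_of_getElem? (c := ⟨pc, R, M⟩) h]; simp [execInstr, Config.goto, hR])
    (Reaches.refl _)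

theorem reaches_jeq_of_ne {pc a b k : ℕ} (h : P[pc]? = some (.jeq a b k)) (hl : pc ≠ l)
    {R : ℕ → ℕ} (hR : R a ≠ R b) (M : ℕ → ℕ) :
    Reaches P w l 1 ⟨pc, R, M⟩ ⟨pc + 1, R, M⟩ :=
  Reaches.head (not_halted_of_getElem? (c := ⟨pc, R, M⟩) h) hl
    (by rw [step_of_getElem? (c := ⟨pc, R, M⟩) h]; simp [execInstr, Config.goto, hR])
    (Reaches.refl _)

theorem IsAveraged.rand {δ : ℝ≥0∞} {Ψ : ℕ → Config → ℝ≥0∞} (hΨ : IsAveraged P w l δ Ψ)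
    {pc d a : ℕ} (h : P[pc]? = some (.rand d a)) (hl : pc ≠ l) {R : ℕ → ℕ} {r : ℕ}
    (hR : R a = r + 1) (M : ℕ → ℕ) (t : ℕ) :
    Ψ (t + 1) ⟨pc, R, M⟩ = δ + ((r + 1 : ℕ) : ℝ≥0∞)⁻¹ *
      ∑ x ∈ Finset.range (r + 1), Ψ t ⟨pc + 1, Function.update R d x, M⟩ := by
  rw [hΨ _ _ (not_halted_of_getElem? (c := ⟨pc, R, M⟩) h) hl,
    step_of_getElem? (c := ⟨pc, R, M⟩) h]
  congr 1
  simp only [execInstr, PMF.mean_map, Config.setReg]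
  rw [PMF.mean]
  rw [tsum_eq_sum (s := Finset.range (r + 1)), Finset.mul_sum]
  · refine Finset.sum_congr rfl fun x hx => ?_
    rw [PMF.uniformOfFinset_apply_of_mem _ (by simpa [hR] using hx)]
    simp [hR]
  · intro x hx
    rw [PMF.uniformOfFinset_apply_of_notMem _ (by simpa [hR] using hx), zero_mul]

end Runs

section LabellingProgram
open Finset Equiv

/-! ### The program

Register 0 counts the edges which have got a label, register 1 holds `m`, register 2 holds `1`,
register 3 points to the list of edges, register 4 to the output, register 5 to a table
of vertex sums behind the output, register 6 into the output, and register 9 holds `0`. -/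

/-- Set the vertex sum of the end to which register 3 points to `0`. -/
def clearBlock : List Instr :=
  [.load 7 3, .add 7 7 5, .store 7 9, .add 3 3 2]

/-- Add register 8 to the vertex sum of the end to which register 3 points. -/
def addBlock : List Instr :=
  [.load 7 3, .add 7 7 5, .load 10 7, .add 10 10 8, .store 7 10, .add 3 3 2]

/-- This is executed again in every round. It relies only on the cell that holds `m` and on register
9, which no instruction of the program writes. -/
def initBlock : List Instr :=
  [.const 2 1, .load 1 2, .const 0 0, .const 3 2, .add 4 1 1, .add 4 4 3, .add 5 4 1, .add 6 4 0]

/-- Insert the new label at a random position, and move the label from there to the end. -/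
def insertBlock : List Instr :=
  [.add 7 7 4, .load 8 7, .store 6 8, .store 7 0, .add 6 6 2]

/-- Load the vertex sums of the ends of an edge. -/
def loadBlock : List Instr :=
  [.load 7 3, .add 7 7 5, .load 7 7, .add 3 3 2, .load 8 3, .add 8 8 5, .load 8 8, .add 3 3 2]

/-- Sample labellings until one of them is local antimagic. -/
def labellingProgram : Program :=
  -- Jump targets: 8 is the sampling loop, 25 is reached once per round with the complete labelling,
  -- 27 is the loop which adds up the sums, 43 prepares the comparison loop at 44. A jump to 0
  -- starts a new round, and 55 is the length of the program, so a jump there halts.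
  initBlock ++ ([.jeq 0 1 25, .add 0 0 2, .rand 7 0] ++ (insertBlock ++ (clearBlock ++ (clearBlock ++
  ([.jump 8, .const 3 2, .add 6 4 9, .jeq 6 5 43, .load 8 6] ++ (addBlock ++ (addBlock ++
  ([.add 6 6 2, .jump 27, .const 3 2, .jeq 3 4 55] ++ (loadBlock ++
  [.jeq 7 8 0, .jump 44])))))))))

variable {n m w : ℕ} {ends : Fin m → Fin n × Fin n}

/-- The contents of the registers which do not change after the first block. -/
structure BaseRegs (m : ℕ) (R : ℕ → ℕ) : Prop where
  one : R 1 = m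
  two : R 2 = 1
  four : R 4 = 2 + 2 * m
  five : R 5 = 2 + 3 * m
  nine : R 9 = 0

theorem BaseRegs.congr {R R' : ℕ → ℕ} (h : BaseRegs m R)
    (hR : ∀ r, r = 1 ∨ r = 2 ∨ r = 4 ∨ r = 5 ∨ r = 9 → R' r = R r) : BaseRegs m R' :=
  ⟨by rw [hR _ (by simp), h.one], by rw [hR _ (by simp), h.two], by rw [hR _ (by simp), h.four],
    by rw [hR _ (by simp), h.five], by rw [hR _ (by simp), h.nine]⟩

/-- The part of the input which the program reads is intact. -/
structure HasInput (ends : Fin m → Fin n × Fin n) (M : ℕ → ℕ) : Prop where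
  size : M 1 = m
  fst : ∀ j : Fin m, M (2 + 2 * j) = (ends j).1
  snd : ∀ j : Fin m, M (2 + 2 * j + 1) = (ends j).2

theorem HasInput.update {M : ℕ → ℕ} (h : HasInput ends M) {a : ℕ} (ha : 2 + 2 * m ≤ a) (x : ℕ) :
    HasInput ends (Function.update M a x) := by
  refine ⟨?_, fun j => ?_, fun j => ?_⟩
  · rw [Function.update_of_ne (by omega), h.size]
  · rw [Function.update_of_ne (by omega), h.fst]
  · rw [Function.update_of_ne (by omega), h.snd]

theorem hasInput_initConfig : HasInput ends (initConfig ends).mem := by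
  refine ⟨by simp [initConfig], fun j => ?_, fun j => ?_⟩
  · have h1 : (2 + 2 * (j : ℕ) - 2) / 2 = j := by omega
    have h2 : (2 + 2 * (j : ℕ)) % 2 = 0 := by omega
    have h3 : 2 + 2 * (j : ℕ) ≠ 0 := by omega
    have h4 : 2 + 2 * (j : ℕ) ≠ 1 := by omega
    simp only [initConfig, h1, h2, h3, h4, if_false, if_true, j.2, dif_pos]
  · have h1 : (2 + 2 * (j : ℕ) + 1 - 2) / 2 = j := by omega
    have h2 : (2 + 2 * (j : ℕ) + 1) % 2 ≠ 0 := by omega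
    have h3 : 2 + 2 * (j : ℕ) + 1 ≠ 0 := by omega
    have h4 : 2 + 2 * (j : ℕ) + 1 ≠ 1 := by omega
    simp only [initConfig, h1, h2, h3, h4, if_false, j.2, dif_pos]

/-- This bounds the addresses, as the table of vertex sums starts at 2 + 3m. The next lemma is for
the vertex sums, which are at most m². The exponent 2 suffices for both. -/
theorem wordSize_bound (hw : (n + m + 2) ^ 2 ≤ 2 ^ w) : 3 * m + n + 4 ≤ 2 ^ w := by
  nlinarith

theorem sq_lt_wordSize (hw : (n + m + 2) ^ 2 ≤ 2 ^ w) : m * m < 2 ^ w := by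
  have : m * m < (n + m + 2) * (n + m + 2) := Nat.mul_lt_mul'' (by omega) (by omega)
  rw [← sq (n + m + 2)] at this
  omega

/-! ### The blocks of the program -/

section Blocks

variable {P : Program} {l pc : ℕ} {tl : List Instr} {R M : ℕ → ℕ}

theorem reaches_clearBlock (hb : P.drop pc = clearBlock ++ tl) (hl : l < pc ∨ pc + 4 ≤ l)
    (hR : BaseRegs m R) {a x : ℕ} (h3 : R 3 = a) (hM : M a = x) (ha : a + 1 < 2 ^ w)
    (hx : 2 + 3 * m + x < 2 ^ w) :
    ∃ R', Reaches P w l 4 ⟨pc, R, M⟩ ⟨pc + 4, R', Function.update M (2 + 3 * m + x) 0⟩ ∧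
      R' 3 = a + 1 ∧ ∀ r, r ≠ 3 → r ≠ 7 → R' r = R r := by
  have h := reaches_block (w := w) hb (by simp [clearBlock, Instr.IsStraight]) hl R M
  have e : (blockEffect w clearBlock (R, M)).2 = Function.update M (2 + 3 * m + x) 0 := by
    simp [clearBlock, blockEffect, Instr.effect, h3, hM, hR.five, hR.nine,
      add_comm x, Nat.mod_eq_of_lt hx]
  rw [e] at h
  refine ⟨_, h, ?_, fun r h1 h2 => ?_⟩
  · simp [clearBlock, blockEffect, Instr.effect, h3, hR.two, Nat.mod_eq_of_lt ha]
  · simp [clearBlock, blockEffect, Instr.effect, h1, h2]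

theorem reaches_addBlock (hb : P.drop pc = addBlock ++ tl) (hl : l < pc ∨ pc + 6 ≤ l)
    (hR : BaseRegs m R) {a x s : ℕ} (h3 : R 3 = a) (hM : M a = x) (ha : a + 1 < 2 ^ w)
    (hx : 2 + 3 * m + x < 2 ^ w) (hs : M (2 + 3 * m + x) + R 8 = s) (hs' : s < 2 ^ w) :
    ∃ R', Reaches P w l 6 ⟨pc, R, M⟩ ⟨pc + 6, R', Function.update M (2 + 3 * m + x) s⟩ ∧
      R' 3 = a + 1 ∧ ∀ r, r ≠ 3 → r ≠ 7 → r ≠ 10 → R' r = R r := by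
  have h := reaches_block (w := w) hb (by simp [addBlock, Instr.IsStraight]) hl R M
  have e : (blockEffect w addBlock (R, M)).2 = Function.update M (2 + 3 * m + x) s := by
    simp [addBlock, blockEffect, Instr.effect, h3, hM, hR.five, 
      add_comm x, Nat.mod_eq_of_lt hx, hs, Nat.mod_eq_of_lt hs']
  rw [e] at h
  refine ⟨_, h, ?_, fun r h1 h2 h3 => ?_⟩
  · simp [addBlock, blockEffect, Instr.effect, h3, hR.two, Nat.mod_eq_of_lt ha]
  · simp [addBlock, blockEffect, Instr.effect, h1, h2, h3]

theorem reaches_loadBlock (hb : P.drop pc = loadBlock ++ tl) (hl : l < pc ∨ pc + 8 ≤ l)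
    (hR : BaseRegs m R) {a x y : ℕ} (h3 : R 3 = a) (hM : M a = x) (hM' : M (a + 1) = y)
    (ha : a + 2 < 2 ^ w) (hx : 2 + 3 * m + x < 2 ^ w) (hy : 2 + 3 * m + y < 2 ^ w) :
    ∃ R', Reaches P w l 8 ⟨pc, R, M⟩ ⟨pc + 8, R', M⟩ ∧
      R' 7 = M (2 + 3 * m + x) ∧ R' 8 = M (2 + 3 * m + y) ∧
      R' 3 = a + 2 ∧ ∀ r, r ≠ 3 → r ≠ 7 → r ≠ 8 → R' r = R r := by
  have h := reaches_block (w := w) hb (by simp [loadBlock, Instr.IsStraight]) hl R M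
  have e : (blockEffect w loadBlock (R, M)).2 = M := by
    simp [loadBlock, blockEffect, Instr.effect]
  rw [e] at h
  have ha1 : a + 1 < 2 ^ w := by omega
  have ha2 : a + 1 + 1 < 2 ^ w := by omega
  refine ⟨_, h, ?_, ?_, ?_, fun r h1 h2 h3 => ?_⟩
  · simp [loadBlock, blockEffect, Instr.effect, h3, hM, hR.five,
      add_comm x, Nat.mod_eq_of_lt hx]
  · simp [loadBlock, blockEffect, Instr.effect, h3, hM', hR.five, hR.two,
      add_comm y, Nat.mod_eq_of_lt hy, Nat.mod_eq_of_lt ha1]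
  · simp [loadBlock, blockEffect, Instr.effect, h3, hR.two, Nat.mod_eq_of_lt ha1,
      Nat.mod_eq_of_lt ha2]
  · simp [loadBlock, blockEffect, Instr.effect, h1, h2, h3]

theorem reaches_initBlock (hb : P.drop pc = initBlock ++ tl) (hl : l < pc ∨ pc + 8 ≤ l)
    (h9 : R 9 = 0) (hM : M 1 = m) (hm : 2 + 3 * m < 2 ^ w) :
    ∃ R', Reaches P w l 8 ⟨pc, R, M⟩ ⟨pc + 8, R', M⟩ ∧ BaseRegs m R' ∧
      R' 0 = 0 ∧ R' 3 = 2 ∧ R' 6 = 2 + 2 * m := by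
  have h := reaches_block (w := w) hb (by simp [initBlock, Instr.IsStraight]) hl R M
  have e : (blockEffect w initBlock (R, M)).2 = M := by
    simp [initBlock, blockEffect, Instr.effect]
  rw [e] at h
  have h1 : 1 < 2 ^ w := by omega
  have h2 : 2 < 2 ^ w := by omega
  have h3 : (m + m) % 2 ^ w = m + m := Nat.mod_eq_of_lt (by omega)
  have h4 : (m + m + 2) % 2 ^ w = m + m + 2 := Nat.mod_eq_of_lt (by omega)
  have h5 : (m + m + 2 + m) % 2 ^ w = m + m + 2 + m := Nat.mod_eq_of_lt (by omega)
  have h6 : 1 % 2 ^ w = 1 := Nat.mod_eq_of_lt h1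
  have h7 : 2 % 2 ^ w = 2 := Nat.mod_eq_of_lt h2
  refine ⟨_, h, ⟨?_, ?_, ?_, ?_, ?_⟩, ?_, ?_, ?_⟩ <;>
  simp only [initBlock, blockEffect, Instr.effect, h9, hM, h3, h4, h5, h6, h7, ne_eq,
    Function.update_self, Function.update_of_ne, Nat.reduceEqDiff, not_false_eq_true, OfNat.ofNat_ne_zero, OfNat.ofNat_ne_one, one_ne_zero,
    OfNat.zero_ne_ofNat, OfNat.one_ne_ofNat, Nat.zero_mod, add_zero]
  all_goals omega

theorem reaches_insertBlock (hb : P.drop pc = insertBlock ++ tl) (hl : l < pc ∨ pc + 5 ≤ l)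
    (hR : BaseRegs m R) {i x : ℕ} (h0 : R 0 = i + 1) (h6 : R 6 = 2 + 2 * m + i) (h7 : R 7 = x)
    (hi : 2 + 2 * m + i + 1 < 2 ^ w) (hx : x ≤ i) :
    ∃ R', Reaches P w l 5 ⟨pc, R, M⟩ ⟨pc + 5, R', Function.update (Function.update M
        (2 + 2 * m + i) (M (2 + 2 * m + x))) (2 + 2 * m + x) (i + 1)⟩ ∧
      R' 6 = 2 + 2 * m + (i + 1) ∧ ∀ r, r ≠ 6 → r ≠ 7 → r ≠ 8 → R' r = R r := by
  have h := reaches_block (w := w) hb (by simp [insertBlock, Instr.IsStraight]) hl R M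
  have hx' : 2 + 2 * m + x < 2 ^ w := by omega
  have e : (blockEffect w insertBlock (R, M)).2 = Function.update (Function.update M
        (2 + 2 * m + i) (M (2 + 2 * m + x))) (2 + 2 * m + x) (i + 1) := by
    simp [insertBlock, blockEffect, Instr.effect, h0, h6, h7, hR.four, add_comm x,
      Nat.mod_eq_of_lt hx']
  rw [e] at h
  refine ⟨_, h, ?_, fun r h1 h2 h3 => ?_⟩
  · simp [insertBlock, blockEffect, Instr.effect, h6, hR.two, Nat.mod_eq_of_lt hi]
    rfl
  · simp [insertBlock, blockEffect, Instr.effect, h1, h2, h3]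

end Blocks

/-! ### Sampling a labelling -/

/-- The situation at the begin of a round. -/
structure AtStart (ends : Fin m → Fin n × Fin n) (c : Config) : Prop where
  pc : c.pc = 0
  nine : c.reg 9 = 0
  input : HasInput ends c.mem

theorem atStart_initConfig : AtStart ends (initConfig ends) := ⟨rfl, rfl, hasInput_initConfig⟩

/-- `v` is an end of the `j`-th edge. -/
def IsEnd (ends : Fin m → Fin n × Fin n) (j : Fin m) (v : Fin n) : Prop :=
  v = (ends j).1 ∨ v = (ends j).2

/-- The situation when the first `i` edges have got the labels `σ j + 1`, and the vertex sums
of their ends are set to `0`. -/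
structure AtSample (ends : Fin m → Fin n × Fin n) (i : ℕ) (σ : Perm (Fin m)) (c : Config) :
    Prop where
  pc : c.pc = 8
  base : BaseRegs m c.reg
  zero : c.reg 0 = i
  three : c.reg 3 = 2 + 2 * i
  six : c.reg 6 = 2 + 2 * m + i
  input : HasInput ends c.mem
  out : ∀ j : Fin m, (j : ℕ) < i → c.mem (2 + 2 * m + j) = σ j + 1
  sum : ∀ j : Fin m, (j : ℕ) < i → ∀ v, IsEnd ends j v → c.mem (2 + 3 * m + v) = 0

/-- The situation at the end of a round, when the labels are `π j + 1`. -/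
structure AtCheck (ends : Fin m → Fin n × Fin n) (π : Perm (Fin m)) (c : Config) :
    Prop where
  pc : c.pc = 25
  base : BaseRegs m c.reg
  input : HasInput ends c.mem
  out : ∀ j : Fin m, c.mem (2 + 2 * m + j) = π j + 1
  sum : ∀ j : Fin m, ∀ v, IsEnd ends j v → c.mem (2 + 3 * m + v) = 0

theorem AtStart.reaches {c : Config} (hc : AtStart ends c) (hw : (n + m + 2) ^ 2 ≤ 2 ^ w) :
    ∃ c', Reaches labellingProgram w 25 8 c c' ∧ AtSample ends 0 1 c' := by
  have hb := wordSize_bound hw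
  obtain ⟨pc, R, M⟩ := c
  obtain ⟨rfl, h9, hin⟩ := hc
  obtain ⟨R', h, hR, h0, h3, h6⟩ := reaches_initBlock (P := labellingProgram) (w := w) (l := 25)
    (pc := 0) (tl := labellingProgram.drop 8) rfl (by omega) h9 hin.size (by omega)
  exact ⟨_, h, rfl, hR, h0, h3, h6, hin, by simp, by simp⟩

/-- Part of one sampling step, after the random number has been drawn. -/
theorem reaches_sample {i : ℕ} {σ : Perm (Fin m)} {c : Config} (hc : AtSample ends i σ c)
    (hw : (n + m + 2) ^ 2 ≤ 2 ^ w) (hi : i < m) (hσ : ∀ a : Fin m, i ≤ a → σ a = a) (x : Fin m)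
    (hx : (x : ℕ) ≤ i) :
    ∃ c', Reaches labellingProgram w 25 14
      ⟨11, Function.update (Function.update c.reg 0 (i + 1)) 7 x, c.mem⟩ c' ∧
      AtSample ends (i + 1) (σ * swap x ⟨i, hi⟩) c' := by
  have hb := wordSize_bound hw
  obtain ⟨pc, R, M⟩ := c
  obtain ⟨rfl, hR, h0, h3, h6, hin, hout, hsum⟩ := hc
  simp only at hR h0 h3 h6 hin hout hsum
  set R₁ := Function.update (Function.update R 0 (i + 1)) 7 (x : ℕ) with hR₁
  have hb1 : BaseRegs m R₁ := hR.congr fun r hr => by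
    rw [hR₁, Function.update_of_ne (by omega), Function.update_of_ne (by omega)]
  obtain ⟨R₂, r2, h26, hf2⟩ := reaches_insertBlock (P := labellingProgram) (w := w) (l := 25)
    (pc := 11) (M := M) (tl := labellingProgram.drop 16) rfl (by omega) hb1 (i := i) (x := x)
    (by simp [hR₁]) (by simp [hR₁, h6]) (by simp [hR₁]) (by omega) hx
  set M₂ := Function.update (Function.update M (2 + 2 * m + i) (M (2 + 2 * m + x)))
    (2 + 2 * m + x) (i + 1) with hM₂
  have hb2 : BaseRegs m R₂ := hb1.congr fun r hr => hf2 r (by omega) (by omega) (by omega)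
  have hin2 : HasInput ends M₂ := (hin.update (by omega) _).update (by omega) _
  have h23 : R₂ 3 = 2 + 2 * i := by rw [hf2 3 (by omega) (by omega) (by omega)]; simp [hR₁, h3]
  have h20 : R₂ 0 = i + 1 := by rw [hf2 0 (by omega) (by omega) (by omega)]; simp [hR₁]
  have hv := (ends ⟨i, hi⟩).1.2
  have hv' := (ends ⟨i, hi⟩).2.2
  obtain ⟨R₃, r3, h33, hf3⟩ := reaches_clearBlock (P := labellingProgram) (w := w) (l := 25)
    (pc := 16) (tl := labellingProgram.drop 20) rfl (by omega) hb2 h23 (hin2.fst ⟨i, hi⟩)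
    (by omega) (by omega)
  set M₃ := Function.update M₂ (2 + 3 * m + (ends ⟨i, hi⟩).1) 0 with hM₃
  have hb3 : BaseRegs m R₃ := hb2.congr fun r hr => hf3 r (by omega) (by omega)
  have hin3 : HasInput ends M₃ := hin2.update (by omega) _
  obtain ⟨R₄, r4, h43, hf4⟩ := reaches_clearBlock (P := labellingProgram) (w := w) (l := 25)
    (pc := 20) (tl := labellingProgram.drop 24) rfl (by omega) hb3 h33 (hin3.snd ⟨i, hi⟩)
    (by omega) (by omega)
  set M₄ := Function.update M₃ (2 + 3 * m + (ends ⟨i, hi⟩).2) 0 with hM₄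
  have hb4 : BaseRegs m R₄ := hb3.congr fun r hr => hf4 r (by omega) (by omega)
  have hin4 : HasInput ends M₄ := hin3.update (by omega) _
  have r5 := reaches_jump (P := labellingProgram) (w := w) (l := 25) (pc := 24) (a := 8) rfl
    (by omega) R₄ M₄
  refine ⟨_, ((r2.trans r3).trans r4).trans r5, rfl, hb4, ?_, ?_, ?_, hin4, ?_, ?_⟩
  · change R₄ 0 = _
    rw [hf4 0 (by omega) (by omega), hf3 0 (by omega) (by omega), h20]
  · change R₄ 3 = _
    omega
  · change R₄ 6 = _
    rw [hf4 6 (by omega) (by omega), hf3 6 (by omega) (by omega), h26]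
  · intro j hj
    change M₄ _ = _
    rw [hM₄, Function.update_of_ne (by omega), hM₃, Function.update_of_ne (by omega), hM₂]
    -- Position `x` gets the new label i + 1, which is σ i + 1 as σ fixes i, and position i gets the
    -- former label of `x`. If x = i, both writes hit the same cell and the later one, the new
    -- label, remains.
    by_cases hjx : j = x
    · subst hjx
      simp [hσ]
    · have hjx' : (j : ℕ) ≠ x := fun h => hjx (Fin.ext h)
      rw [Function.update_of_ne (by omega)]
      by_cases hji : (j : ℕ) = i
      · obtain rfl : j = ⟨i, hi⟩ := Fin.ext hji
        simp only [Function.update_self, Perm.coe_mul, Function.comp_apply, swap_apply_right]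
        exact hout x (by simp at hjx'; omega)
      · rw [Function.update_of_ne (by omega), hout j (by omega), Perm.mul_apply,
          swap_apply_of_ne_of_ne hjx fun h => hji (congrArg Fin.val h)]
  · intro j hj v hv
    simp only [hM₄, hM₃]
    by_cases h2 : v = (ends ⟨i, hi⟩).2
    · rw [h2, Function.update_self]
    have h2' : (v : ℕ) ≠ (ends ⟨i, hi⟩).2 := fun h => h2 (Fin.ext h)
    rw [Function.update_of_ne (by omega)]
    by_cases h1 : v = (ends ⟨i, hi⟩).1
    · rw [h1, Function.update_self]
    have h1' : (v : ℕ) ≠ (ends ⟨i, hi⟩).1 := fun h => h1 (Fin.ext h)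
    rw [Function.update_of_ne (by omega), hM₂, Function.update_of_ne (by omega),
      Function.update_of_ne (by omega)]
    refine hsum j ?_ v hv
    by_contra hji
    obtain rfl : j = ⟨i, hi⟩ := Fin.ext (by simp; omega)
    exact hv.elim h1 h2

end LabellingProgram

/-! ### Uniformity of the sampled labelling -/

section LabellingRounds
open Finset Equiv

variable {n m w : ℕ} {ends : Fin m → Fin n × Fin n}

theorem AtSample.step {i : ℕ} {σ : Perm (Fin m)} {c : Config} (hc : AtSample ends i σ c)
    (hw : (n + m + 2) ^ 2 ≤ 2 ^ w) (hi : i < m) (hσ : ∀ a : Fin m, i ≤ a → σ a = a) :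
    ∃ F : Fin m → Config,
      (∀ x : Fin m, (x : ℕ) ≤ i → AtSample ends (i + 1) (σ * swap x ⟨i, hi⟩) (F x)) ∧
      ∀ (δ : ℝ≥0∞) (Ψ : ℕ → Config → ℝ≥0∞), IsAveraged labellingProgram w 25 δ Ψ → ∀ t,
        Ψ (t + 17) c = (17 : ℕ) * δ + ((i + 1 : ℕ) : ℝ≥0∞)⁻¹ *
          ∑ x ∈ ({x : Fin m | (x : ℕ) ≤ i} : Finset _), Ψ t (F x) := by
  have hb := wordSize_bound hw
  have := fun x : Fin m => fun hx : (x : ℕ) ≤ i => reaches_sample hc hw hi hσ x hx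
  have hne : Nonempty Config := ⟨c⟩
  choose! F hF1 hF2 using this
  refine ⟨F, hF2, fun δ Ψ hΨ t => ?_⟩
  obtain ⟨pc, R, M⟩ := c
  obtain ⟨rfl, hR, h0, h3, h6, hin, hout, hsum⟩ := hc
  simp only at hR h0
  have r1 := reaches_jeq_of_ne (P := labellingProgram) (w := w) (l := 25) (pc := 8) (k := 25)
    (a := 0) (b := 1) rfl (by omega) (R := R) (by rw [h0, hR.one]; omega) M
  have r2 := reaches_block (P := labellingProgram) (w := w) (l := 25) (pc := 9)
    (b := [.add 0 0 2]) (tl := labellingProgram.drop 10) rfl (by simp [Instr.IsStraight])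
    (by simp) R M
  have e : (blockEffect w [.add 0 0 2] (R, M)) = (Function.update R 0 (i + 1), M) := by
    simp [blockEffect, Instr.effect, h0, hR.two, Nat.mod_eq_of_lt (show i + 1 < 2 ^ w by omega)]
  rw [e] at r2
  have h1 := hΨ.reaches (r1.trans r2) (t + 14 + 1)
  have h2 := hΨ.rand (pc := 10) (d := 7) (a := 0) rfl (by omega)
    (R := Function.update R 0 (i + 1)) (r := i) (by simp) M (t + 14)
  simp only [List.length_cons, List.length_nil, Nat.reduceAdd] at h1
  rw [show t + 17 = t + 14 + 1 + 2 by omega, h1, h2]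
  have h4 : ∑ x ∈ range (i + 1), Ψ (t + 14)
        ⟨10 + 1, Function.update (Function.update R 0 (i + 1)) 7 x, M⟩ =
      ∑ x ∈ ({x : Fin m | (x : ℕ) ≤ i} : Finset _), ((14 : ℕ) * δ + Ψ t (F x)) := by
    have : range (i + 1) = ({x : Fin m | (x : ℕ) ≤ i} : Finset (Fin m)).map Fin.valEmbedding := by
      ext a
      simp only [mem_range, mem_map, mem_filter, mem_univ, true_and, Fin.valEmbedding_apply]
      exact ⟨fun h => ⟨⟨a, by omega⟩, by simp; omega, rfl⟩, by rintro ⟨b, hb, rfl⟩; omega⟩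
    rw [this, sum_map]
    refine sum_congr rfl fun x hx => ?_
    exact hΨ.reaches (hF1 x (by simpa using hx)) t
  have h5 : #{x : Fin m | (x : ℕ) ≤ i} = i + 1 := by
    have := card_map (Fin.valEmbedding (n := m)) (s := {x : Fin m | (x : ℕ) ≤ i})
    rw [← this, ← card_range (i + 1)]
    congr 1
    ext a
    simp only [mem_range, mem_map, mem_filter, mem_univ, true_and, Fin.valEmbedding_apply]
    exact ⟨by rintro ⟨b, hb, rfl⟩; omega, fun h => ⟨⟨a, by omega⟩, by simp; omega, rfl⟩⟩
  rw [h4, sum_add_distrib, sum_const, h5, nsmul_eq_mul, mul_add, ← mul_assoc,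
    ENNReal.inv_mul_cancel (by simp) (ENNReal.natCast_ne_top _)]
  push_cast
  ring

/-- After `i` of the `m` steps of the sampling, the permutations of the first `i` edges are equally
likely. -/
theorem AtStart.exists_atSample {c : Config} (hc : AtStart ends c)
    (hw : (n + m + 2) ^ 2 ≤ 2 ^ w) {i : ℕ} (hi : i ≤ m) :
    ∃ F : Perm (Fin m) → Config,
      (∀ σ, (∀ a : Fin m, i ≤ a → σ a = a) → AtSample ends i σ (F σ)) ∧
      ∀ (δ : ℝ≥0∞) (Ψ : ℕ → Config → ℝ≥0∞), IsAveraged labellingProgram w 25 δ Ψ → ∀ t,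
        Ψ (t + (8 + 17 * i)) c = (8 + 17 * i : ℕ) * δ + (i.factorial : ℝ≥0∞)⁻¹ *
          ∑ σ with ∀ a : Fin m, i ≤ a → σ a = a, Ψ t (F σ) := by
  induction i with
  | zero =>
    obtain ⟨c', h1, h2⟩ := hc.reaches hw
    have h3 : ∀ σ : Perm (Fin m), (∀ a : Fin m, 0 ≤ (a : ℕ) → σ a = a) ↔ σ = 1 := fun σ =>
      ⟨fun h => Perm.ext fun a => h a (by omega), by rintro rfl; simp⟩
    refine ⟨fun _ => c', fun σ hσ => ?_, fun δ Ψ hΨ t => ?_⟩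
    · rw [(h3 σ).1 hσ]
      exact h2
    · simp_rw [h3]
      simp [hΨ.reaches h1 t, filter_eq']
  | succ i ih =>
    obtain ⟨F, hF, hF'⟩ := ih (by omega)
    have hi' : i < m := hi
    have := fun σ => fun hσ : ∀ a : Fin m, i ≤ a → σ a = a => (hF σ hσ).step hw hi' hσ
    have hne : Nonempty Config := ⟨c⟩
    choose! G hG1 hG2 using this
    -- Each τ that fixes everything from i + 1 on is uniquely σ * swap x i with σ fixing everything
    -- from i on and x ≤ i, namely for x = τ⁻¹ i. So each outcome arises from exactly one sequence
    -- of draws.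
    have e1 : ∀ (σ : Perm (Fin m)) (x : Fin m), (∀ a : Fin m, i ≤ a → σ a = a) →
        (σ * swap x ⟨i, hi'⟩)⁻¹ ⟨i, hi'⟩ = x := fun σ x hσ => by
      rw [Perm.inv_eq_iff_eq, Perm.mul_apply, swap_apply_left, hσ _ (by simp)]
    have e2 : ∀ τ : Perm (Fin m), (∀ a : Fin m, i + 1 ≤ a → τ a = a) →
        ((τ⁻¹ ⟨i, hi'⟩ : Fin m) : ℕ) ≤ i := fun τ hτ => by
      by_contra h
      have := hτ (τ⁻¹ ⟨i, hi'⟩) (by omega)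
      rw [show τ (τ⁻¹ ⟨i, hi'⟩) = ⟨i, hi'⟩ by simp] at this
      rw [← this] at h
      simp at h
    have e3 : ∀ τ : Perm (Fin m), (∀ a : Fin m, i + 1 ≤ a → τ a = a) →
        ∀ a : Fin m, i ≤ a → (τ * swap (τ⁻¹ ⟨i, hi'⟩) ⟨i, hi'⟩) a = a := fun τ hτ a ha => by
      by_cases hai : a = ⟨i, hi'⟩
      · subst hai
        simp
      · have hai' : (a : ℕ) ≠ i := fun h => hai (Fin.ext h)
        have hax : a ≠ τ⁻¹ ⟨i, hi'⟩ := fun h => by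
          have := e2 τ hτ
          rw [← h] at this
          omega
        rw [Perm.mul_apply, swap_apply_of_ne_of_ne hax hai, hτ a (by omega)]
    have e4 : ∀ (σ : Perm (Fin m)) (x : Fin m), (x : ℕ) ≤ i → (∀ a : Fin m, i ≤ a → σ a = a) →
        ∀ a : Fin m, i + 1 ≤ a → (σ * swap x ⟨i, hi'⟩) a = a := fun σ x hx hσ a ha => by
      rw [Perm.mul_apply, swap_apply_of_ne_of_ne, hσ a (by omega)]
      · rintro rfl; omega
      · rintro rfl; simp at ha
    refine ⟨fun τ => G (τ * swap (τ⁻¹ ⟨i, hi'⟩) ⟨i, hi'⟩) (τ⁻¹ ⟨i, hi'⟩), fun τ hτ => ?_,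
      fun δ Ψ hΨ t => ?_⟩
    · have := hG1 _ (e3 τ hτ) (τ⁻¹ ⟨i, hi'⟩) (e2 τ hτ)
      rwa [mul_assoc, swap_mul_self, mul_one] at this
    · have h1 := hF' δ Ψ hΨ (t + 17)
      rw [show t + (8 + 17 * (i + 1)) = t + 17 + (8 + 17 * i) by ring, h1]
      have h2 : ∑ σ with ∀ a : Fin m, i ≤ a → σ a = a, Ψ (t + 17) (F σ) =
          ∑ σ : Perm (Fin m) with ∀ a : Fin m, i ≤ a → σ a = a, ((17 : ℕ) * δ +
            ((i + 1 : ℕ) : ℝ≥0∞)⁻¹ * ∑ x ∈ ({x : Fin m | (x : ℕ) ≤ i} : Finset _), Ψ t (G σ x)) :=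
        sum_congr rfl fun σ hσ => hG2 σ (by simpa using hσ) δ Ψ hΨ t
      have h3 : ∑ σ : Perm (Fin m) with ∀ a : Fin m, i ≤ a → σ a = a,
            ∑ x ∈ ({x : Fin m | (x : ℕ) ≤ i} : Finset _), Ψ t (G σ x) =
          ∑ τ : Perm (Fin m) with ∀ a : Fin m, i + 1 ≤ a → τ a = a,
            Ψ t (G (τ * swap (τ⁻¹ ⟨i, hi'⟩) ⟨i, hi'⟩) (τ⁻¹ ⟨i, hi'⟩)) := by
        rw [← sum_product']
        refine sum_nbij' (fun p => p.1 * swap p.2 ⟨i, hi'⟩)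
          (fun τ => (τ * swap (τ⁻¹ ⟨i, hi'⟩) ⟨i, hi'⟩, τ⁻¹ ⟨i, hi'⟩)) ?_ ?_ ?_ ?_ ?_
        · rintro ⟨σ, x⟩ h
          simp only [mem_product, mem_filter, mem_univ, true_and] at h ⊢
          exact e4 σ x h.2 h.1
        · intro τ h
          simp only [mem_product, mem_filter, mem_univ, true_and] at h ⊢
          exact ⟨e3 τ h, e2 τ h⟩
        · rintro ⟨σ, x⟩ h
          simp only [mem_product, mem_filter, mem_univ, true_and] at h ⊢
          rw [e1 σ x h.1, mul_assoc, swap_mul_self, mul_one]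
        · intro τ h
          simp only [mul_assoc, swap_mul_self, mul_one]
        · rintro ⟨σ, x⟩ h
          simp only [mem_product, mem_filter, mem_univ, true_and] at h ⊢
          rw [e1 σ x h.1, mul_assoc, swap_mul_self, mul_one]
      -- There are i! such permutations: this is the induction hypothesis for the constant function
      -- 1 with reward 0.
      have h4 : (i.factorial : ℝ≥0∞)⁻¹ * #{σ : Perm (Fin m) | ∀ a : Fin m, i ≤ a → σ a = a} = 1 := by
        have := hF' 0 (fun _ _ => 1) (fun t c _ _ => by rw [PMF.mean_const, zero_add]) 0
        simpa using this.symm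
      rw [h2, sum_add_distrib, sum_const, nsmul_eq_mul, mul_add, ← mul_assoc, h4, one_mul,
        ← mul_sum, h3, Nat.factorial_succ, ← mul_assoc, Nat.cast_mul,
        ENNReal.mul_inv (by simp) (by simp), mul_comm ((i + 1 : ℕ) : ℝ≥0∞)⁻¹]
      push_cast
      ring

end LabellingRounds

/-! ### Computing and comparing the vertex sums -/

section LabellingCheck
open Finset Equiv

variable {n m w : ℕ} {ends : Fin m → Fin n × Fin n}

theorem AtStart.exists_atCheck {c : Config} (hc : AtStart ends c)
    (hw : (n + m + 2) ^ 2 ≤ 2 ^ w) :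
    ∃ F : Perm (Fin m) → Config, (∀ π, AtCheck ends π (F π)) ∧
      ∀ (δ : ℝ≥0∞) (Ψ : ℕ → Config → ℝ≥0∞), IsAveraged labellingProgram w 25 δ Ψ → ∀ t,
        Ψ (t + (9 + 17 * m)) c = (9 + 17 * m : ℕ) * δ + (m.factorial : ℝ≥0∞)⁻¹ *
          ∑ π, Ψ t (F π) := by
  obtain ⟨F, hF, hF'⟩ := hc.exists_atSample hw le_rfl
  have h1 : ∀ σ : Perm (Fin m), ∀ a : Fin m, m ≤ a → σ a = a := fun σ a ha => by omega
  have h2 : ∀ σ, ∃ c', Reaches labellingProgram w 25 1 (F σ) c' ∧ AtCheck ends σ c' := fun σ => by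
    have h := hF σ (h1 σ)
    generalize F σ = c at h
    obtain ⟨pc, R, M⟩ := c
    obtain ⟨rfl, hR, h0, h3, h6, hin, hout, hsum⟩ := h
    simp only at hR h0 hin hout hsum
    exact ⟨_, reaches_jeq_of_eq (P := labellingProgram) (w := w) (l := 25) (pc := 8) (k := 25)
      (a := 0) (b := 1) rfl (by omega) (R := R) (by rw [h0, hR.one]) M, rfl, hR, hin,
      fun j => hout j j.2, fun j => hsum j j.2⟩
  choose F' hr hF'' using h2
  refine ⟨F', hF'', fun δ Ψ hΨ t => ?_⟩
  have h3 : (m.factorial : ℝ≥0∞)⁻¹ * #(univ : Finset (Perm (Fin m))) = 1 := by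
    rw [card_univ, Fintype.card_perm, Fintype.card_fin]
    exact ENNReal.inv_mul_cancel (by simp [m.factorial_ne_zero]) (ENNReal.natCast_ne_top _)
  have h := hF' δ Ψ hΨ (t + 1)
  rw [filter_true_of_mem fun σ _ => h1 σ,
    sum_congr rfl fun σ _ => hΨ.reaches (hr σ) t, sum_add_distrib, sum_const, nsmul_eq_mul,
    mul_add, ← mul_assoc, h3] at h
  rw [show t + (9 + 17 * m) = t + 1 + (8 + 17 * m) by ring, h]
  push_cast
  ring

open Classical in
/-- The sum of the labels `π j + 1` at `v` of the first `i` edges. -/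
noncomputable def partialSum (ends : Fin m → Fin n × Fin n) (π : Perm (Fin m)) (i : ℕ)
    (v : Fin n) : ℕ :=
  ∑ j : Fin m, if (j : ℕ) < i ∧ IsEnd ends j v then (π j : ℕ) + 1 else 0

theorem partialSum_zero (π : Perm (Fin m)) (v : Fin n) : partialSum ends π 0 v = 0 := by
  simp [partialSum]

open Classical in
theorem partialSum_le (π : Perm (Fin m)) (i : ℕ) (v : Fin n) :
    partialSum ends π i v ≤ m * m := by
  have : ∀ j : Fin m, j ∈ univ → (if (j : ℕ) < i ∧ IsEnd ends j v then (π j : ℕ) + 1 else 0) ≤ m :=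
    fun j _ => by
      have := (π j).2
      split_ifs <;> omega
  simpa [partialSum] using sum_le_sum this

open Classical in
theorem partialSum_succ (π : Perm (Fin m)) {i : ℕ} (hi : i < m) (v : Fin n) :
    partialSum ends π (i + 1) v =
      partialSum ends π i v + if IsEnd ends ⟨i, hi⟩ v then (π ⟨i, hi⟩ : ℕ) + 1 else 0 := by
  have h : (if IsEnd ends ⟨i, hi⟩ v then (π ⟨i, hi⟩ : ℕ) + 1 else 0) =
      ∑ j : Fin m, if j = ⟨i, hi⟩ then (if IsEnd ends j v then (π j : ℕ) + 1 else 0) else 0 := by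
    simp
  rw [h, partialSum, partialSum, ← sum_add_distrib]
  refine sum_congr rfl fun j _ => ?_
  by_cases hj : j = ⟨i, hi⟩
  · subst hj
    simp
  · have hj' : (j : ℕ) ≠ i := fun h => hj (Fin.ext h)
    have : (j : ℕ) < i + 1 ↔ (j : ℕ) < i := by omega
    simp [hj, this]

theorem partialSum_eq_vertexSum {G : SimpleGraph (Fin n)} (edge : Fin m ≃ G.edgeSet)
    (hends : ∀ i, s((ends i).1, (ends i).2) = (edge i : Sym2 (Fin n))) (π : Perm (Fin m))
    (v : Fin n) :
    partialSum ends π m v = vertexSum G (labelOf (edge.symm.trans π)) v := by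
  classical
  rw [vertexSum_labelOf, partialSum]
  refine sum_congr rfl fun j _ => ?_
  have h : (j : ℕ) < m ∧ IsEnd ends j v ↔ v ∈ (edge j : Sym2 (Fin n)) := by simp [← hends, IsEnd]
  by_cases hv : v ∈ (edge j : Sym2 (Fin n))
  · rw [if_pos hv, if_pos (h.2 hv)]
  · rw [if_neg hv, if_neg fun h' => hv (h.1 h')]

theorem goodPerm_iff_partialSum {G : SimpleGraph (Fin n)} (edge : Fin m ≃ G.edgeSet)
    (hends : ∀ i, s((ends i).1, (ends i).2) = (edge i : Sym2 (Fin n))) (π : Perm (Fin m)) :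
    GoodPerm edge π ↔ ∀ j, partialSum ends π m (ends j).1 ≠ partialSum ends π m (ends j).2 := by
  simp_rw [goodPerm_iff, partialSum_eq_vertexSum edge hends]
  constructor
  · intro h j
    apply h
    have := (edge j).2
    rwa [← hends, SimpleGraph.mem_edgeSet] at this
  · intro h v w hvw
    have h1 := hends (edge.symm ⟨s(v, w), hvw⟩)
    rw [apply_symm_apply, Sym2.eq_iff] at h1
    have h2 := h (edge.symm ⟨s(v, w), hvw⟩)
    rcases h1 with ⟨h3, h4⟩ | ⟨h3, h4⟩
    · rwa [h3, h4] at h2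
    · rw [h3, h4] at h2
      exact h2.symm

/-- The situation when the labels of the first `i` edges have been added to the vertex sums. -/
structure AtSum (ends : Fin m → Fin n × Fin n) (i : ℕ) (π : Perm (Fin m)) (c : Config) :
    Prop where
  pc : c.pc = 27
  base : BaseRegs m c.reg
  three : c.reg 3 = 2 + 2 * i
  six : c.reg 6 = 2 + 2 * m + i
  input : HasInput ends c.mem
  out : ∀ j : Fin m, c.mem (2 + 2 * m + j) = π j + 1
  sum : ∀ j : Fin m, ∀ v, IsEnd ends j v → c.mem (2 + 3 * m + v) = partialSum ends π i v

/-- The situation when the vertex sums at the first `i` edges have been compared. -/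
structure AtCompare (ends : Fin m → Fin n × Fin n) (i : ℕ) (π : Perm (Fin m)) (c : Config) :
    Prop where
  pc : c.pc = 44
  base : BaseRegs m c.reg
  three : c.reg 3 = 2 + 2 * i
  input : HasInput ends c.mem
  out : ∀ j : Fin m, c.mem (2 + 2 * m + j) = π j + 1
  sum : ∀ j : Fin m, ∀ v, IsEnd ends j v → c.mem (2 + 3 * m + v) = partialSum ends π m v

theorem AtCheck.reaches {π : Perm (Fin m)} {c : Config} (hc : AtCheck ends π c)
    (hw : (n + m + 2) ^ 2 ≤ 2 ^ w) :
    ∃ c₁ c', ¬ Halted labellingProgram c ∧ _root_.step labellingProgram w c = PMF.pure c₁ ∧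
      Reaches labellingProgram w 25 1 c₁ c' ∧ AtSum ends 0 π c' := by
  have hb := wordSize_bound hw
  obtain ⟨pc, R, M⟩ := c
  obtain ⟨rfl, hR, hin, hout, hsum⟩ := hc
  simp only at hR hin hout hsum
  have r2 := reaches_block (P := labellingProgram) (w := w) (l := 25) (pc := 26)
    (b := [.add 6 4 9]) (tl := labellingProgram.drop 27) rfl (by simp [Instr.IsStraight])
    (by simp) (Function.update R 3 2) M
  have e : (blockEffect w [.add 6 4 9] (Function.update R 3 2, M)) =
      (Function.update (Function.update R 3 2) 6 (2 + 2 * m), M) := by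
    simp [blockEffect, Instr.effect, hR.four, hR.nine,
      Nat.mod_eq_of_lt (show 2 + 2 * m < 2 ^ w by omega)]
  rw [e] at r2
  refine ⟨⟨26, Function.update R 3 2, M⟩, _, not_halted_of_getElem? (i := .const 3 2) rfl, ?_, r2,
    rfl, ?_, ?_, ?_, hin, hout, fun j v hv => ?_⟩
  · rw [step_of_getElem? (ins := .const 3 2) rfl]
    simp [execInstr, Config.setReg, Nat.mod_eq_of_lt (show 2 < 2 ^ w by omega)]
  · exact hR.congr fun r hr => by
      change Function.update (Function.update R _ _) _ _ _ = _
      rw [Function.update_of_ne (by omega), Function.update_of_ne (by omega)]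
  · simp
  · simp
  · rw [partialSum_zero]
    exact hsum j v hv

theorem AtSum.step {i : ℕ} {π : Perm (Fin m)} {c : Config} (hc : AtSum ends i π c)
    (hw : (n + m + 2) ^ 2 ≤ 2 ^ w) (hi : i < m) (hne : (ends ⟨i, hi⟩).1 ≠ (ends ⟨i, hi⟩).2) :
    ∃ c', Reaches labellingProgram w 25 16 c c' ∧ AtSum ends (i + 1) π c' := by
  classical
  have hb := wordSize_bound hw
  have hb' := sq_lt_wordSize hw
  obtain ⟨pc, R, M⟩ := c
  obtain ⟨rfl, hR, h3, h6, hin, hout, hsum⟩ := hc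
  simp only at hR h3 h6 hin hout hsum
  have hv := (ends ⟨i, hi⟩).1.2
  have hv' := (ends ⟨i, hi⟩).2.2
  have hne' : ((ends ⟨i, hi⟩).1 : ℕ) ≠ (ends ⟨i, hi⟩).2 := fun h => hne (Fin.ext h)
  set p : ℕ := π ⟨i, hi⟩ + 1 with hp
  have hs1 : partialSum ends π (i + 1) (ends ⟨i, hi⟩).1 =
      partialSum ends π i (ends ⟨i, hi⟩).1 + p := by
    rw [partialSum_succ π hi, if_pos (show IsEnd _ _ _ from Or.inl rfl)]
  have hs2 : partialSum ends π (i + 1) (ends ⟨i, hi⟩).2 =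
      partialSum ends π i (ends ⟨i, hi⟩).2 + p := by
    rw [partialSum_succ π hi, if_pos (show IsEnd _ _ _ from Or.inr rfl)]
  have r1 := reaches_jeq_of_ne (P := labellingProgram) (w := w) (l := 25) (pc := 27) (k := 43)
    (a := 6) (b := 5) rfl (by omega) (R := R) (by rw [h6, hR.five]; omega) M
  have r2 := reaches_block (P := labellingProgram) (w := w) (l := 25) (pc := 28)
    (b := [.load 8 6]) (tl := labellingProgram.drop 29) rfl (by simp [Instr.IsStraight])
    (by simp) R M
  have e : (blockEffect w [.load 8 6] (R, M)) = (Function.update R 8 p, M) := by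
    simp only [blockEffect, Instr.effect, h6, hp, ← hout]
  rw [e] at r2
  set R₁ := Function.update R 8 p with hR₁
  have hf1 : ∀ r, r ≠ 8 → R₁ r = R r := fun r hr => Function.update_of_ne hr _ _
  have h18 : R₁ 8 = p := Function.update_self _ _ _
  have hb1 : BaseRegs m R₁ := hR.congr fun r hr => hf1 r (by omega)
  obtain ⟨R₂, r3, h23, hf2⟩ := reaches_addBlock (P := labellingProgram) (w := w) (l := 25)
    (pc := 29) (tl := labellingProgram.drop 35) rfl (by omega) hb1
    ((hf1 3 (by omega)).trans h3) (hin.fst ⟨i, hi⟩) (by omega) (by omega)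
    (s := partialSum ends π (i + 1) (ends ⟨i, hi⟩).1)
    (by rw [h18, hsum _ _ (Or.inl rfl), hs1]) (lt_of_le_of_lt (partialSum_le _ _ _) hb')
  set M₂ := Function.update M (2 + 3 * m + (ends ⟨i, hi⟩).1) _ with hM₂
  have hb2 : BaseRegs m R₂ := hb1.congr fun r hr => hf2 r (by omega) (by omega) (by omega)
  have hin2 : HasInput ends M₂ := hin.update (by omega) _
  obtain ⟨R₃, r4, h33, hf3⟩ := reaches_addBlock (P := labellingProgram) (w := w) (l := 25)
    (pc := 35) (tl := labellingProgram.drop 41) rfl (by omega) hb2 h23 (hin2.snd ⟨i, hi⟩)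
    (by omega) (by omega) (s := partialSum ends π (i + 1) (ends ⟨i, hi⟩).2)
    -- The two ends differ, so the first addition has not touched the sum at the second end.
    (by rw [hf2 8 (by omega) (by omega) (by omega), h18, hM₂, Function.update_of_ne (by omega),
          hsum _ _ (Or.inr rfl), hs2]) (lt_of_le_of_lt (partialSum_le _ _ _) hb')
  set M₃ := Function.update M₂ (2 + 3 * m + (ends ⟨i, hi⟩).2) _ with hM₃
  have hb3 : BaseRegs m R₃ := hb2.congr fun r hr => hf3 r (by omega) (by omega) (by omega)
  have hin3 : HasInput ends M₃ := hin2.update (by omega) _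
  have h36 : R₃ 6 = 2 + 2 * m + i := by
    rw [hf3 6 (by omega) (by omega) (by omega), hf2 6 (by omega) (by omega) (by omega),
      hf1 6 (by omega), h6]
  have r5 := reaches_block (P := labellingProgram) (w := w) (l := 25) (pc := 41)
    (b := [.add 6 6 2]) (tl := labellingProgram.drop 42) rfl (by simp [Instr.IsStraight])
    (by simp) R₃ M₃
  have e : (blockEffect w [.add 6 6 2] (R₃, M₃)) =
      (Function.update R₃ 6 (2 + 2 * m + i + 1), M₃) := by
    simp [blockEffect, Instr.effect, h36, hb3.two,
      Nat.mod_eq_of_lt (show 2 + 2 * m + i + 1 < 2 ^ w by omega)]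
  rw [e] at r5
  have r6 := reaches_jump (P := labellingProgram) (w := w) (l := 25) (pc := 42) (a := 27) rfl
    (by omega) (Function.update R₃ 6 (2 + 2 * m + i + 1)) M₃
  refine ⟨_, (((((r1.trans r2).trans r3).trans r4).trans r5).trans r6), rfl,
    hb3.congr fun r hr => Function.update_of_ne (by omega) _ _, ?_, ?_, hin3, ?_, ?_⟩
  · change Function.update R₃ 6 (2 + 2 * m + i + 1) 3 = _
    rw [Function.update_of_ne (by omega)]
    omega
  · exact Function.update_self 6 (2 + 2 * m + i + 1) R₃
  · intro j
    change M₃ _ = _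
    rw [hM₃, Function.update_of_ne (by omega), hM₂, Function.update_of_ne (by omega), hout]
  · intro j v hv
    change M₃ _ = _
    rw [hM₃]
    by_cases h2 : v = (ends ⟨i, hi⟩).2
    · rw [h2, Function.update_self]
    have h2' : (v : ℕ) ≠ (ends ⟨i, hi⟩).2 := fun h => h2 (Fin.ext h)
    rw [Function.update_of_ne (by omega), hM₂]
    by_cases h1 : v = (ends ⟨i, hi⟩).1
    · rw [h1, Function.update_self]
    have h1' : (v : ℕ) ≠ (ends ⟨i, hi⟩).1 := fun h => h1 (Fin.ext h)
    rw [Function.update_of_ne (by omega), hsum j v hv, partialSum_succ π hi,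
      if_neg (by simp [IsEnd, h1, h2]), add_zero]

theorem AtSum.exists_atCompare {π : Perm (Fin m)} (hw : (n + m + 2) ^ 2 ≤ 2 ^ w)
    (hne : ∀ j, (ends j).1 ≠ (ends j).2) (d : ℕ) {i : ℕ} (hi : i + d = m) {c : Config}
    (hc : AtSum ends i π c) :
    ∃ c', Reaches labellingProgram w 25 (16 * d + 2) c c' ∧ AtCompare ends 0 π c' := by
  induction d generalizing i c with
  | zero =>
    have hb := wordSize_bound hw
    obtain rfl : i = m := hi
    obtain ⟨pc, R, M⟩ := c
    obtain ⟨rfl, hR, h3, h6, hin, hout, hsum⟩ := hc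
    simp only at hR h3 h6 hin hout hsum
    have r1 := reaches_jeq_of_eq (P := labellingProgram) (w := w) (l := 25) (pc := 27) (k := 43)
      (a := 6) (b := 5) rfl (by omega) (R := R) (by rw [h6, hR.five]; omega) M
    have r2 := reaches_block (P := labellingProgram) (w := w) (l := 25) (pc := 43)
      (b := [.const 3 2]) (tl := labellingProgram.drop 44) rfl (by simp [Instr.IsStraight])
      (by simp) R M
    have e : (blockEffect w [.const 3 2] (R, M)) = (Function.update R 3 2, M) := by
      simp [blockEffect, Instr.effect, Nat.mod_eq_of_lt (show 2 < 2 ^ w by omega)]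
    rw [e] at r2
    exact ⟨_, r1.trans r2, rfl, hR.congr fun r hr => Function.update_of_ne (by omega) _ _,
      Function.update_self 3 2 R, hin, hout, hsum⟩
  | succ d ih =>
    obtain ⟨c₁, h1, h2⟩ := hc.step hw (by omega) (hne _)
    obtain ⟨c', h3, h4⟩ := ih (by omega) h2
    refine ⟨c', ?_, h4⟩
    have := h1.trans h3
    rwa [show 16 + (16 * d + 2) = 16 * (d + 1) + 2 by ring] at this

/-- Each edge with different sums costs 11 instructions. The number of steps is only bounded, since
the first edge with equal sums ends the round; the input is then still intact, as a new round
requires. -/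
theorem AtCompare.exists_reaches {π : Perm (Fin m)} (hw : (n + m + 2) ^ 2 ≤ 2 ^ w)
    (d : ℕ) {i : ℕ} (hi : i + d = m) {c : Config} (hc : AtCompare ends i π c) :
    ∃ k c', k ≤ 11 * d + 1 ∧ Reaches labellingProgram w 25 k c c' ∧
      ((∀ j : Fin m, i ≤ j → partialSum ends π m (ends j).1 ≠ partialSum ends π m (ends j).2) ∧
          c'.pc = 55 ∧ (∀ j, readLabels m c' j = π j + 1) ∨
        (∃ j : Fin m, i ≤ j ∧ partialSum ends π m (ends j).1 = partialSum ends π m (ends j).2) ∧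
          AtStart ends c') := by
  have hb := wordSize_bound hw
  induction d generalizing i c with
  | zero =>
    obtain rfl : i = m := hi
    obtain ⟨pc, R, M⟩ := c
    obtain ⟨rfl, hR, h3, hin, hout, hsum⟩ := hc
    simp only at hR h3
    have r1 := reaches_jeq_of_eq (P := labellingProgram) (w := w) (l := 25) (pc := 44) (k := 55)
      (a := 3) (b := 4) rfl (by omega) (R := R) (by rw [h3, hR.four]) M
    exact ⟨1, _, by omega, r1, Or.inl ⟨fun j hj => by omega, rfl, hout⟩⟩
  | succ d ih =>
    obtain ⟨pc, R, M⟩ := c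
    obtain ⟨rfl, hR, h3, hin, hout, hsum⟩ := hc
    simp only at hR h3 hin hout hsum
    have him : i < m := by omega
    have hv := (ends ⟨i, him⟩).1.2
    have hv' := (ends ⟨i, him⟩).2.2
    have r1 := reaches_jeq_of_ne (P := labellingProgram) (w := w) (l := 25) (pc := 44) (k := 55)
      (a := 3) (b := 4) rfl (by omega) (R := R) (by rw [h3, hR.four]; omega) M
    obtain ⟨R₂, r2, h27, h28, h23, hf2⟩ := reaches_loadBlock (P := labellingProgram) (w := w)
      (l := 25) (pc := 45) (tl := labellingProgram.drop 53) rfl (by omega) hR h3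
      (hin.fst ⟨i, him⟩) (hin.snd ⟨i, him⟩) (by omega) (by omega) (by omega)
    rw [hsum ⟨i, him⟩ _ (Or.inl rfl)] at h27
    rw [hsum ⟨i, him⟩ _ (Or.inr rfl)] at h28
    have hb2 : BaseRegs m R₂ := hR.congr fun r hr => hf2 r (by omega) (by omega) (by omega)
    by_cases heq : R₂ 7 = R₂ 8
    · have r3 := reaches_jeq_of_eq (P := labellingProgram) (w := w) (l := 25) (pc := 53) (k := 0)
        rfl (by omega) heq M
      refine ⟨10, _, by omega, (r1.trans r2).trans r3, Or.inr ⟨⟨⟨i, him⟩, le_rfl, ?_⟩,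
        rfl, hb2.nine, hin⟩⟩
      rw [← h27, ← h28, heq]
    · have r3 := reaches_jeq_of_ne (P := labellingProgram) (w := w) (l := 25) (pc := 53) (k := 0)
        rfl (by omega) heq M
      have r4 := reaches_jump (P := labellingProgram) (w := w) (l := 25) (pc := 54) (a := 44) rfl
        (by omega) R₂ M
      obtain ⟨k, c', hk, r5, h5⟩ := ih (i := i + 1) (by omega) (c := ⟨44, R₂, M⟩)
        ⟨rfl, hb2, h23, hin, hout, hsum⟩
      refine ⟨11 + k, c', by omega, (((r1.trans r2).trans r3).trans r4).trans r5, ?_⟩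
      rcases h5 with ⟨h6, h7⟩ | ⟨⟨j, hj, h6⟩, h7⟩
      · refine Or.inl ⟨fun j hj => ?_, h7⟩
        by_cases hji : (j : ℕ) = i
        · obtain rfl : j = ⟨i, him⟩ := Fin.ext hji
          rwa [← h27, ← h28]
        · exact h6 j (by omega)
      · exact Or.inr ⟨⟨j, by omega, h6⟩, h7⟩

/-- The check at the end of a round either finishes the program or starts another round. -/
theorem AtCheck.exists_reaches {π : Perm (Fin m)} {c : Config} (hc : AtCheck ends π c)
    (hw : (n + m + 2) ^ 2 ≤ 2 ^ w) {G : SimpleGraph (Fin n)} (edge : Fin m ≃ G.edgeSet)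
    (hends : ∀ i, s((ends i).1, (ends i).2) = (edge i : Sym2 (Fin n))) :
    ∃ k c₁ c', k ≤ 27 * m + 4 ∧ ¬ Halted labellingProgram c ∧
      step labellingProgram w c = PMF.pure c₁ ∧ Reaches labellingProgram w 25 k c₁ c' ∧
      (GoodPerm edge π ∧ c'.pc = 55 ∧ (∀ j, readLabels m c' j = π j + 1) ∨
        ¬ GoodPerm edge π ∧ AtStart ends c') := by
  have hne : ∀ j, (ends j).1 ≠ (ends j).2 := fun j => by
    have := (edge j).2
    rw [← hends, SimpleGraph.mem_edgeSet] at this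
    exact this.ne
  obtain ⟨c₁, c₂, h1, h2, r2, h3⟩ := hc.reaches hw
  obtain ⟨c₃, r3, h4⟩ := h3.exists_atCompare hw hne m (by omega)
  obtain ⟨k, c', hk, r4, h5⟩ := h4.exists_reaches hw m (by omega)
  refine ⟨_, c₁, c', ?_, h1, h2, (r2.trans r3).trans r4, ?_⟩
  · omega
  · rw [goodPerm_iff_partialSum edge hends]
    push Not
    simpa using h5

end LabellingCheck

/-! ### Renewal arguments over the rounds -/

section LabellingResults
open Finset Equiv

variable {n m w : ℕ} {ends : Fin m → Fin n × Fin n} {G : SimpleGraph (Fin n)}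

theorem sampleProb_eq_zero {P : Program} {l : ℕ} {Φ : List (Fin m → ℕ) → Config → Prop}
    (h : ∀ L q, ¬ Φ L q) (c : Config) : sampleProb P w m l Φ c = 0 := by
  simp [sampleProb, haltProb, h]

/-- One round of the program. -/
theorem AtStart.exists_round {c : Config} (hc : AtStart ends c)
    (hw : (n + m + 2) ^ 2 ≤ 2 ^ w) (edge : Fin m ≃ G.edgeSet)
    (hends : ∀ i, s((ends i).1, (ends i).2) = (edge i : Sym2 (Fin n))) :
    ∃ F : Perm (Fin m) → Config,
      (∀ π, GoodPerm edge π → Halted labellingProgram (F π) ∧ (F π).pc ≠ 25 ∧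
        ∀ j, readLabels m (F π) j = π j + 1) ∧
      (∀ π, ¬ GoodPerm edge π → AtStart ends (F π)) ∧
      (∀ Φ : List (Fin m → ℕ) → Config → Prop, sampleProb labellingProgram w m 25 Φ c =
        (m.factorial : ℝ≥0∞)⁻¹ * ∑ π : Perm (Fin m), sampleProb labellingProgram w m 25
          (fun L => Φ ((fun j => (π j : ℕ) + 1) :: L)) (F π)) ∧
      ∀ t, timeWithin labellingProgram w t c ≤ (44 * m + 14 : ℕ) +
        (m.factorial : ℝ≥0∞)⁻¹ * ∑ π : Perm (Fin m), timeWithin labellingProgram w t (F π) := by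
  obtain ⟨F, hF, hF'⟩ := hc.exists_atCheck hw
  have := fun π => (hF π).exists_reaches hw edge hends
  choose k c₁ F' hk h1 h2 h3 h4 using this
  refine ⟨F', fun π hπ => ?_, fun π hπ => ?_, fun Φ => ?_, fun t => ?_⟩
  · rcases h4 π with ⟨_, h5, h6⟩ | ⟨h5, _⟩
    · exact ⟨by rw [Halted, h5]; rfl, by omega, h6⟩
    · exact absurd hπ h5
  · rcases h4 π with ⟨h5, _, _⟩ | ⟨_, h5⟩
    · exact absurd h5 hπ
    · exact h5
  · have h := hF' 0 _ (isAveraged_sampleProb Φ) 0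
    rw [mul_zero, zero_add] at h
    rw [h]
    congr 1
    refine sum_congr rfl fun π _ => ?_
    rw [sampleProb_of_eq (h1 π) (hF π).pc, h2, PMF.mean_pure]
    have h5 := (isAveraged_sampleProb (P := labellingProgram) (w := w) (l := 25)
      fun L => Φ (readLabels m (F π) :: L)).reaches (h3 π) 0
    rw [mul_zero, zero_add] at h5
    rw [h5, show readLabels m (F π) = fun j => (π j : ℕ) + 1 from funext (hF π).out]
  · have h := hF' 1 _ isAveraged_timeWithin t
    have h6 : ∀ π, timeWithin labellingProgram w t (F π) ≤
        (27 * m + 5 : ℕ) + timeWithin labellingProgram w t (F' π) := fun π => by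
      -- By monotonicity the same time limit `t` is kept on both sides, at the price of an
      -- inequality; this makes the recursion for the expected time solvable.
      calc timeWithin labellingProgram w t (F π)
          ≤ timeWithin labellingProgram w (t + k π + 1) (F π) := timeWithin_mono (by omega) _
        _ = (k π + 1 : ℕ) + timeWithin labellingProgram w t (F' π) := by
          rw [timeWithin_succ (h1 π), h2, PMF.mean_pure,
            (isAveraged_timeWithin (l := 25)).reaches (h3 π) t]
          push_cast
          ring
        _ ≤ _ := by
          exact add_le_add (Nat.cast_le.2 (Nat.succ_le_succ (hk π))) le_rfl
    have h7 : (m.factorial : ℝ≥0∞)⁻¹ * #(univ : Finset (Perm (Fin m))) = 1 := by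
      rw [card_univ, Fintype.card_perm, Fintype.card_fin]
      exact ENNReal.inv_mul_cancel (by simp [m.factorial_ne_zero]) (ENNReal.natCast_ne_top _)
    calc timeWithin labellingProgram w t c
        ≤ timeWithin labellingProgram w (t + (9 + 17 * m)) c := timeWithin_mono (by omega) _
      _ ≤ (9 + 17 * m : ℕ) * 1 + (m.factorial : ℝ≥0∞)⁻¹ *
          ∑ π, ((27 * m + 5 : ℕ) + timeWithin labellingProgram w t (F' π)) := by
        rw [h]
        gcongr with π
        exact h6 π
      _ = _ := by
        rw [sum_add_distrib, sum_const, nsmul_eq_mul, mul_add, ← mul_assoc, h7]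
        push_cast
        ring

open Classical in
theorem average_eq (edge : Fin m ≃ G.edgeSet) (a b : ℝ≥0∞) :
    (m.factorial : ℝ≥0∞)⁻¹ * ∑ π : Perm (Fin m), (if GoodPerm edge π then a else b) =
      successProb G * a + (1 - successProb G) * b := by
  have h1 : (#{π | GoodPerm edge π} : ℝ≥0∞) + (#{π | ¬ GoodPerm edge π} : ℝ≥0∞) =
      m.factorial := by
    rw [← Nat.cast_add, card_filter_add_card_filter_not, card_univ, Fintype.card_perm,
      Fintype.card_fin]
  have h2 : 1 - successProb G = (m.factorial : ℝ≥0∞)⁻¹ * (#{π | ¬ GoodPerm edge π} : ℝ≥0∞) := by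
    have h3 : (m.factorial : ℝ≥0∞)⁻¹ * m.factorial = 1 :=
      ENNReal.inv_mul_cancel (by simp [m.factorial_ne_zero]) (ENNReal.natCast_ne_top _)
    rw [successProb_eq edge, div_eq_mul_inv, mul_comm _ (_ : ℝ≥0∞)⁻¹]
    refine ENNReal.sub_eq_of_eq_add (ENNReal.mul_ne_top (ENNReal.inv_ne_top.2
      (Nat.cast_ne_zero.2 m.factorial_ne_zero)) (ENNReal.natCast_ne_top _)) ?_
    rw [← mul_add, add_comm, h1, h3]
  rw [h2, successProb_eq edge, sum_ite, sum_const, sum_const, nsmul_eq_mul, nsmul_eq_mul, mul_add,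
    div_eq_mul_inv]
  ring

theorem successProb_le_one (edge : Fin m ≃ G.edgeSet) : successProb G ≤ 1 := by
  classical
  rw [successProb_eq edge]
  refine ENNReal.div_le_of_le_mul ?_
  rw [one_mul, Nat.cast_le]
  refine (card_filter_le _ _).trans ?_
  rw [card_univ, Fintype.card_perm, Fintype.card_fin]

/-- Induction over the rounds: a labelling determines its permutation, so in the average over the
first round only one of the m! terms survives. -/
theorem sampleProb_eq_list (hw : (n + m + 2) ^ 2 ≤ 2 ^ w) (edge : Fin m ≃ G.edgeSet)
    (hends : ∀ i, s((ends i).1, (ends i).2) = (edge i : Sym2 (Fin n)))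
    {π : Perm (Fin m)} (hπ : GoodPerm edge π) (L : List (Perm (Fin m)))
    (hL : ∀ σ ∈ L, ¬ GoodPerm edge σ) {c : Config} (hc : AtStart ends c) :
    sampleProb labellingProgram w m 25
        (fun l _ => l = (L ++ [π]).map fun σ => fun j => (σ j : ℕ) + 1) c =
      (m.factorial : ℝ≥0∞)⁻¹ ^ (L.length + 1) := by
  have hinj : ∀ σ τ : Perm (Fin m), ((fun j => (σ j : ℕ) + 1) = fun j => (τ j : ℕ) + 1) → σ = τ :=
    fun σ τ h => Perm.ext fun j => Fin.ext (by have := congrFun h j; simpa using this)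
  induction L generalizing c with
  | nil =>
    obtain ⟨F, h1, h2, h3, -⟩ := hc.exists_round hw edge hends
    rw [h3, sum_eq_single π]
    · obtain ⟨h4, h5, -⟩ := h1 π hπ
      rw [sampleProb_of_halted h4 h5]
      simp
    · intro σ _ hσ
      refine sampleProb_eq_zero (fun l _ h => hσ (hinj σ π ?_)) _
      simpa using (List.cons.inj h).1
    · simp
  | cons σ L ih =>
    obtain ⟨F, h1, h2, h3, -⟩ := hc.exists_round hw edge hends
    rw [h3, sum_eq_single σ]
    · have := ih (fun τ hτ => hL τ (by simp [hτ])) (h2 σ (hL σ (by simp)))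
      simp only [List.cons_append, List.map_cons, List.cons.injEq, true_and]
      rw [this, List.length_cons, pow_succ' _ (L.length + 1)]
    · intro τ _ hτ
      exact sampleProb_eq_zero (fun l _ h => hτ (hinj τ σ (List.cons.inj h).1)) _
    · simp

theorem sampleProb_length (hw : (n + m + 2) ^ 2 ≤ 2 ^ w) (edge : Fin m ≃ G.edgeSet)
    (hends : ∀ i, s((ends i).1, (ends i).2) = (edge i : Sym2 (Fin n))) (r : ℕ) {c : Config}
    (hc : AtStart ends c) :
    sampleProb labellingProgram w m 25 (fun l _ => l.length = r + 1) c =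
      (1 - successProb G) ^ r * successProb G := by
  classical
  induction r generalizing c with
  | zero =>
    obtain ⟨F, h1, h2, h3, -⟩ := hc.exists_round hw edge hends
    have h4 : ∀ π, sampleProb labellingProgram w m 25
        (fun l _ => ((fun j => (π j : ℕ) + 1) :: l).length = 0 + 1) (F π) =
        if GoodPerm edge π then 1 else 0 := fun π => by
      split_ifs with hπ
      · obtain ⟨h4, h5, -⟩ := h1 π hπ
        rw [sampleProb_of_halted h4 h5]
        simp
      · obtain ⟨F', -, -, h6, -⟩ := (h2 π hπ).exists_round hw edge hends
        rw [h6, sum_eq_zero, mul_zero]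
        intro σ _
        exact sampleProb_eq_zero (by simp) _
    rw [h3, sum_congr rfl fun π _ => h4 π, average_eq]
    simp
  | succ r ih =>
    obtain ⟨F, h1, h2, h3, -⟩ := hc.exists_round hw edge hends
    have h4 : ∀ π, sampleProb labellingProgram w m 25
        (fun l _ => ((fun j => (π j : ℕ) + 1) :: l).length = r + 1 + 1) (F π) =
        if GoodPerm edge π then 0 else (1 - successProb G) ^ r * successProb G := fun π => by
      split_ifs with hπ
      · obtain ⟨h4, h5, -⟩ := h1 π hπ
        rw [sampleProb_of_halted h4 h5]
        simp
      · rw [← ih (h2 π hπ)]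
        simp
    rw [h3, sum_congr rfl fun π _ => h4 π, average_eq, pow_succ]
    ring

/-- A failed round leaves altered registers and memory, so the infimum I over all starting
configurations is taken. One round gives I ≥ p + (1 − p) I, and hence I ≥ 1, as p > 0 and I is
finite. -/
theorem sampleProb_isLocalAntimagic (hw : (n + m + 2) ^ 2 ≤ 2 ^ w) (edge : Fin m ≃ G.edgeSet)
    (hends : ∀ i, s((ends i).1, (ends i).2) = (edge i : Sym2 (Fin n)))
    (hp : successProb G ≠ 0) {c : Config} (hc : AtStart ends c) :
    sampleProb labellingProgram w m 25
      (fun _ q => IsLocalAntimagic G fun e => readLabels m q (edge.symm e)) c = 1 := by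
  classical
  set I : ℝ≥0∞ := ⨅ (c : Config) (_ : AtStart ends c), sampleProb labellingProgram w m 25
    (fun _ q => IsLocalAntimagic G fun e => readLabels m q (edge.symm e)) c with hI
  have hIle : ∀ c, AtStart ends c → I ≤ sampleProb labellingProgram w m 25
    (fun _ q => IsLocalAntimagic G fun e => readLabels m q (edge.symm e)) c :=
    fun c hc => iInf₂_le c hc
  have hI1 : I ≤ 1 := (hIle c hc).trans (haltProb_le_one _ _)
  have hIt : I ≠ ∞ := ne_top_of_le_ne_top ENNReal.one_ne_top hI1
  have hp1 := successProb_le_one edge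
  have hpt : successProb G ≠ ∞ := ne_top_of_le_ne_top ENNReal.one_ne_top hp1
  have hkey : successProb G * 1 + (1 - successProb G) * I ≤ I := by
    refine le_iInf₂ fun c hc => ?_
    obtain ⟨F, h1, h2, h3, -⟩ := hc.exists_round hw edge hends
    rw [← average_eq edge, h3]
    gcongr with π
    split_ifs with hπ
    · obtain ⟨h4, h5, h6⟩ := h1 π hπ
      rw [sampleProb_of_halted h4 h5, if_pos]
      have : (fun e => readLabels m (F π) (edge.symm e)) = labelOf (edge.symm.trans π) :=
        funext fun e => h6 _
      rw [this]
      exact hπ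
    · exact hIle _ (h2 π hπ)
  have h1 : successProb G * 1 + (1 - successProb G) * I ≤
      successProb G * I + (1 - successProb G) * I := by
    rwa [← add_mul, add_tsub_cancel_of_le hp1, one_mul]
  have h2 := (ENNReal.add_le_add_iff_right (ENNReal.mul_ne_top
    (ne_top_of_le_ne_top ENNReal.one_ne_top tsub_le_self) hIt)).1 h1
  have h3 := (ENNReal.mul_le_mul_iff_right hp hpt).1 h2
  exact le_antisymm (haltProb_le_one _ _) (h3.trans (hIle c hc))

/-- The supremum S over all starting configurations satisfies S ≤ 44m + 14 + (1 − p) S. The limit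
`t` on the time makes S finite, so that (1 − p) S can be cancelled. -/
theorem successProb_mul_timeWithin_le (hw : (n + m + 2) ^ 2 ≤ 2 ^ w) (edge : Fin m ≃ G.edgeSet)
    (hends : ∀ i, s((ends i).1, (ends i).2) = (edge i : Sym2 (Fin n))) (t : ℕ)
    {c : Config} (hc : AtStart ends c) :
    successProb G * timeWithin labellingProgram w t c ≤ (44 * m + 14 : ℕ) := by
  classical
  set S : ℝ≥0∞ := ⨆ (c : Config) (_ : AtStart ends c), timeWithin labellingProgram w t c with hS
  have hle : ∀ c, AtStart ends c → timeWithin labellingProgram w t c ≤ S :=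
    fun c hc => le_iSup₂ (f := fun c (_ : AtStart ends c) => timeWithin labellingProgram w t c) c hc
  have hSt : S ≠ ∞ := ne_top_of_le_ne_top (ENNReal.natCast_ne_top t)
    (iSup₂_le fun c _ => timeWithin_le t c)
  have hp1 := successProb_le_one edge
  have hkey : S ≤ (44 * m + 14 : ℕ) + (successProb G * 0 + (1 - successProb G) * S) := by
    refine iSup₂_le fun c hc => ?_
    obtain ⟨F, h1, h2, -, h3⟩ := hc.exists_round hw edge hends
    refine (h3 t).trans ?_
    rw [← average_eq edge]
    gcongr with π
    split_ifs with hπ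
    · rw [timeWithin_of_halted (h1 π hπ).1]
    · exact hle _ (h2 π hπ)
  have h1 : successProb G * S + (1 - successProb G) * S ≤
      (44 * m + 14 : ℕ) + (1 - successProb G) * S := by
    rwa [← add_mul, add_tsub_cancel_of_le hp1, one_mul, mul_zero, zero_add] at *
  have h2 := (ENNReal.add_le_add_iff_right (ENNReal.mul_ne_top
    (ne_top_of_le_ne_top ENNReal.one_ne_top tsub_le_self) hSt)).1 h1
  refine le_trans ?_ h2
  gcongr
  exact hle c hc

theorem one_le_mul_successProb (edge : Fin m ≃ G.edgeSet) (hm : 1 ≤ m) (hG : NoIsolatedEdge G) :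
    1 ≤ 100 * (m : ℝ≥0∞) * successProb G := by
  have h := le_successProb edge hm hG
  rw [ENNReal.div_le_iff (by simp; omega) (ENNReal.natCast_ne_top _)] at h
  calc (1 : ℝ≥0∞) = 100 * (((1 : ℝ≥0) / 100 : ℝ≥0) : ℝ≥0∞) := by
        rw [← ENNReal.coe_ofNat, ← ENNReal.coe_mul, ← ENNReal.coe_one, ENNReal.coe_inj]
        norm_num
    _ ≤ 100 * (successProb G * m) := by gcongr
    _ = _ := by ring

theorem expectedTime_le (hw : (n + m + 2) ^ 2 ≤ 2 ^ w) (edge : Fin m ≃ G.edgeSet)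
    (hends : ∀ i, s((ends i).1, (ends i).2) = (edge i : Sym2 (Fin n))) (hm : 1 ≤ m)
    (hG : NoIsolatedEdge G) {c : Config} (hc : AtStart ends c) :
    expectedTime labellingProgram w c ≤ ((5800 : ℝ≥0) : ℝ≥0∞) * (m : ℝ≥0∞) ^ 2 := by
  rw [expectedTime_eq_iSup]
  refine iSup_le fun t => ?_
  have h1 := one_le_mul_successProb edge hm hG
  have h2 := successProb_mul_timeWithin_le hw edge hends t hc
  calc timeWithin labellingProgram w t c = 1 * timeWithin labellingProgram w t c := (one_mul _).symm
    _ ≤ 100 * m * successProb G * timeWithin labellingProgram w t c := by gcongr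
    _ = 100 * m * (successProb G * timeWithin labellingProgram w t c) := by ring
    _ ≤ 100 * m * (44 * m + 14 : ℕ) := by gcongr
    -- As m ≥ 1, one has 44m + 14 ≤ 58m; this gives the constant 5800 = 100 · 58.
    _ ≤ 100 * m * (58 * m : ℕ) := by
      gcongr
      omega
    _ = _ := by
      push_cast
      ring

end LabellingResults

theorem mainTheorem7 :
    ∃ (P : Program) (l k : ℕ) (c C : ℝ≥0), 0 < c ∧
      ∀ (n m w : ℕ) (G : SimpleGraph (Fin n)) (edge : Fin m ≃ G.edgeSet)
        (ends : Fin m → Fin n × Fin n),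
        (∀ i, s((ends i).1, (ends i).2) = (edge i : Sym2 (Fin n))) →
        1 ≤ m → NoIsolatedEdge G → (n + m + 2) ^ k ≤ 2 ^ w →
        -- the success probability of a round is `Ω(1/m)`
        (c : ℝ≥0∞) / (m : ℝ≥0∞) ≤ successProb G ∧
        -- the program samples independent uniform labellings until one is local antimagic
        (∀ (L : List (G.edgeSet ≃ Fin m)) (f : G.edgeSet ≃ Fin m),
          (∀ g ∈ L, ¬ IsLocalAntimagic G (labelOf g)) → IsLocalAntimagic G (labelOf f) →
          haltProb P w (initConfig ends)
              (fun h => sampledLabels m l h =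
                (L ++ [f]).map (fun g => fun i => labelOf g (edge i))) =
            (1 / (Nat.factorial m : ℝ≥0∞)) ^ (L.length + 1)) ∧
        -- the number of rounds is geometric
        (∀ r : ℕ,
          haltProb P w (initConfig ends) (fun h => (sampledLabels m l h).length = r + 1) =
            (1 - successProb G) ^ r * successProb G) ∧
        -- almost surely the program halts, and its output is a local antimagic labelling
        haltProb P w (initConfig ends)
            (fun h => ∃ q ∈ h.head?, IsLocalAntimagic G (fun e => readLabels m q (edge.symm e))) =
          1 ∧
        -- the expected running time is `O(m ^ 2)`
        expectedTime P w (initConfig ends) ≤ (C : ℝ≥0∞) * (m : ℝ≥0∞) ^ 2 := by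
  refine ⟨labellingProgram, 25, 2, 1 / 100, 5800, by norm_num, ?_⟩
  intro n m w G edge ends hends hm hG hw
  have hstart : AtStart ends (initConfig ends) := atStart_initConfig
  refine ⟨le_successProb edge hm hG, fun L f hL hf => ?_, fun r => ?_, ?_,
    expectedTime_le hw edge hends hm hG hstart⟩
  · rw [haltProb_eq_sampleProb (fun l => l = (L ++ [f]).map fun g => fun i => labelOf g (edge i))]
    have hgood : ∀ g : G.edgeSet ≃ Fin m,
        GoodPerm edge (edge.trans g) ↔ IsLocalAntimagic G (labelOf g) := fun g => by
      rw [GoodPerm, ← Equiv.trans_assoc, Equiv.symm_trans_self, Equiv.refl_trans]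
    have h := sampleProb_eq_list hw edge hends ((hgood f).2 hf)
      (L.map fun g => edge.trans g) (by
        simp only [List.mem_map, forall_exists_index, and_imp, forall_apply_eq_imp_iff₂]
        exact fun g hg => fun h => hL g hg ((hgood g).1 h)) hstart
    rw [List.length_map] at h
    rw [one_div, ← h]
    congr
    funext l q
    simp [labelOf, Function.comp_def]
  · rw [haltProb_eq_sampleProb (fun l => l.length = r + 1)]
    exact sampleProb_length hw edge hends r hstart
  · refine sampleProb_isLocalAntimagic hw edge hends (fun h => ?_) hstart
    have := one_le_mul_successProb edge hm hG
    simp [h] at this
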